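/- Let $B^0=(b^0_{ij})$ be an $n\times n$ integer matrix and $D=\operatorname{diag}(d_1,\dots,d_n)$ with positive integers $d_j$ such that $DB^0$ is skew-symmetric. Let $\mathbb T_n$ be the $n$-regular tree with edges labelled by $1,\dots,n$ (the edges at each vertex having distinct labels), and let $t_0\in\mathbb T_n$ be a base vertex. For $j\in[1,n]$, $t\in\mathbb T_n$ let - $F^{B^0;t_0}_{j;t}\in\mathbb Z[u_1,\dots,u_n]$ be the classical $F$-polynomial and $\mathbf g_{j;t}\in\mathbb Z^n$ the $\mathbf g$-vector, i.e. the specialization at $x_i=1$, $y_i=u_i$ of the cluster variable $x_{j;t}$ of the classical cluster algebra with principal coefficients $\binom{B^0}{I}$ at $t_0$ and initial extended cluster $(x_1,\dots,x_n,y_1,\dots,y_n)$, and the degree of this cluster variable for the grading $\deg x_i=\mathbf e_i$, $\deg y_l=-(\text{column } l \text{ of } B^0)$; - $F_{j;t}=F_{j;t}^{B^0;D;t_0}$ be the (left) quantum $F$-polynomial, i.e. the unique polynomial with coefficients in $\mathbb Z[q^{\pm1/2}]$ in variables $Z_1,\dots,Z_n$ with $Z_iZ_l=q^{d_ib^0_{il}}Z_lZ_i$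 such that $X_{j;t}=F_{j;t}(\hat Y)M_0(\mathbf g_{j;t})$ in the quantum cluster algebras with principal coefficients $\mathcal A_\bullet(B^0,D,\Lambda,t_0)$, for all skew-symmetric integer $n\times n$ matrices $\Lambda$ (where $\mathbf g_{j;t}$ is extended by $n$ zeros). Let $\tilde B^0$ be an $m\times n$ integer matrix ($m\ge n$) whose top $n\times n$ part is $B^0$, and let $\Lambda_0$ be a skew-symmetric integer $m\times m$ matrix with $(\tilde B^0)^T\Lambda_0=(D\,|\,0)$. Consider the quantum cluster algebra with quantum seed $(M_0,\tilde B^0)$ at $t_0$, where the toric frame $M_0$ satisfies $M_0(\mathbf c)M_0(\mathbf d)=q^{\Lambda_0(\mathbf c,\mathbf d)/2}M_0(\mathbf c+\mathbf d)$. Let $M_t$ be its toric frame at $t$, let $\Lambda_t$ be the skew-symmetric bilinear form on $\mathbb Z^m$ with $M_t(\mathbf c)M_t(\mathbf d)=q^{\Lambda_t(\mathbf c,\mathbf d)/2}M_t(\mathbf c+\mathbf d)$, let $X_{j;t}=M_t(\mathbf e_j)$ be its cluster variables, and put $\hat Y_l=M_0(\tilde{\mathbf b}^l)$, where $\tilde{\mathbf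 b}^l$ is the $l$th column of $\tilde B^0=(b^0_{il})$. Let $\tilde{\mathbf g}_{j;t}\in\mathbb Z^m$ be the extended $\mathbf g$-vectors: for $j\in[1,n]$, $\tilde{\mathbf g}_{j;t}=(g_1,\dots,g_m)$ is the unique vector such that $x_{j;t}=F^{B^0;t_0}_{j;t}(\hat y_1,\dots,\hat y_n)\,x_1^{g_1}\cdots x_m^{g_m}$, $\hat y_l=\prod_{i=1}^m x_i^{b^0_{il}}$, in the classical cluster algebra with exchange matrix $\tilde B^0$ at $t_0$ and initial extended cluster $(x_1,\dots,x_m)$, and $\tilde{\mathbf g}_{j;t}=\mathbf e_j$ for $j\in[n+1,m]$. **Theorem.** Suppose that $F^{B^0;t_0}_{j;t}$ has nonzero constant term for all $j\in[1,n]$ and $t\in\mathbb T_n$. Then in every quantum cluster algebra as above, for all $t\in\mathbb T_n$, $$X_{j;t}=F_{j;t}(\hat Y_1,\dots,\hat Y_n)\,M_0(\tilde{\mathbf g}_{j;t})\qquad(j\in[1,n]),$$ and moreover $\Lambda_t(\mathbf e_i,\mathbf e_j)=\Lambda_0(\tilde{\mathbf g}_{i;t},\tilde{\mathbf g}_{j;t})$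 for all $i,j\in[1,m]$. -/

import Mathlib

open scoped LaurentPolynomial

/-- The vertices of the `n`-regular tree `𝕋_n` with edges labelled by `1, …, n`, rooted at the
initial vertex `t₀`.  A vertex is encoded by the sequence of labels (last label first) along the
unique path that leads to it from `t₀`; such sequences are exactly the words without two equal
consecutive letters, and `t₀` is the empty word. -/
def TreeVertex (n : ℕ) : Type := {w : List (Fin n) // w.IsChain (· ≠ ·)}

/-- Matrix mutation in direction `k`.  An `m × n` exchange matrix has its rows indexed by
`Fin n ⊕ Fin r`, where `m = n + r`; the rows `Sum.inl i` form the principal part. -/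
def matMut {n r : ℕ} (B : Matrix (Fin n ⊕ Fin r) (Fin n) ℤ) (k : Fin n) :
    Matrix (Fin n ⊕ Fin r) (Fin n) ℤ := fun i j =>
  if i = Sum.inl k ∨ j = k then - B i j
  else B i j + Int.sign (B i k) * max (B i k * B (Sum.inl k) j) 0

/-- The principal matrix with principal part `B⁰`: the identity matrix placed below `B⁰`. -/
def principalMatrix {n : ℕ} (B0 : Matrix (Fin n) (Fin n) ℤ) :
    Matrix (Fin n ⊕ Fin n) (Fin n) ℤ := Matrix.fromRows B0 1

noncomputable section Classical

/-! ### Classical cluster algebras, `F`-polynomials and `g`-vectors -/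

/-- An extended cluster in a field `L` together with an exchange matrix. -/
structure ClassicalSeed (n r : ℕ) (L : Type*) where
  var : Fin n ⊕ Fin r → L
  mat : Matrix (Fin n ⊕ Fin r) (Fin n) ℤ

/-- Seed mutation; here `(b).toNat = [b]₊`. -/
def ClassicalSeed.mutate {n r : ℕ} {L : Type*} [Field L] (s : ClassicalSeed n r L) (k : Fin n) :
    ClassicalSeed n r L where
  var := Function.update s.var (Sum.inl k)
    ((s.var (Sum.inl k))⁻¹ *
      (∏ i, s.var i ^ (s.mat i k).toNat + ∏ i, s.var i ^ (-(s.mat i k)).toNat))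
  mat := matMut s.mat k

/-- The seed reached from `s` by mutating along a word (last letter first). -/
def ClassicalSeed.along {n r : ℕ} {L : Type*} [Field L] (s : ClassicalSeed n r L) :
    List (Fin n) → ClassicalSeed n r L
  | [] => s
  | k :: w => (s.along w).mutate k

/-- The ambient field `ℚ(x₁, …, x_m)`. -/
abbrev AmbientField (n r : ℕ) : Type := FractionRing (MvPolynomial (Fin n ⊕ Fin r) ℤ)

/-- The initial extended cluster `x₁, …, x_m`. -/
def initVar {n r : ℕ} (i : Fin n ⊕ Fin r) : AmbientField n r :=
  algebraMap (MvPolynomial (Fin n ⊕ Fin r) ℤ) (AmbientField n r) (MvPolynomial.X i)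

/-- The cluster variable `x_{j;t}` of the cluster algebra of geometric type whose seed at `t₀` is
`((x₁, …, x_m), B̃)`. -/
def clusterVar {n r : ℕ} (B : Matrix (Fin n ⊕ Fin r) (Fin n) ℤ) (j : Fin n) (t : TreeVertex n) :
    AmbientField n r :=
  ((ClassicalSeed.mk initVar B).along t.1).var (Sum.inl j)

/-- The substitution `x_i ↦ 1`, `y_i ↦ u_i`. -/
def specialize (n : ℕ) : MvPolynomial (Fin n ⊕ Fin n) ℤ →ₐ[ℤ] MvPolynomial (Fin n) ℤ :=
  MvPolynomial.aeval (Sum.elim (fun _ => 1) MvPolynomial.X)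

/-- `p` is the value at `x₁ = ⋯ = x_n = 1`, `y_i = u_i` of the rational function `x_{j;t}` of the
cluster algebra with principal coefficients at `t₀`: writing this function as `a / b` with
polynomials `a, b` in `x₁, …, x_n, y₁, …, y_n` such that `b` does not vanish under the
substitution, `p` is the quotient of the substituted polynomials. -/
def IsFPolynomial {n : ℕ} (B0 : Matrix (Fin n) (Fin n) ℤ) (j : Fin n) (t : TreeVertex n)
    (p : MvPolynomial (Fin n) ℤ) : Prop :=
  ∃ a b : MvPolynomial (Fin n ⊕ Fin n) ℤ,
    clusterVar (principalMatrix B0) j t * algebraMap _ (AmbientField n n) b =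
      algebraMap _ (AmbientField n n) a ∧
    specialize n b ≠ 0 ∧ specialize n a = p * specialize n b

open Classical in
/-- The (nonquantum) `F`-polynomial `F_{j;t}^{B⁰;t₀}` in `ℤ[u₁, …, u_n]`. -/
def fPolynomial {n : ℕ} (B0 : Matrix (Fin n) (Fin n) ℤ) (j : Fin n) (t : TreeVertex n) :
    MvPolynomial (Fin n) ℤ :=
  if h : ∃ p, IsFPolynomial B0 j t p then h.choose else 0

/-- `g` is the degree of `x_{j;t}` (principal coefficients at `t₀`) for the `ℤⁿ`-grading with
`deg x_i = e_i` and `deg y_j = -b⁰_j`, the degree of a quotient of homogeneous polynomials being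
the difference of the degrees. -/
def IsGVector {n : ℕ} (B0 : Matrix (Fin n) (Fin n) ℤ) (j : Fin n) (t : TreeVertex n)
    (g : Fin n → ℤ) : Prop :=
  ∃ (a b : MvPolynomial (Fin n ⊕ Fin n) ℤ) (α β : Fin n → ℤ),
    b ≠ 0 ∧
    clusterVar (principalMatrix B0) j t * algebraMap _ (AmbientField n n) b =
      algebraMap _ (AmbientField n n) a ∧
    a.IsWeightedHomogeneous
      (Sum.elim (fun i => Pi.single i 1) (fun l i => - B0 i l) : Fin n ⊕ Fin n → Fin n → ℤ) α ∧
    b.IsWeightedHomogeneous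
      (Sum.elim (fun i => Pi.single i 1) (fun l i => - B0 i l) : Fin n ⊕ Fin n → Fin n → ℤ) β ∧
    g = α - β

open Classical in
/-- The `g`-vector `g_{j;t}^{B⁰;t₀}`. -/
def gVector {n : ℕ} (B0 : Matrix (Fin n) (Fin n) ℤ) (j : Fin n) (t : TreeVertex n) : Fin n → ℤ :=
  if h : ∃ g, IsGVector B0 j t g then h.choose else 0

/-- `g` satisfies `x_{j;t} = F_{j;t}(ŷ₁, …, ŷ_n) x₁^{g₁} ⋯ x_m^{g_m}`, where
`ŷ_l = ∏ᵢ xᵢ^{b⁰_{il}}`, in the cluster algebra with exchange matrix `B̃⁰` at `t₀`. -/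
def IsExtGVector {n r : ℕ} (B : Matrix (Fin n ⊕ Fin r) (Fin n) ℤ) (j : Fin n) (t : TreeVertex n)
    (g : Fin n ⊕ Fin r → ℤ) : Prop :=
  clusterVar B j t =
    MvPolynomial.aeval (fun l => ∏ i, (initVar i : AmbientField n r) ^ B i l)
      (fPolynomial B.toRows₁ j t) * ∏ i, (initVar i : AmbientField n r) ^ g i

open Classical in
/-- The extended `g`-vectors `g̃_{l;t}^{B̃⁰;t₀} ∈ ℤᵐ`; for a frozen index `l` it is `e_l`. -/
def extGVector {n r : ℕ} (B : Matrix (Fin n ⊕ Fin r) (Fin n) ℤ) (l : Fin n ⊕ Fin r)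
    (t : TreeVertex n) : Fin n ⊕ Fin r → ℤ :=
  match l with
  | Sum.inl j => if h : ∃ g, IsExtGVector B j t g then h.choose else 0
  | Sum.inr i => Pi.single (Sum.inr i) 1

end Classical

noncomputable section Quantum

/-! ### Quantum cluster algebras

The ring `ℤ[q^{±1/2}]` is `ℤ[T;T⁻¹]` with `q^{1/2} = T 1`, so that `q^{c/2} = T c`. -/

/-- `Λ` is the form `Λ_M` of `M`: one has `M(c) M(d) = q^{Λ(c,d)/2} M(c+d)`. -/
def HasForm {ι K : Type*} [Fintype ι] [DivisionRing K] [Algebra ℤ[T;T⁻¹] K]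
    (M : (ι → ℤ) → K) (Λ : Matrix ι ι ℤ) : Prop :=
  ∀ c d, M c * M d = (LaurentPolynomial.T (c ⬝ᵥ Λ.mulVec d) : ℤ[T;T⁻¹]) • M (c + d)

/-- `M` is a toric frame in the skew-field `K` with form `Λ`: the elements `M(c)` multiply as the
distinguished basis of the based quantum torus of `(ℤ^ι, Λ)`, they are linearly independent over
`ℤ[q^{±1/2}]`, and `K` is the skew-field of right fractions of their span. -/
structure IsToricFrame {ι K : Type*} [Fintype ι] [DivisionRing K] [Algebra ℤ[T;T⁻¹] K]
    (M : (ι → ℤ) → K) (Λ : Matrix ι ι ℤ) : Prop where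
  skew : Λ.transpose = -Λ
  form : HasForm M Λ
  linearIndependent : LinearIndependent ℤ[T;T⁻¹] M
  fractions : ∀ x : K, ∃ a ∈ Submodule.span ℤ[T;T⁻¹] (Set.range M),
    ∃ b ∈ Submodule.span ℤ[T;T⁻¹] (Set.range M), b ≠ 0 ∧ x = a * b⁻¹

/-- Compatibility: `B̃ᵀ Λ = (D | 0)` where `D` is diagonal with diagonal entries `d`. -/
def IsCompatible {n r : ℕ} (Λ : Matrix (Fin n ⊕ Fin r) (Fin n ⊕ Fin r) ℤ)
    (B : Matrix (Fin n ⊕ Fin r) (Fin n) ℤ) (d : Fin n → ℤ) : Prop :=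
  B.transpose * Λ = Matrix.fromCols (Matrix.diagonal d) 0

/-- The `t`-binomial coefficient `(r choose p)_t` at `t = q^{d/2}`, as an element of `K`. -/
def qBinomial (K : Type*) [DivisionRing K] [Algebra ℤ[T;T⁻¹] K] (d : ℤ) (r p : ℕ) : K :=
  algebraMap ℤ[T;T⁻¹] K (∏ i ∈ Finset.range p,
      (LaurentPolynomial.T (d * ((r : ℤ) - i)) - LaurentPolynomial.T (-(d * ((r : ℤ) - i))))) /
    algebraMap ℤ[T;T⁻¹] K (∏ i ∈ Finset.range p,
      (LaurentPolynomial.T (d * ((i : ℤ) + 1)) - LaurentPolynomial.T (-(d * ((i : ℤ) + 1)))))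

/-- The matrix `E_ε` for the sign `ε = +`. -/
def mutE {n r : ℕ} (B : Matrix (Fin n ⊕ Fin r) (Fin n) ℤ) (k : Fin n) :
    Matrix (Fin n ⊕ Fin r) (Fin n ⊕ Fin r) ℤ := fun i j =>
  if j ≠ Sum.inl k then (if i = j then 1 else 0)
  else if i = Sum.inl k then -1
  else max 0 (-(B i k))

/-- `∑_{p=0}^{c_k} (c_k choose p)_{q^{d_k/2}} M(E c + p b^k)`, meant for `c_k ≥ 0`. -/
def frameMutSum {n r : ℕ} {K : Type*} [DivisionRing K] [Algebra ℤ[T;T⁻¹] K]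
    (dk : ℤ) (M : (Fin n ⊕ Fin r → ℤ) → K) (B : Matrix (Fin n ⊕ Fin r) (Fin n) ℤ) (k : Fin n)
    (c : Fin n ⊕ Fin r → ℤ) : K :=
  ∑ p ∈ Finset.range ((c (Sum.inl k)).toNat + 1),
    qBinomial K dk (c (Sum.inl k)).toNat p *
      M ((mutE B k).mulVec c + fun i => (p : ℤ) * B i k)

/-- The data `(M, B̃)` of a quantum seed in `K`. -/
structure QuantumSeed (n r : ℕ) (K : Type*) where
  frame : (Fin n ⊕ Fin r → ℤ) → K
  mat : Matrix (Fin n ⊕ Fin r) (Fin n) ℤ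

/-- Mutation of quantum seeds in direction `k`: the displayed sum gives `M'(c)` for `c_k ≥ 0`, and
`M'(c) = M'(-c)⁻¹`. -/
def QuantumSeed.mutate {n r : ℕ} {K : Type*} [DivisionRing K] [Algebra ℤ[T;T⁻¹] K]
    (d : Fin n → ℤ) (s : QuantumSeed n r K) (k : Fin n) : QuantumSeed n r K where
  frame := fun c =>
    if 0 ≤ c (Sum.inl k) then frameMutSum (d k) s.frame s.mat k c
    else (frameMutSum (d k) s.frame s.mat k (-c))⁻¹
  mat := matMut s.mat k

/-- The quantum seed reached from `s` by mutating along a word (last letter first). -/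
def QuantumSeed.along {n r : ℕ} {K : Type*} [DivisionRing K] [Algebra ℤ[T;T⁻¹] K]
    (d : Fin n → ℤ) (s : QuantumSeed n r K) : List (Fin n) → QuantumSeed n r K
  | [] => s
  | k :: w => (s.along d w).mutate d k

/-- The toric frame `M_t` at `t` of the quantum cluster pattern whose quantum seed at `t₀` is
`(M₀, B̃⁰)`. -/
def frameAt {n r : ℕ} {K : Type*} [DivisionRing K] [Algebra ℤ[T;T⁻¹] K] (d : Fin n → ℤ)
    (M0 : (Fin n ⊕ Fin r → ℤ) → K) (B : Matrix (Fin n ⊕ Fin r) (Fin n) ℤ) (t : TreeVertex n) :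
    (Fin n ⊕ Fin r → ℤ) → K :=
  ((QuantumSeed.mk M0 B).along d t.1).frame

/-- The quantum cluster variable `X_{j;t} = M_t(e_j)`. -/
def quantumClusterVar {n r : ℕ} {K : Type*} [DivisionRing K] [Algebra ℤ[T;T⁻¹] K] (d : Fin n → ℤ)
    (M0 : (Fin n ⊕ Fin r → ℤ) → K) (B : Matrix (Fin n ⊕ Fin r) (Fin n) ℤ) (j : Fin n)
    (t : TreeVertex n) : K :=
  frameAt d M0 B t (Pi.single (Sum.inl j) 1)

/-- `Ŷ_j = M₀(b̃^j)`, where `b̃^j` is the `j`-th column of `B̃⁰`. -/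
def yHat {n r : ℕ} {K : Type*} (M0 : (Fin n ⊕ Fin r → ℤ) → K)
    (B : Matrix (Fin n ⊕ Fin r) (Fin n) ℤ) (j : Fin n) : K :=
  M0 (fun i => B i j)

/-! ### Quantum `F`-polynomials -/

/-- Polynomials in the quasi-commuting variables `Z₁, …, Z_n` with coefficients in
`ℤ[q^{±1/2}]`, given by their coefficients with respect to the basis of normalized monomials
`Z^a = q^{(1/2) ∑_{i<j} d_j b⁰_{ji} a_i a_j} Z₁^{a₁} ⋯ Z_n^{a_n}`, `a ∈ ℕⁿ`. -/
abbrev QuantumPolynomial (n : ℕ) : Type := (Fin n →₀ ℕ) →₀ ℤ[T;T⁻¹]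

/-- The value `F(Y)` obtained by setting each `Z_i` to `Y_i`. -/
def QuantumPolynomial.eval {n : ℕ} {K : Type*} [DivisionRing K] [Algebra ℤ[T;T⁻¹] K]
    (B0 : Matrix (Fin n) (Fin n) ℤ) (d : Fin n → ℤ) (Y : Fin n → K) (F : QuantumPolynomial n) : K :=
  F.sum fun a coeff =>
    coeff • (LaurentPolynomial.T
        (∑ i : Fin n, ∑ j ∈ Finset.Ioi i, d j * B0 j i * (a i : ℤ) * (a j : ℤ)) : ℤ[T;T⁻¹]) •
      (List.ofFn fun i => Y i ^ a i).prod

/-- The `2n × 2n` matrix `Λ₀` of the quantum cluster algebra `𝒜_•(B⁰, D, Λ, t₀)` with principal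
coefficients. -/
def principalForm {n : ℕ} (B0 : Matrix (Fin n) (Fin n) ℤ) (d : Fin n → ℤ)
    (Λ : Matrix (Fin n) (Fin n) ℤ) : Matrix (Fin n ⊕ Fin n) (Fin n ⊕ Fin n) ℤ :=
  Matrix.fromBlocks Λ (-(Λ * B0) - Matrix.diagonal d)
    (-(B0.transpose * Λ) + Matrix.diagonal d)
    (B0.transpose * Λ * B0 + B0.transpose * Matrix.diagonal d)

/-- `F` satisfies `X_{j;t} = F(Ŷ) M₀(g_{j;t})` in the quantum cluster algebras
`𝒜_•(B⁰, D, Λ, t₀)` with principal coefficients. -/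
def IsQuantumFPolynomial {n : ℕ} (B0 : Matrix (Fin n) (Fin n) ℤ) (d : Fin n → ℤ) (j : Fin n)
    (t : TreeVertex n) (F : QuantumPolynomial n) : Prop :=
  ∀ (Λ : Matrix (Fin n) (Fin n) ℤ), Λ.transpose = -Λ →
    ∀ (K : Type) [DivisionRing K] [Algebra ℤ[T;T⁻¹] K] (M0 : (Fin n ⊕ Fin n → ℤ) → K),
      IsToricFrame M0 (principalForm B0 d Λ) →
        quantumClusterVar d M0 (principalMatrix B0) j t =
          F.eval B0 d (yHat M0 (principalMatrix B0)) * M0 (Sum.elim (gVector B0 j t) 0)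

open Classical in
/-- The (left) quantum `F`-polynomial `F_{j;t}^{B⁰;D;t₀}`. -/
def quantumFPolynomial {n : ℕ} (B0 : Matrix (Fin n) (Fin n) ℤ) (d : Fin n → ℤ) (j : Fin n)
    (t : TreeVertex n) : QuantumPolynomial n :=
  if h : ∃ F, IsQuantumFPolynomial B0 d j t F then h.choose else 0

end Quantum

/-! A mutation of toric frames in direction `k` transforms exponents by a linear map `mutLin`, which
may be formed with the column `b` or with `-b`: compatibility makes both choices pull the form back
to the same form. When the sign is that of the `c`-vector, the composite of these maps along a path
is `gMap`, and its columns are the extended `g`-vectors. So the form at `t` is the initial form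
pulled back along the `g`-vectors (`IsQSeed.formAlong_apply`), which is the second claim.

That the `c`-vectors have signs is where the hypothesis enters. The product of two successive
`F`-polynomials in direction `k` is a sum of two terms, divisible by the monomials with exponents
`[c]₊` and `[-c]₊`. If `c` had entries of both signs, this sum would have constant term zero, but
the product does not (`signCoherent_of_constantCoeff`). Sign-coherence gives `gMap_matCol`, which
says that `gMap` sends a column of the current exchange matrix to the initial matrix applied to the
`c`-vector. From this follow the classical separation formula (`varAlong_eq`) and the identification
of the vectors in the statement with the columns of `gMap` (`extGVector_eq`, `gVector_eq`).

For the first claim, the quantum exchange relation is rewritten as `F_k * Z = P`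
(`IsQSeed.qEval_mul_eq`), where `Z` is a conjugate of the new cluster variable divided by the
monomial of its `g`-vector. Here `P` is a polynomial in the `Ŷ_l` whose coefficients depend only on
the initial principal part, on `d` and on the preceding quantum polynomials. By the quantum Laurent
phenomenon (`QuantumSeed.laurent`) `Z` lies in the initial quantum torus, and left division by a
polynomial with constant term `1` cannot leave the polynomials in the `Ŷ_l`
(`IsQSeed.exists_qEval_eq`). The resulting identity between quantum polynomials is free of
coefficients, so a quotient found in one algebra also serves in another with the same principal part
(`exists_represents`). Comparison with principal coefficients identifies it as the quantum
`F`-polynomial.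

The definition of the latter quantifies over toric frames, so one must be known to exist.
`exists_isToricFrame` takes the group ring of a central extension of `ℤ^ι` by `ℤ`, which satisfies
the Ore condition because the group has polynomial growth, and passes to its skew-field of
fractions. -/

open LaurentPolynomial (T)

noncomputable section Frames

/-! ### Frames of quantum tori -/

variable {ι K : Type*} [DivisionRing K] [Algebra ℤ[T;T⁻¹] K]

/-- `M` multiplies as the distinguished basis of the based quantum torus of the form `ω`. -/
def QForm (M : (ι → ℤ) → K) (ω : LinearMap.BilinForm ℤ (ι → ℤ)) : Prop :=
  ∀ c d, M c * M d = (T (ω c d) : ℤ[T;T⁻¹]) • M (c + d)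

/-- A frame spanning a based quantum torus in `K`. -/
structure QTorus (M : (ι → ℤ) → K) (ω : LinearMap.BilinForm ℤ (ι → ℤ)) : Prop where
  form : QForm M ω
  skew : ∀ c d, ω c d = -ω d c
  linInd : LinearIndependent ℤ[T;T⁻¹] M

theorem T_smul_T_smul {V : Type*} [AddCommGroup V] [Module ℤ[T;T⁻¹] V] (a b : ℤ) (x : V) :
    (T a : ℤ[T;T⁻¹]) • (T b : ℤ[T;T⁻¹]) • x = (T (a + b) : ℤ[T;T⁻¹]) • x := by
  rw [smul_smul, ← LaurentPolynomial.T_add]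

theorem T_zero_smul {V : Type*} [AddCommGroup V] [Module ℤ[T;T⁻¹] V] (x : V) :
    (T 0 : ℤ[T;T⁻¹]) • x = x := by
  rw [LaurentPolynomial.T_zero, one_smul]

theorem T_smul_eq_iff {V : Type*} [AddCommGroup V] [Module ℤ[T;T⁻¹] V] (a : ℤ) (x y : V) :
    (T a : ℤ[T;T⁻¹]) • x = y ↔ x = (T (-a) : ℤ[T;T⁻¹]) • y := by
  constructor
  · rintro rfl; rw [T_smul_T_smul, neg_add_cancel, T_zero_smul]
  · rintro rfl; rw [T_smul_T_smul, add_neg_cancel, T_zero_smul]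

theorem T_injective : Function.Injective (T : ℤ → ℤ[T;T⁻¹]) :=
  AddMonoidAlgebra.single_left_injective one_ne_zero

/-- The tropical part of the exchange relation in direction `k` given by the column `b`. -/
def exVec [DecidableEq ι] (k : ι) (b : ι → ℤ) : ι → ℤ := fun i =>
  if i = k then -1 else max 0 (-(b i))

/-- The linear map `E_+` of the mutation in direction `k` given by the column `b`. -/
def mutLin [DecidableEq ι] (k : ι) (b : ι → ℤ) : (ι → ℤ) →ₗ[ℤ] (ι → ℤ) :=
  LinearMap.id + (LinearMap.proj k : (ι → ℤ) →ₗ[ℤ] ℤ).smulRight (exVec k b - Pi.single k 1)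

section mutLin
variable [DecidableEq ι] (k : ι) (b : ι → ℤ)

theorem mutLin_apply (c : ι → ℤ) :
    mutLin k b c = c + c k • (exVec k b - Pi.single k 1) := rfl

theorem exVec_self : exVec k b k = -1 := by simp [exVec]

theorem exVec_of_ne {i : ι} (h : i ≠ k) : exVec k b i = max 0 (-(b i)) := by simp [exVec, h]

theorem exVec_neg (hb : b k = 0) : exVec k (-b) = exVec k b + b := by
  ext i
  by_cases h : i = k
  · subst h; simp [exVec, hb]
  · simp [exVec, h]; omega

theorem mutLin_single : mutLin k b (Pi.single k 1) = exVec k b := by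
  simp [mutLin_apply]

theorem mutLin_of_eq_zero {c : ι → ℤ} (hc : c k = 0) : mutLin k b c = c := by
  simp [mutLin_apply, hc]

theorem mutLin_apply_self (c : ι → ℤ) : mutLin k b c k = -c k := by
  simp [mutLin_apply, exVec_self]; ring

theorem mutLin_apply_of_ne (c : ι → ℤ) {i : ι} (h : i ≠ k) :
    mutLin k b c i = c i + c k * max 0 (-(b i)) := by
  simp [mutLin_apply, exVec_of_ne k b h, h]

theorem mutLin_neg_apply (hb : b k = 0) (c : ι → ℤ) :
    mutLin k (-b) c = mutLin k b c + c k • b := by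
  simp [mutLin_apply, exVec_neg k b hb, smul_add, smul_sub]; abel

theorem mutLin_mutLin (c : ι → ℤ) : mutLin k b (mutLin k b c) = c := by
  ext i
  by_cases h : i = k
  · subst h; simp [mutLin_apply_self]
  · simp [mutLin_apply_of_ne _ _ _ h, mutLin_apply_self]

theorem mutLin_injective : Function.Injective (mutLin k b) :=
  Function.LeftInverse.injective (mutLin_mutLin k b)

end mutLin

section QForm
variable {M : (ι → ℤ) → K} {ω : LinearMap.BilinForm ℤ (ι → ℤ)}

theorem QForm.add (h : QForm M ω) (c d : ι → ℤ) :
    M (c + d) = (T (-ω c d) : ℤ[T;T⁻¹]) • (M c * M d) := by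
  rw [h, T_smul_T_smul, neg_add_cancel, T_zero_smul]

variable (h : QTorus M ω)
include h

theorem QTorus.self_eq_zero (c : ι → ℤ) : ω c c = 0 := by
  have := h.skew c c; omega

theorem QTorus.ne_zero (c : ι → ℤ) : M c ≠ 0 := h.linInd.ne_zero c

theorem QTorus.frame_zero : M 0 = 1 := by
  have := h.form 0 0
  simp only [map_zero, add_zero, T_zero_smul] at this
  exact (mul_eq_left₀ (h.ne_zero 0)).1 this

theorem QTorus.comm (c d : ι → ℤ) :
    M c * M d = (T (2 * ω c d) : ℤ[T;T⁻¹]) • (M d * M c) := by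
  rw [h.form, h.form, T_smul_T_smul, add_comm d c, h.skew d c]
  congr 2; ring

theorem QTorus.mul_neg (c : ι → ℤ) : M c * M (-c) = 1 := by
  rw [h.form, map_neg, h.self_eq_zero, neg_zero, T_zero_smul, add_neg_cancel, h.frame_zero]

theorem QTorus.frame_neg (c : ι → ℤ) : M (-c) = (M c)⁻¹ :=
  eq_inv_of_mul_eq_one_right (h.mul_neg c)

/-- The vector `M 0 = 1` is linearly independent on its own, so no nonzero scalar annihilates `1`.
-/
theorem QTorus.algebraMap_injective : Function.Injective (algebraMap ℤ[T;T⁻¹] K) := by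
  rw [injective_iff_map_eq_zero]
  intro a ha
  have := (linearIndependent_iff.1 h.linInd) (Finsupp.single 0 a) (by
    simp [h.frame_zero, Algebra.smul_def, ha])
  simpa using this

theorem QTorus.smul_eq_zero {r : ℤ[T;T⁻¹]} {x : K} : r • x = 0 ↔ r = 0 ∨ x = 0 := by
  rw [Algebra.smul_def, mul_eq_zero, map_eq_zero_iff _ h.algebraMap_injective]

theorem QTorus.T_smul_injective {a b : ℤ} {x : K} (hx : x ≠ 0)
    (hab : (T a : ℤ[T;T⁻¹]) • x = (T b : ℤ[T;T⁻¹]) • x) : a = b := by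
  rw [← sub_eq_zero, ← sub_smul, h.smul_eq_zero] at hab
  rcases hab with hab | hab
  · rw [sub_eq_zero] at hab
    exact T_injective hab
  · exact absurd hab hx

/-- The form is determined by the frame. -/
theorem QTorus.form_eq_of_qForm {ω' : LinearMap.BilinForm ℤ (ι → ℤ)} (h' : QForm M ω')
    (c d : ι → ℤ) : ω' c d = ω c d :=
  h.T_smul_injective (h.ne_zero (c + d)) ((h' c d).symm.trans (h.form c d))

end QForm

/-! ### Mutation of frames -/

/-- `M'` is obtained from the frame `M` by mutation in direction `k` along the column `b`. -/
structure IsMutation [DecidableEq ι] (ω : LinearMap.BilinForm ℤ (ι → ℤ)) (k : ι) (b : ι → ℤ)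
    (M M' : (ι → ℤ) → K) : Prop where
  form : QForm M' (ω.compl₁₂ (mutLin k b) (mutLin k b))
  agree : ∀ c, c k = 0 → M' c = M c
  exchange : M' (Pi.single k 1) = M (exVec k b) + M (exVec k b + b)

/-- `b` is the `k`-th column of an exchange matrix compatible with `ω`. -/
structure CompatCol (ω : LinearMap.BilinForm ℤ (ι → ℤ)) (k : ι) (b : ι → ℤ) (δ : ℤ) : Prop where
  ne : δ ≠ 0
  apply : ∀ c, ω b c = δ * c k
  self : b k = 0

section mutation
variable [DecidableEq ι] {k : ι} {b : ι → ℤ} {δ : ℤ} {M M' : (ι → ℤ) → K}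
  {ω : LinearMap.BilinForm ℤ (ι → ℤ)}

omit [DecidableEq ι] in
theorem CompatCol.apply' (hb : CompatCol ω k b δ) (h : QTorus M ω) (c : ι → ℤ) :
    ω c b = -(δ * c k) := by
  rw [h.skew, hb.apply]

/-- The two linear maps differ by `c ↦ c k • b`. Since `ω b` is `δ` times the `k`-th coordinate and
`mutLin` reverses that coordinate, the two cross terms are `δ c_k d_k` and `-δ c_k d_k`, and `ω b b
= 0`. -/
theorem compl_mutLin_neg (h : QTorus M ω) (hb : CompatCol ω k b δ) :
    ω.compl₁₂ (mutLin k (-b)) (mutLin k (-b)) = ω.compl₁₂ (mutLin k b) (mutLin k b) := by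
  have : ∀ c d, ω.compl₁₂ (mutLin k (-b)) (mutLin k (-b)) c d
      = ω.compl₁₂ (mutLin k b) (mutLin k b) c d := by
    intro c d
    simp only [LinearMap.compl₁₂_apply, mutLin_neg_apply k b hb.self, map_add, map_smul,
      LinearMap.add_apply, LinearMap.smul_apply, hb.apply, hb.apply' h, mutLin_apply_self, hb.self,
      smul_eq_mul]
    ring
  exact LinearMap.ext fun c => LinearMap.ext fun d => this c d

/-- Negating the column only exchanges the two terms of the exchange relation. This freedom is used
to follow the tropical sign, and to reduce a negative matrix entry to a positive one. -/
theorem IsMutation.flip (h : QTorus M ω) (hb : CompatCol ω k b δ)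
    (hM : IsMutation ω k b M M') : IsMutation ω k (-b) M M' where
  form := by rw [compl_mutLin_neg h hb]; exact hM.form
  agree := hM.agree
  exchange := by
    rw [hM.exchange, exVec_neg k b hb.self, add_assoc, add_neg_cancel, add_zero, add_comm]

/-- A frame is determined by its form, its restriction to `c_k = 0` and its value at `e_k`. -/
theorem QForm.eq_of_agree {ω' : LinearMap.BilinForm ℤ (ι → ℤ)} {M'' : (ι → ℤ) → K}
    (h' : QForm M' ω') (h'' : QForm M'' ω') (hs : ∀ c, ω' c c = 0) (h0 : M' 0 = 1)
    (h : ∀ c, c k = 0 → M' c = M'' c)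
    (he : M' (Pi.single k 1) = M'' (Pi.single k 1)) : M' = M'' := by
  have h0' : M'' 0 = 1 := by rw [← h 0 rfl, h0]
  have hne : M' (Pi.single k 1) ≠ 0 := by
    intro h1
    have := h' (Pi.single k 1) (-Pi.single k 1)
    rw [h1, zero_mul, add_neg_cancel, h0, map_neg, hs, neg_zero, T_zero_smul] at this
    exact zero_ne_one this
  have key : ∀ c, M' c = M'' c → M' (c + Pi.single k 1) = M'' (c + Pi.single k 1) := by
    intro c hc
    rw [h'.add, h''.add, hc, he]
  have key' : ∀ c, M' (c + Pi.single k 1) = M'' (c + Pi.single k 1) → M' c = M'' c := by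
    intro c hc
    have h1 := h' c (Pi.single k 1)
    have h2 := h'' c (Pi.single k 1)
    rw [hc, ← h2, ← he] at h1
    exact mul_right_cancel₀ hne h1
  have hnat : ∀ (m : ℕ) c, c k = 0 → M' (c + (m : ℤ) • Pi.single k 1)
      = M'' (c + (m : ℤ) • Pi.single k 1) ∧ M' (c - (m : ℤ) • Pi.single k 1)
      = M'' (c - (m : ℤ) • Pi.single k 1) := by
    intro m c hc
    induction m with
    | zero => simpa using h c hc
    | succ m ih =>
      constructor
      · have := key _ ih.1
        convert this using 2 <;> · push_cast; rw [add_smul, one_smul, add_assoc]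
      · apply key'
        convert ih.2 using 2 <;> · push_cast; rw [add_smul, one_smul]; abel
  funext c
  have hc : c = (c - c k • Pi.single k (1 : ℤ)) + c k • Pi.single k 1 := by abel
  have hc0 : (c - c k • Pi.single k (1 : ℤ) : ι → ℤ) k = 0 := by simp
  rw [hc]
  obtain ⟨m, hm | hm⟩ := Int.eq_nat_or_neg (c k)
  · have := (hnat m _ hc0).1
    rwa [← hm] at this
  · have := (hnat m _ hc0).2
    rwa [sub_eq_add_neg, ← neg_smul, ← hm] at this

theorem IsMutation.unique {M'' : (ι → ℤ) → K} (h : QTorus M ω) (hM : IsMutation ω k b M M')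
    (hM' : IsMutation ω k b M M'') : M' = M'' :=
  hM.form.eq_of_agree hM'.form (fun c => h.self_eq_zero _)
    (by rw [hM.agree _ rfl, h.frame_zero]) (fun c hc => by rw [hM.agree c hc, hM'.agree c hc])
    (by rw [hM.exchange, hM'.exchange])

/-- Mutation of frames is involutive. -/
theorem IsMutation.symm (h : QTorus M ω) (hb : CompatCol ω k b δ) (hM : IsMutation ω k b M M')
    (h' : QTorus M' (ω.compl₁₂ (mutLin k b) (mutLin k b))) :
    IsMutation (ω.compl₁₂ (mutLin k b) (mutLin k b)) k (-b) M' M where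
  form := by
    intro c d
    rw [h.form]
    congr 2
    simp only [LinearMap.compl₁₂_apply, mutLin_neg_apply k b hb.self, map_add, map_smul,
      LinearMap.add_apply, LinearMap.smul_apply, hb.apply, hb.apply' h, mutLin_mutLin,
      hb.self, smul_eq_mul, mutLin_of_eq_zero k b hb.self]
    ring
  agree c hc := (hM.agree c hc).symm
  exchange := by
    have hne : M' (Pi.single k 1) ≠ 0 := h'.ne_zero _
    -- After multiplication by `M' e_k` the exponents on the right have `k`-th coordinate zero,
    -- where both frames agree, and on the left the exchange relation applies.
    apply mul_right_cancel₀ hne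
    rw [add_mul, h'.form, h'.form, hM.agree (exVec k (-b) + Pi.single k 1) (by simp [exVec_self]),
      hM.agree (exVec k (-b) + -b + Pi.single k 1) (by simp [exVec_self, hb.self]), hM.exchange, mul_add, h.form, h.form, exVec_neg k b hb.self]
    simp only [LinearMap.compl₁₂_apply, map_add, mutLin_of_eq_zero k b hb.self, mutLin_single,
      LinearMap.add_apply, hb.apply, hb.apply' h, exVec_self, map_neg, LinearMap.neg_apply]
    have hE : mutLin k b (exVec k b) = Pi.single k 1 := by rw [← mutLin_single, mutLin_mutLin]
    rw [hE, add_comm]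
    congr 1
    · congr 2
      · simp
      · abel
    · congr 2
      · simp
      · abel

end mutation
end Frames

/-! ### Spans of frame elements and linear independence of mutated frames -/

noncomputable section FrameMutation

variable {ι K : Type*} [DivisionRing K] [Algebra ℤ[T;T⁻¹] K]

/-- The span of the elements `M(c)` with `c ∈ S`. -/
def frameSpan (M : (ι → ℤ) → K) (S : Set (ι → ℤ)) : Submodule ℤ[T;T⁻¹] K :=
  Submodule.span ℤ[T;T⁻¹] (M '' S)

section frameSpan
variable {M : (ι → ℤ) → K} {ω : LinearMap.BilinForm ℤ (ι → ℤ)}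

theorem mem_frameSpan {S : Set (ι → ℤ)} {c : ι → ℤ} (hc : c ∈ S) : M c ∈ frameSpan M S :=
  Submodule.subset_span ⟨c, hc, rfl⟩

theorem frameSpan_mono {S S' : Set (ι → ℤ)} (h : S ⊆ S') : frameSpan M S ≤ frameSpan M S' :=
  Submodule.span_mono (Set.image_mono h)

theorem frameSpan_le {S : Set (ι → ℤ)} {p : Submodule ℤ[T;T⁻¹] K} :
    frameSpan M S ≤ p ↔ ∀ c ∈ S, M c ∈ p := by
  simp [frameSpan, Submodule.span_le, Set.subset_def]

theorem QForm.mul_mem_frameSpan (h : QForm M ω) {S S' S'' : Set (ι → ℤ)}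
    (hS : ∀ c ∈ S, ∀ d ∈ S', c + d ∈ S'') {x y : K} (hx : x ∈ frameSpan M S)
    (hy : y ∈ frameSpan M S') : x * y ∈ frameSpan M S'' := by
  have h1 : ∀ c ∈ S, ∀ y ∈ frameSpan M S', M c * y ∈ frameSpan M S'' := by
    intro c hc y hy
    have : frameSpan M S' ≤ (frameSpan M S'').comap (LinearMap.mulLeft ℤ[T;T⁻¹] (M c)) := by
      rw [frameSpan_le]
      intro d hd
      simp only [Submodule.mem_comap, LinearMap.mulLeft_apply, h c d]
      exact Submodule.smul_mem _ _ (mem_frameSpan (hS c hc d hd))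
    exact this hy
  have : frameSpan M S ≤ (frameSpan M S'').comap (LinearMap.mulRight ℤ[T;T⁻¹] y) := by
    rw [frameSpan_le]
    intro c hc
    exact h1 c hc y hy
  exact this hx

theorem exists_add_of_mem_frameSpan {S : Set (ι → ℤ)} (P : Set (ι → ℤ)) {x : K}
    (hx : x ∈ frameSpan M S) :
    ∃ y ∈ frameSpan M (S ∩ P), ∃ z ∈ frameSpan M (S ∩ Pᶜ), x = y + z := by
  rw [← Set.inter_union_compl S P, frameSpan, Set.image_union, Submodule.span_union,
    Submodule.mem_sup] at hx
  obtain ⟨y, hy, z, hz, rfl⟩ := hx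
  exact ⟨y, hy, z, hz, rfl⟩

theorem QTorus.eq_zero_of_mem (h : QTorus M ω) {S S' : Set (ι → ℤ)} (hS : Disjoint S S') {x : K}
    (hx : x ∈ frameSpan M S) (hx' : x ∈ frameSpan M S') : x = 0 :=
  Submodule.disjoint_def.1 (h.linInd.disjoint_span_image hS) x hx hx'

end frameSpan

section mutation
variable [DecidableEq ι] {k : ι} {b : ι → ℤ} {δ : ℤ} {M M' : (ι → ℤ) → K}
  {ω : LinearMap.BilinForm ℤ (ι → ℤ)}

/-- The leading term of the mutated frame. -/
theorem IsMutation.lead (h : QTorus M ω) (hM : IsMutation ω k b M M') (c : ι → ℤ)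
    (hc : 0 ≤ c k) :
    M' c - M (mutLin k b c) ∈ frameSpan M {a | ∃ p : ℤ, 1 ≤ p ∧ a = mutLin k b c + p • b} := by
  obtain ⟨m, hm⟩ := Int.eq_ofNat_of_zero_le hc
  induction m generalizing c with
  | zero =>
    have hc0 : c k = 0 := by simpa using hm
    rw [mutLin_of_eq_zero k b hc0, hM.agree c hc0, sub_self]
    exact Submodule.zero_mem _
  | succ m ih =>
    obtain ⟨c', rfl⟩ : ∃ c', c = c' + Pi.single k 1 := ⟨c - Pi.single k 1, by abel⟩
    have hc' : c' k = m := by simpa using hm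
    have ih := ih c' (by omega) hc'
    set y := M' c' - M (mutLin k b c') with hy
    have hMc : M' c' = M (mutLin k b c') + y := by rw [hy]; abel
    have hv : mutLin k b (c' + Pi.single k 1) = mutLin k b c' + exVec k b := by
      rw [map_add, mutLin_single]
    rw [hM.form.add, hMc, hM.exchange, mul_add, add_mul, h.form, smul_add, smul_add, T_smul_T_smul,
      hv]
    have he : -(ω.compl₁₂ (mutLin k b) (mutLin k b)) c' (Pi.single k 1)
        + ω (mutLin k b c') (exVec k b) = 0 := by
      rw [LinearMap.compl₁₂_apply, mutLin_single, neg_add_cancel]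
    rw [he, T_zero_smul, add_assoc, add_sub_cancel_left]
    refine Submodule.add_mem _ (Submodule.smul_mem _ _ ?_) (Submodule.smul_mem _ _ ?_)
    · refine h.form.mul_mem_frameSpan (S' := {exVec k b}) ?_ ih (mem_frameSpan rfl)
      rintro _ ⟨p, hp, rfl⟩ _ rfl
      exact ⟨p, hp, by abel⟩
    · refine h.form.mul_mem_frameSpan (S := {a | ∃ p : ℤ, 0 ≤ p ∧ a = mutLin k b c' + p • b})
        (S' := {exVec k b + b}) ?_ ?_ (mem_frameSpan rfl)
      · rintro _ ⟨p, hp, rfl⟩ _ rfl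
        exact ⟨p + 1, by omega, by rw [add_smul, one_smul]; abel⟩
      · refine Submodule.add_mem _ (mem_frameSpan ⟨0, le_rfl, by simp⟩)
          (frameSpan_mono ?_ ih)
        rintro _ ⟨p, hp, rfl⟩
        exact ⟨p, by omega, rfl⟩

/-- After a shift of all exponents by a multiple of `e_k`, every `M' c` involved is the monomial at
`mutLin k b c` plus terms displaced by positive multiples of `b`. The functional `ω · (δ e_k)` grows
by `δ²` along `b`, so in a linear relation the leading monomial of an exponent minimising it cannot
be cancelled. -/
theorem IsMutation.linearIndependent (h : QTorus M ω) (hb : CompatCol ω k b δ)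
    (hM : IsMutation ω k b M M') : LinearIndependent ℤ[T;T⁻¹] M' := by
  classical
  rw [linearIndependent_iff']
  intro S g hg
  by_contra! hne
  obtain ⟨c₁, hc₁, hgc₁⟩ := hne
  obtain ⟨c₀, hc₀, hmin⟩ := Finset.exists_min_image (S.filter fun c => g c ≠ 0)
    (fun c => ω (mutLin k b c) (δ • Pi.single k 1)) ⟨c₁, by simp [hc₁, hgc₁]⟩
  simp only [Finset.mem_filter] at hc₀ hmin
  -- The description of leading terms needs nonnegative `k`-th entries; multiplying the relation by
  -- `M' (N e_k)` provides them.
  obtain ⟨N, hN⟩ : ∃ N : ℤ, ∀ c ∈ S, 0 ≤ c k + N :=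
    ⟨∑ c ∈ S, |c k|, fun c hc => by
      have := Finset.single_le_sum (f := fun c : ι → ℤ => |c k|) (fun i _ => abs_nonneg _) hc
      have := neg_abs_le (c k)
      omega⟩
  set e : ι → ℤ := N • Pi.single k 1 with he
  have hek : ∀ c ∈ S, 0 ≤ (c + e) k := fun c hc => by simpa [he] using hN c hc
  set ω' := ω.compl₁₂ (mutLin k b) (mutLin k b)
  have h1 : ∑ c ∈ S, (g c * T (ω' c e)) • M' (c + e) = 0 := by
    rw [← zero_mul (M' e), ← hg, Finset.sum_mul]
    refine Finset.sum_congr rfl fun c _ => ?_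
    rw [smul_mul_assoc, hM.form, smul_smul]
  rw [← Finset.add_sum_erase S _ hc₀.1] at h1
  set a₀ := mutLin k b (c₀ + e) with ha₀
  have hA : ∀ c ∈ S, g c ≠ 0 → ∀ p : ℤ, (1 ≤ p ∨ c ≠ c₀ ∧ 0 ≤ p) →
      mutLin k b (c + e) + p • b ≠ a₀ := by
    intro c hc hgc p hp heq
    have h2 := hmin c ⟨hc, hgc⟩
    have h3 := congrArg (fun v => ω v (δ • Pi.single k 1)) heq
    simp only [ha₀, map_add, LinearMap.add_apply, map_smul, LinearMap.smul_apply, hb.apply,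
      smul_eq_mul, Pi.single_eq_same, mul_one] at h2 h3
    have h4 : 0 < δ * δ := mul_self_pos.2 hb.ne
    have h5 : 0 ≤ p := by omega
    have h6 : p * (δ * δ) ≤ 0 := by linarith
    have h7 : p = 0 := by nlinarith
    subst h7
    rcases hp with hp | hp
    · omega
    · rw [zero_smul, add_zero] at heq
      exact hp.1 (add_right_cancel (mutLin_injective k b heq))
  have hmem : ∀ c ∈ S, g c ≠ 0 → M' (c + e) - M (mutLin k b (c + e)) ∈ frameSpan M {a₀}ᶜ := by
    intro c hc hgc
    refine frameSpan_mono ?_ (hM.lead h (c + e) (hek c hc))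
    rintro _ ⟨p, hp, rfl⟩
    exact hA c hc hgc p (Or.inl hp)
  have h2 : (g c₀ * T (ω' c₀ e)) • M a₀ ∈ frameSpan M {a₀}ᶜ := by
    have h3 : (g c₀ * T (ω' c₀ e)) • M a₀ =
        -((g c₀ * T (ω' c₀ e)) • (M' (c₀ + e) - M a₀)
          + ∑ c ∈ S.erase c₀, (g c * T (ω' c e)) • M' (c + e)) := by
      rw [eq_neg_iff_add_eq_zero, ← h1, smul_sub]; abel
    rw [h3]
    refine Submodule.neg_mem _ (Submodule.add_mem _ (Submodule.smul_mem _ _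
      (hmem _ hc₀.1 hc₀.2)) (Submodule.sum_mem _ fun c hc => ?_))
    rw [Finset.mem_erase] at hc
    by_cases hgc : g c = 0
    · simp [hgc]
    · refine Submodule.smul_mem _ _ ?_
      rw [← sub_add_cancel (M' (c + e)) (M (mutLin k b (c + e)))]
      refine Submodule.add_mem _ (hmem c hc.2 hgc) (mem_frameSpan ?_)
      have := hA c hc.2 hgc 0 (Or.inr ⟨hc.1, le_rfl⟩)
      simpa using this
  have h3 := h.eq_zero_of_mem (disjoint_compl_right (a := ({a₀} : Set (ι → ℤ))))
    (Submodule.smul_mem _ _ (mem_frameSpan rfl)) h2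
  rw [h.smul_eq_zero] at h3
  rcases h3 with h3 | h3
  · have h4 : g c₀ * T (ω' c₀ e) * T (-ω' c₀ e) = 0 := by rw [h3, zero_mul]
    rw [mul_assoc, ← LaurentPolynomial.T_add, add_neg_cancel, LaurentPolynomial.T_zero,
      mul_one] at h4
    exact hc₀.2 h4
  · exact h.ne_zero _ h3

theorem IsMutation.qTorus (h : QTorus M ω) (hb : CompatCol ω k b δ) (hM : IsMutation ω k b M M') :
    QTorus M' (ω.compl₁₂ (mutLin k b) (mutLin k b)) where
  form := hM.form
  skew _ _ := h.skew _ _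
  linInd := hM.linearIndependent h hb

end mutation

/-! ### The mutation formula with `q`-binomial coefficients -/

theorem qBinomial_zero (δ : ℤ) (s : ℕ) : qBinomial K δ s 0 = 1 := by
  simp [qBinomial]

theorem qBinomial_eq_zero (δ : ℤ) (s : ℕ) : qBinomial K δ s (s + 1) = 0 := by
  rw [qBinomial, Finset.prod_range_succ]
  simp

/-- Over the common denominator of length `p + 1` this is the identity `[s+1] = t^{-(p+1)} [s-p] +
t^{s-p} [p+1]` for `[a] = t^a - t^{-a}`. The hypotheses keep the denominators nonzero in `K`. -/
theorem qBinomial_pascal (hinj : Function.Injective (algebraMap ℤ[T;T⁻¹] K)) {δ : ℤ} (hδ : δ ≠ 0)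
    (s p : ℕ) :
    qBinomial K δ (s + 1) (p + 1) =
      algebraMap ℤ[T;T⁻¹] K (T (-(δ * (p + 1)))) * qBinomial K δ s (p + 1)
      + algebraMap ℤ[T;T⁻¹] K (T (δ * (s - p))) * qBinomial K δ s p := by
  have hne : ∀ i : ℕ, (T (δ * ((i : ℤ) + 1)) - T (-(δ * ((i : ℤ) + 1))) : ℤ[T;T⁻¹]) ≠ 0 := by
    intro i hi
    rw [sub_eq_zero] at hi
    have := T_injective hi
    have h2 : δ * ((i : ℤ) + 1) ≠ 0 := mul_ne_zero hδ (by omega)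
    omega
  set den : ℕ → ℤ[T;T⁻¹] := fun p => ∏ i ∈ Finset.range p,
    (T (δ * ((i : ℤ) + 1)) - T (-(δ * ((i : ℤ) + 1)))) with hden
  set num : ℕ → ℕ → ℤ[T;T⁻¹] := fun r p => ∏ i ∈ Finset.range p,
      (T (δ * ((r : ℤ) - i)) - T (-(δ * ((r : ℤ) - i)))) with hnum
  have hq : ∀ r p, qBinomial K δ r p = algebraMap _ K (num r p) / algebraMap _ K (den p) :=
    fun r p => rfl
  have hd : ∀ p, algebraMap _ K (den p) ≠ 0 := fun p => by
    rw [Ne, map_eq_zero_iff _ hinj, hden]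
    exact Finset.prod_ne_zero_iff.2 fun i _ => hne i
  have hd1 : den (p + 1) = den p * (T (δ * ((p : ℤ) + 1)) - T (-(δ * ((p : ℤ) + 1)))) := by
    rw [hden]; exact Finset.prod_range_succ _ _
  have hn1 : num s (p + 1) = num s p * (T (δ * ((s : ℤ) - p)) - T (-(δ * ((s : ℤ) - p)))) := by
    rw [hnum]; exact Finset.prod_range_succ _ _
  have hn2 : num (s + 1) (p + 1) = (T (δ * ((s : ℤ) + 1)) - T (-(δ * ((s : ℤ) + 1)))) * num s p := by
    rw [hnum]
    simp only
    rw [Finset.prod_range_succ', mul_comm]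
    congr 1
    simp
  have e1 : algebraMap _ K (num s p) / algebraMap _ K (den p) =
      algebraMap _ K (num s p * (T (δ * ((p : ℤ) + 1)) - T (-(δ * ((p : ℤ) + 1)))))
        / algebraMap _ K (den (p + 1)) := by
    rw [hd1, map_mul, map_mul, mul_div_mul_right]
    rw [Ne, map_eq_zero_iff _ hinj]
    exact hne p
  rw [hq, hq, hq, e1, ← mul_div_assoc, ← mul_div_assoc, ← add_div, ← map_mul, ← map_mul, ← map_add,
    hn1, hn2]
  congr 2
  have : (T (δ * ((s : ℤ) + 1)) - T (-(δ * ((s : ℤ) + 1))) : ℤ[T;T⁻¹]) =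
      T (-(δ * (p + 1))) * (T (δ * ((s : ℤ) - p)) - T (-(δ * ((s : ℤ) - p))))
      + T (δ * (s - p)) * (T (δ * ((p : ℤ) + 1)) - T (-(δ * ((p : ℤ) + 1)))) := by
    simp only [mul_sub (T _ : ℤ[T;T⁻¹]), ← LaurentPolynomial.T_add]
    have a1 : -(δ * ((p : ℤ) + 1)) + δ * (s - p) = δ * (s - p) + -(δ * ((p : ℤ) + 1)) := by ring
    have a2 : -(δ * ((p : ℤ) + 1)) + -(δ * (s - p)) = -(δ * (s + 1)) := by ring
    have a3 : δ * ((s : ℤ) - p) + δ * (p + 1) = δ * (s + 1) := by ring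
    rw [a1, a2, a3]; ring
  rw [this]; ring

end FrameMutation

/-! ### Quantum seed mutation as a mutation of frames -/

noncomputable section SeedMutation

variable {ι K : Type*} [DivisionRing K] [Algebra ℤ[T;T⁻¹] K]

theorem T_smul_mul_T_smul (a b : ℤ) (x y : K) :
    ((T a : ℤ[T;T⁻¹]) • x) * ((T b : ℤ[T;T⁻¹]) • y) = (T (a + b) : ℤ[T;T⁻¹]) • (x * y) := by
  rw [smul_mul_assoc, mul_smul_comm, T_smul_T_smul]

theorem T_smul_inv (a : ℤ) (x : K) :
    ((T a : ℤ[T;T⁻¹]) • x)⁻¹ = (T (-a) : ℤ[T;T⁻¹]) • x⁻¹ := by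
  by_cases hx : x = 0
  · simp [hx]
  · symm
    apply eq_inv_of_mul_eq_one_right
    rw [T_smul_mul_T_smul, add_neg_cancel, T_zero_smul, mul_inv_cancel₀ hx]

/-- If `x` quasi-commutes with `y`, then so does `x ^ s`. -/
theorem zpow_mul_eq_T_smul {x y : K} (hx : x ≠ 0) {a : ℤ}
    (h : x * y = (T a : ℤ[T;T⁻¹]) • (y * x)) (s : ℤ) :
    x ^ s * y = (T (s * a) : ℤ[T;T⁻¹]) • (y * x ^ s) := by
  have hnat : ∀ m : ℕ, x ^ m * y = (T (m * a) : ℤ[T;T⁻¹]) • (y * x ^ m) := by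
    intro m
    induction m with
    | zero => simp
    | succ m ih =>
      rw [pow_succ', mul_assoc, ih, mul_smul_comm, ← mul_assoc, h, smul_mul_assoc, T_smul_T_smul,
        mul_assoc]
      push_cast
      congr 2; ring
  obtain ⟨m, rfl | rfl⟩ := Int.eq_nat_or_neg s
  · simpa using hnat m
  · have h1 := hnat m
    have hxm : x ^ m ≠ 0 := pow_ne_zero m hx
    rw [zpow_neg, zpow_natCast, inv_mul_eq_iff_eq_mul₀ hxm, mul_smul_comm, ← mul_assoc, h1,
      smul_mul_assoc, T_smul_T_smul, mul_assoc, mul_inv_cancel₀ hxm, mul_one]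
    rw [neg_mul, neg_add_cancel, T_zero_smul]

/-- Extension of a frame on `c_k = 0` by powers of a quasi-commuting element. -/
theorem QForm.of_extension [DecidableEq ι] {k : ι} {M M' : (ι → ℤ) → K}
    {ω ω' : LinearMap.BilinForm ℤ (ι → ℤ)} (h : QTorus M ω) (hskew : ∀ c d, ω' c d = -ω' d c)
    (hω : ∀ c d, c k = 0 → d k = 0 → ω' c d = ω c d) {x : K} (hx : x ≠ 0)
    (hxM : ∀ u, u k = 0 → x * M u = (T (2 * ω' (Pi.single k 1) u) : ℤ[T;T⁻¹]) • (M u * x))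
    (agree : ∀ u, u k = 0 → M' u = M u)
    (hnn : ∀ c, 0 ≤ c k →
      M' c * x = (T (ω' c (Pi.single k 1)) : ℤ[T;T⁻¹]) • M' (c + Pi.single k 1))
    (hneg : ∀ c, c k < 0 → M' c = (M' (-c))⁻¹) : QForm M' ω' := by
  have hs : ∀ c, ω' c c = 0 := fun c => by have := hskew c c; omega
  have hnat : ∀ (u : ι → ℤ) (_ : u k = 0) (m : ℕ), M' (u + (m : ℤ) • Pi.single k 1) =
      (T (-(m * ω' u (Pi.single k 1))) : ℤ[T;T⁻¹]) • (M u * x ^ m) := by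
    intro u hu m
    induction m with
    | zero => simp [agree u hu]
    | succ m ih =>
      have h1 := hnn (u + (m : ℤ) • Pi.single k 1) (by simp [hu])
      rw [eq_comm, T_smul_eq_iff, ih, smul_mul_assoc, T_smul_T_smul, mul_assoc, ← pow_succ] at h1
      rw [Nat.cast_succ, add_smul, one_smul, ← add_assoc, h1]
      simp only [map_add, map_smul, LinearMap.add_apply, LinearMap.smul_apply, hs]
      congr 2; simp; ring
  -- Negative powers follow from natural ones by inverting and moving `M u` back to the left of the
  -- power of `x`.
  have hint : ∀ (u : ι → ℤ) (_ : u k = 0) (s : ℤ), M' (u + s • Pi.single k 1) =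
      (T (-(s * ω' u (Pi.single k 1))) : ℤ[T;T⁻¹]) • (M u * x ^ s) := by
    intro u hu s
    by_cases hs0 : 0 ≤ s
    · obtain ⟨m, rfl⟩ := Int.eq_ofNat_of_zero_le hs0
      simpa using hnat u hu m
    · obtain ⟨m, rfl⟩ : ∃ m : ℕ, s = -m := ⟨s.natAbs, by omega⟩
      have hneg' : -(u + (-(m : ℤ)) • Pi.single k 1) = -u + (m : ℤ) • Pi.single k (1 : ℤ) := by
        rw [neg_smul]; abel
      rw [hneg _ (by simp [hu]; omega), hneg', hnat (-u) (by simp [hu]), T_smul_inv, mul_inv_rev,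
        ← h.frame_neg, neg_neg u, ← zpow_natCast, ← zpow_neg, zpow_mul_eq_T_smul hx (hxM u hu),
        T_smul_T_smul, hskew (Pi.single k 1) u]
      congr 2; simp; ring
  intro c d
  obtain ⟨u, s, hu, rfl⟩ : ∃ (u : ι → ℤ) (s : ℤ), u k = 0 ∧ c = u + s • Pi.single k 1 :=
    ⟨c - c k • Pi.single k 1, c k, by simp, by abel⟩
  obtain ⟨u', s', hu', rfl⟩ : ∃ (u : ι → ℤ) (s : ℤ), u k = 0 ∧ d = u + s • Pi.single k 1 :=
    ⟨d - d k • Pi.single k 1, d k, by simp, by abel⟩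
  have e : u + s • Pi.single k 1 + (u' + s' • Pi.single k 1) = (u + u') + (s + s') • Pi.single k 1 := by
    rw [add_smul]; abel
  rw [e, hint u hu, hint u' hu', hint (u + u') (by simp [hu, hu']), T_smul_mul_T_smul, mul_assoc,
    ← mul_assoc (x ^ s), zpow_mul_eq_T_smul hx (hxM u' hu'), smul_mul_assoc, mul_smul_comm,
    T_smul_T_smul, mul_assoc (M u'), ← zpow_add₀ hx, ← mul_assoc (M u), h.form, smul_mul_assoc, T_smul_T_smul,
    T_smul_T_smul, ← hω u u' hu hu']
  congr 2
  simp only [map_add, map_smul, LinearMap.add_apply, LinearMap.smul_apply, hs, smul_eq_mul,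
    hskew (Pi.single k 1) u']
  ring

variable {n r : ℕ}

theorem mutE_mulVec (B : Matrix (Fin n ⊕ Fin r) (Fin n) ℤ) (k : Fin n) (c : Fin n ⊕ Fin r → ℤ) :
    (mutE B k).mulVec c = mutLin (Sum.inl k) (fun i => B i k) c := by
  have : (mutE B k).mulVecLin = mutLin (Sum.inl k) (fun i => B i k) := by
    refine LinearMap.pi_ext' fun j => LinearMap.ext_ring ?_
    ext i
    simp only [LinearMap.comp_apply, Matrix.mulVecLin_apply, LinearMap.single_apply,
      Matrix.mulVec_single_one, Matrix.col_apply, mutE]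
    by_cases hj : j = Sum.inl k
    · subst hj; simp [mutLin_single, exVec]
    · rw [mutLin_of_eq_zero _ _ (by simp [Ne.symm hj])]
      simp [hj, Pi.single_apply]
  exact congrArg (fun f => f c) this

theorem frameMutSum_eq (δ : ℤ) (M : (Fin n ⊕ Fin r → ℤ) → K)
    (B : Matrix (Fin n ⊕ Fin r) (Fin n) ℤ) (k : Fin n) (c : Fin n ⊕ Fin r → ℤ) :
    frameMutSum δ M B k c = ∑ p ∈ Finset.range ((c (Sum.inl k)).toNat + 1),
      qBinomial K δ (c (Sum.inl k)).toNat p *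
        M (mutLin (Sum.inl k) (fun i => B i k) c + (p : ℤ) • fun i => B i k) := by
  rw [frameMutSum, mutE_mulVec]; rfl

theorem frameMutSum_of_eq_zero (δ : ℤ) (M : (Fin n ⊕ Fin r → ℤ) → K)
    (B : Matrix (Fin n ⊕ Fin r) (Fin n) ℤ) (k : Fin n) {c : Fin n ⊕ Fin r → ℤ}
    (hc : c (Sum.inl k) = 0) : frameMutSum δ M B k c = M c := by
  rw [frameMutSum_eq, hc]
  simp [qBinomial_zero, mutLin_of_eq_zero _ _ hc]

/-- Each summand times the exchange binomial contributes to two consecutive shifts by `b`, with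
precisely the powers of `q` in `qBinomial_pascal`. Thus the defining sum for `c + e_k` arises from
that for `c` by right multiplication with the new frame element at `e_k`. -/
theorem frameMutSum_mul {δ : ℤ} {M : (Fin n ⊕ Fin r → ℤ) → K}
    {ω : LinearMap.BilinForm ℤ (Fin n ⊕ Fin r → ℤ)} (h : QTorus M ω)
    (B : Matrix (Fin n ⊕ Fin r) (Fin n) ℤ) (k : Fin n)
    (hb : CompatCol ω (Sum.inl k) (fun i => B i k) δ)
    (c : Fin n ⊕ Fin r → ℤ) (hc : 0 ≤ c (Sum.inl k)) :
    frameMutSum δ M B k c * (M (exVec (Sum.inl k) (fun i => B i k))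
        + M (exVec (Sum.inl k) (fun i => B i k) + fun i => B i k)) =
      (T (ω.compl₁₂ (mutLin (Sum.inl k) (fun i => B i k)) (mutLin (Sum.inl k) (fun i => B i k)) c
          (Pi.single (Sum.inl k) 1)) : ℤ[T;T⁻¹]) •
        frameMutSum δ M B k (c + Pi.single (Sum.inl k) 1) := by
  obtain ⟨s, hs⟩ := Int.eq_ofNat_of_zero_le hc
  have hs' : (c + Pi.single (Sum.inl k) 1 : Fin n ⊕ Fin r → ℤ) (Sum.inl k) = ((s + 1 : ℕ) : ℤ) := by simp [hs]
  rw [frameMutSum_eq, frameMutSum_eq, hs', hs, Int.toNat_natCast, Int.toNat_natCast, map_add,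
    mutLin_single, LinearMap.compl₁₂_apply, mutLin_single]
  set b : Fin n ⊕ Fin r → ℤ := fun i => B i k with hbdef
  set v := exVec (Sum.inl k) b with hv
  have hvk : v (Sum.inl k) = -1 := exVec_self _ _
  have hEk : mutLin (Sum.inl k) b c (Sum.inl k) = -(s : ℤ) := by
    rw [mutLin_apply_self, hs]
  set E := mutLin (Sum.inl k) b c with hE
  set N : ℕ → K := fun p => M (E + v + (p : ℤ) • b) with hN
  have hT : ∀ (a : ℤ) (x : K), (T a : ℤ[T;T⁻¹]) • x = algebraMap ℤ[T;T⁻¹] K (T a) * x :=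
    fun a x => Algebra.smul_def _ _
  have hcomm : ∀ (a : ℤ) (x : K), x * algebraMap ℤ[T;T⁻¹] K (T a : ℤ[T;T⁻¹]) = algebraMap ℤ[T;T⁻¹] K (T a) * x :=
    fun a x => (Algebra.commutes _ _).symm
  have hL : ∀ p : ℕ, M (E + (p : ℤ) • b) * (M v + M (v + b)) =
      (T (ω E v) : ℤ[T;T⁻¹]) • (algebraMap ℤ[T;T⁻¹] K (T (-(δ * p))) * N p
        + algebraMap ℤ[T;T⁻¹] K (T (δ * (s - p))) * N (p + 1)) := by
    intro p
    rw [mul_add, h.form, h.form, smul_add, ← hT, ← hT, T_smul_T_smul, T_smul_T_smul]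
    simp only [map_add, LinearMap.add_apply, map_smul, LinearMap.smul_apply, hb.apply,
      hb.apply' h, hEk, hvk, hb.self, hN]
    congr 2
    · congr 1; simp; ring
    · congr 1; abel
    · congr 1; simp; ring
    · congr 1; push_cast; rw [add_smul, one_smul]; abel
  have hp : ∀ p, qBinomial K δ s p * M (E + (p : ℤ) • b) * (M v + M (v + b)) =
      (T (ω E v) : ℤ[T;T⁻¹]) • (algebraMap ℤ[T;T⁻¹] K (T (-(δ * p))) * qBinomial K δ s p * N p
        + algebraMap ℤ[T;T⁻¹] K (T (δ * (s - p))) * qBinomial K δ s p * N (p + 1)) := by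
    intro p
    rw [mul_assoc, hL, mul_smul_comm, mul_add, ← mul_assoc, ← mul_assoc, hcomm, hcomm]
  rw [Finset.sum_mul, Finset.sum_congr rfl fun p _ => hp p, ← Finset.smul_sum]
  congr 1
  rw [Finset.sum_add_distrib, Finset.sum_range_succ' _ (s + 1)]
  have hpas : ∀ p ∈ Finset.range (s + 1), qBinomial K δ (s + 1) (p + 1) * N (p + 1) =
      algebraMap ℤ[T;T⁻¹] K (T (-(δ * ((p + 1 : ℕ) : ℤ)))) * qBinomial K δ s (p + 1) * N (p + 1)
      + algebraMap ℤ[T;T⁻¹] K (T (δ * (s - p))) * qBinomial K δ s p * N (p + 1) := by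
    intro p _
    rw [qBinomial_pascal h.algebraMap_injective hb.ne, add_mul]
    push_cast
    rfl
  rw [Finset.sum_congr rfl hpas, Finset.sum_add_distrib, add_right_comm]
  congr 1
  have h1 := Finset.sum_range_succ' (fun p : ℕ =>
    algebraMap ℤ[T;T⁻¹] K (T (-(δ * (p : ℤ)))) * qBinomial K δ s p * N p) (s + 1)
  rw [Finset.sum_range_succ, qBinomial_eq_zero] at h1
  simp only [mul_zero, zero_mul, add_zero] at h1
  rw [h1]
  simp [qBinomial_zero, hN]

/-- The two terms are distinct basis elements, since `b` pairs with `e_k` to `δ ≠ 0` and is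
therefore nonzero. -/
theorem exchange_ne_zero [DecidableEq ι] {k : ι} {M : (ι → ℤ) → K} {b : ι → ℤ} {δ : ℤ}
    {ω : LinearMap.BilinForm ℤ (ι → ℤ)} (h : QTorus M ω) (hb : CompatCol ω k b δ) (v : ι → ℤ) :
    M v + M (v + b) ≠ 0 := by
  intro h0
  refine h.ne_zero v (h.eq_zero_of_mem (S := {v}) (S' := {v + b}) ?_ (mem_frameSpan rfl) ?_)
  · rw [Set.disjoint_singleton]
    intro hv
    have : b = 0 := by simpa using hv
    have h2 := hb.apply (Pi.single k 1)
    rw [this] at h2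
    simp at h2
    exact hb.ne h2.symm
  · rw [eq_neg_of_add_eq_zero_left h0]
    exact Submodule.neg_mem _ (mem_frameSpan rfl)

/-- This replaces the sum with `q`-binomial coefficients by the characterisation through form,
agreement and exchange relation, which is all that is used afterwards. -/
theorem QuantumSeed.isMutation (d : Fin n → ℤ) (s : QuantumSeed n r K) (k : Fin n)
    {ω : LinearMap.BilinForm ℤ (Fin n ⊕ Fin r → ℤ)} (h : QTorus s.frame ω)
    (hb : CompatCol ω (Sum.inl k) (fun i => s.mat i k) (d k)) :
    IsMutation ω (Sum.inl k) (fun i => s.mat i k) s.frame (s.mutate d k).frame := by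
  set b : Fin n ⊕ Fin r → ℤ := fun i => s.mat i k with hbdef
  set κ : Fin n ⊕ Fin r := Sum.inl k with hκ
  have hpos : ∀ c, 0 ≤ c κ → (s.mutate d k).frame c = frameMutSum (d k) s.frame s.mat k c :=
    fun c hc => if_pos hc
  have agree : ∀ u, u κ = 0 → (s.mutate d k).frame u = s.frame u := fun u hu => by
    rw [hpos u hu.ge, frameMutSum_of_eq_zero _ _ _ _ hu]
  have exchange : (s.mutate d k).frame (Pi.single κ 1) =
      s.frame (exVec κ b) + s.frame (exVec κ b + b) := by
    have h1 := frameMutSum_mul h s.mat k hb 0 le_rfl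
    rw [frameMutSum_of_eq_zero _ _ _ _ (by rfl), h.frame_zero, one_mul, map_zero,
      LinearMap.zero_apply, T_zero_smul, zero_add] at h1
    rw [hpos _ (by simp), ← h1]
  refine ⟨?_, agree, exchange⟩
  refine QForm.of_extension (k := κ) h (fun c d => h.skew _ _) ?_
    (exchange_ne_zero h hb (exVec κ b)) ?_ agree ?_ ?_
  · intro c d hc hd
    rw [LinearMap.compl₁₂_apply, mutLin_of_eq_zero _ _ hc, mutLin_of_eq_zero _ _ hd]
  -- Both terms of the exchange binomial quasi-commute with `M u` with the same power of `q`,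
  -- because `ω b u` vanishes when `u k = 0`.
  · intro u hu
    rw [add_mul, mul_add, smul_add, h.comm _ u, h.comm _ u, LinearMap.compl₁₂_apply,
      mutLin_single, mutLin_of_eq_zero _ _ hu, map_add, LinearMap.add_apply, hb.apply, hu,
      mul_zero, add_zero]
  · intro c hc
    rw [hpos c hc, hpos _ (by simp; omega)]
    exact frameMutSum_mul h s.mat k hb c hc
  · intro c hc
    rw [hpos (-c) (by simp; omega)]
    exact if_neg (not_le.2 hc)

end SeedMutation

/-! ### Compatible quantum seeds along words -/

noncomputable section Seeds

variable {n r : ℕ} {K : Type*} [DivisionRing K] [Algebra ℤ[T;T⁻¹] K]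

/-- The `j`-th column of an exchange matrix. -/
abbrev matCol (B : Matrix (Fin n ⊕ Fin r) (Fin n) ℤ) (j : Fin n) : Fin n ⊕ Fin r → ℤ :=
  fun i => B i j

theorem matCol_matMut_self (B : Matrix (Fin n ⊕ Fin r) (Fin n) ℤ) (k : Fin n) :
    matCol (matMut B k) k = -matCol B k := by
  ext i; simp [matCol, matMut]

/-- This form of the mutation rule exposes the coefficient `max 0 (-x)` that also occurs in
`mutLin`. -/
theorem sign_mul_max (x y : ℤ) :
    Int.sign x * max (x * y) 0 = max 0 (-x) * y + max 0 y * x := by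
  rcases lt_trichotomy x 0 with hx | rfl | hx
  · rw [Int.sign_eq_neg_one_of_neg hx, max_eq_right (by omega : (0 : ℤ) ≤ -x)]
    rcases le_total 0 y with hy | hy
    · rw [max_eq_right (mul_nonpos_of_nonpos_of_nonneg hx.le hy), max_eq_right hy]; ring
    · rw [max_eq_left (mul_nonneg_of_nonpos_of_nonpos hx.le hy), max_eq_left hy]; ring
  · simp
  · rw [Int.sign_eq_one_of_pos hx, max_eq_left (by omega : -x ≤ (0 : ℤ))]
    rcases le_total 0 y with hy | hy
    · rw [max_eq_left (mul_nonneg hx.le hy), max_eq_right hy]; ring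
    · rw [max_eq_right (mul_nonpos_of_nonneg_of_nonpos hx.le hy), max_eq_left hy]; ring

/-- The terms `max 0 (-b_ik) * b_kj` cancel, because `mutLin` adds what the mutation rule produces
with the opposite sign of the `k`-th entry. The identity drives both the preservation of
compatibility and the recursion for the `c`-vectors. -/
theorem mutLin_matCol_matMut {B : Matrix (Fin n ⊕ Fin r) (Fin n) ℤ} {k j : Fin n}
    (hk : B (Sum.inl k) k = 0) (hj : j ≠ k) :
    mutLin (Sum.inl k) (matCol B k) (matCol (matMut B k) j) =
      matCol B j + max 0 (B (Sum.inl k) j) • matCol B k := by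
  ext i
  by_cases hi : i = Sum.inl k
  · subst hi
    rw [mutLin_apply_self]
    simp [matCol, matMut, hk]
  · rw [mutLin_apply_of_ne _ _ _ hi]
    simp [matCol, matMut, hi, hj, sign_mul_max]
    ring

theorem matMut_neg (B : Matrix (Fin n ⊕ Fin r) (Fin n) ℤ) (k : Fin n) :
    matMut (-B) k = -matMut B k := by
  ext i j
  simp only [matMut, Matrix.neg_apply, Int.sign_neg]
  split_ifs
  · rfl
  · ring_nf

/-- A quantum seed whose frame spans a based quantum torus, with compatible exchange matrix. -/
structure IsQSeed (d : Fin n → ℤ) (M : (Fin n ⊕ Fin r → ℤ) → K)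
    (B : Matrix (Fin n ⊕ Fin r) (Fin n) ℤ) (ω : LinearMap.BilinForm ℤ (Fin n ⊕ Fin r → ℤ)) :
    Prop where
  torus : QTorus M ω
  compat : ∀ j c, ω (matCol B j) c = d j * c (Sum.inl j)

section
variable {d : Fin n → ℤ} {M : (Fin n ⊕ Fin r → ℤ) → K}
  {B : Matrix (Fin n ⊕ Fin r) (Fin n) ℤ} {ω : LinearMap.BilinForm ℤ (Fin n ⊕ Fin r → ℤ)}
  (h : IsQSeed d M B ω)
include h

theorem IsQSeed.skew (i j : Fin n) : d i * B (Sum.inl i) j = -(d j * B (Sum.inl j) i) := by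
  rw [← h.compat i (matCol B j), ← h.compat j (matCol B i), h.torus.skew]

theorem IsQSeed.diag (j : Fin n) (hj : d j ≠ 0) : B (Sum.inl j) j = 0 := by
  have h1 := h.skew j j
  have : d j * B (Sum.inl j) j = 0 := by omega
  exact (mul_eq_zero.1 this).resolve_left hj

theorem IsQSeed.compatCol (j : Fin n) (hj : d j ≠ 0) :
    CompatCol ω (Sum.inl j) (matCol B j) (d j) where
  ne := hj
  apply := h.compat j
  self := h.diag j hj

/-- `IsQSeed` does not ask for `d` to be positive precisely so that this symmetry is available; it
interchanges positive and negative entries. -/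
theorem IsQSeed.neg : IsQSeed (-d) M (-B) ω where
  torus := h.torus
  compat j c := by
    have : matCol (-B) j = -matCol B j := rfl
    rw [this, map_neg, LinearMap.neg_apply, h.compat]; simp

theorem IsQSeed.max_eq (hd : ∀ j, 0 < d j) (j k : Fin n) :
    d j * max 0 (-B (Sum.inl j) k) = max 0 (B (Sum.inl k) j) * d k := by
  have h1 := h.skew k j
  have hj := hd j
  have hk := hd k
  rw [mul_max_of_nonneg _ _ hj.le, max_mul_of_nonneg _ _ hk.le]
  congr 1
  · simp
  · linarith

/-- Mutation of frames preserves the compatibility. -/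
theorem IsQSeed.mutate (hd : ∀ j, 0 < d j) {k : Fin n} {M' : (Fin n ⊕ Fin r → ℤ) → K}
    (hM : IsMutation ω (Sum.inl k) (matCol B k) M M') :
    IsQSeed d M' (matMut B k) (ω.compl₁₂ (mutLin (Sum.inl k) (matCol B k))
      (mutLin (Sum.inl k) (matCol B k))) where
  torus := hM.qTorus h.torus (h.compatCol k (hd k).ne')
  compat j c := by
    have hk := h.diag k (hd k).ne'
    rw [LinearMap.compl₁₂_apply]
    by_cases hj : j = k
    · subst hj
      rw [matCol_matMut_self, map_neg, mutLin_of_eq_zero (Sum.inl j) (matCol B j) hk, map_neg,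
        LinearMap.neg_apply, h.compat, mutLin_apply_self]
      ring
    · rw [mutLin_matCol_matMut hk hj, map_add, map_smul, LinearMap.add_apply, LinearMap.smul_apply,
        h.compat, h.compat, mutLin_apply_self, mutLin_apply_of_ne _ _ _ (by simpa using hj),
        mul_add, mul_left_comm, h.max_eq hd j k, smul_eq_mul]
      ring

end

/-- The form of the frame of the seed reached along a word. -/
def formAlong (d : Fin n → ℤ) (s : QuantumSeed n r K)
    (ω : LinearMap.BilinForm ℤ (Fin n ⊕ Fin r → ℤ)) :
    List (Fin n) → LinearMap.BilinForm ℤ (Fin n ⊕ Fin r → ℤ)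
  | [] => ω
  | k :: w => (formAlong d s ω w).compl₁₂
      (mutLin (Sum.inl k) (matCol (s.along d w).mat k))
      (mutLin (Sum.inl k) (matCol (s.along d w).mat k))

theorem QuantumSeed.isMutation_along {d : Fin n → ℤ} (hd : ∀ j, 0 < d j) (s : QuantumSeed n r K)
    {ω : LinearMap.BilinForm ℤ (Fin n ⊕ Fin r → ℤ)} {w : List (Fin n)}
    (hw : IsQSeed d (s.along d w).frame (s.along d w).mat (formAlong d s ω w)) (k : Fin n) :
    IsMutation (formAlong d s ω w) (Sum.inl k) (matCol (s.along d w).mat k)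
      (s.along d w).frame (s.along d (k :: w)).frame :=
  QuantumSeed.isMutation d _ k hw.torus (hw.compatCol k (hd k).ne')

theorem IsQSeed.along {d : Fin n → ℤ} (hd : ∀ j, 0 < d j) {s : QuantumSeed n r K}
    {ω : LinearMap.BilinForm ℤ (Fin n ⊕ Fin r → ℤ)} (h : IsQSeed d s.frame s.mat ω)
    (w : List (Fin n)) :
    IsQSeed d (s.along d w).frame (s.along d w).mat (formAlong d s ω w) := by
  induction w with
  | nil => exact h
  | cons k w ih => exact ih.mutate hd (s.isMutation_along hd ih k)

theorem matMut_matMut (B : Matrix (Fin n ⊕ Fin r) (Fin n) ℤ) (k : Fin n) :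
    matMut (matMut B k) k = B := by
  ext i j
  by_cases h : i = Sum.inl k ∨ j = k
  · simp [matMut, h]
  · push Not at h
    simp [matMut, h.1, h.2]

/-- Mutation of quantum seeds is involutive. -/
theorem QuantumSeed.along_cons_cons {d : Fin n → ℤ} (hd : ∀ j, 0 < d j) {s : QuantumSeed n r K}
    {ω : LinearMap.BilinForm ℤ (Fin n ⊕ Fin r → ℤ)} (h : IsQSeed d s.frame s.mat ω)
    (w : List (Fin n)) (k : Fin n) : s.along d (k :: k :: w) = s.along d w := by
  have hw := h.along hd w
  have hkw := h.along hd (k :: w)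
  have h1 := s.isMutation_along hd hw k
  have h2 := s.isMutation_along hd hkw k
  have h3 := h1.symm hw.torus (hw.compatCol k (hd k).ne') hkw.torus
  have h4 : matCol (s.along d (k :: w)).mat k = -matCol (s.along d w).mat k :=
    matCol_matMut_self _ k
  rw [h4] at h2
  have h5 := h2.unique hkw.torus h3
  have h6 : (s.along d (k :: k :: w)).mat = (s.along d w).mat :=
    matMut_matMut _ k
  cases hs : s.along d (k :: k :: w)
  cases hs' : s.along d w
  rw [hs, hs'] at h5 h6
  simp only at h5 h6
  rw [h5, h6]

end Seeds

noncomputable section Laurent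

/-! ### The quantum Laurent phenomenon -/

section
variable {ι K : Type*} [DivisionRing K] [Algebra ℤ[T;T⁻¹] K]
  {M : (ι → ℤ) → K} {ω : LinearMap.BilinForm ℤ (ι → ℤ)}

/-- The quantum torus spanned by a frame. -/
abbrev torusSpan (M : (ι → ℤ) → K) : Submodule ℤ[T;T⁻¹] K := frameSpan M Set.univ

theorem QTorus.mul_mem (h : QTorus M ω) {x y : K} (hx : x ∈ torusSpan M) (hy : y ∈ torusSpan M) :
    x * y ∈ torusSpan M :=
  h.form.mul_mem_frameSpan (fun _ _ _ _ => Set.mem_univ _) hx hy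

theorem frame_mem (M : (ι → ℤ) → K) (c : ι → ℤ) : M c ∈ torusSpan M := mem_frameSpan trivial

theorem frameSpan_le_torusSpan (S : Set (ι → ℤ)) : frameSpan M S ≤ torusSpan M :=
  frameSpan_mono (Set.subset_univ S)

theorem QTorus.one_mem (h : QTorus M ω) : (1 : K) ∈ torusSpan M := by
  rw [← h.frame_zero]; exact frame_mem M 0

theorem QTorus.pow_mem (h : QTorus M ω) {x : K} (hx : x ∈ torusSpan M) (m : ℕ) :
    x ^ m ∈ torusSpan M := by
  induction m with
  | zero => simpa using h.one_mem
  | succ m ih => rw [pow_succ]; exact h.mul_mem ih hx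

theorem QTorus.frame_pow (h : QTorus M ω) (c : ι → ℤ) (m : ℕ) : M c ^ m = M ((m : ℤ) • c) := by
  induction m with
  | zero => simp [h.frame_zero]
  | succ m ih =>
    rw [pow_succ, ih, h.form, map_smul, LinearMap.smul_apply, h.self_eq_zero, smul_zero,
      T_zero_smul]
    push_cast
    rw [add_smul, one_smul]

/-- The top part of `E` with respect to `ℓ` is a monomial. -/
def TopMonomial (M : (ι → ℤ) → K) (ℓ : (ι → ℤ) →ₗ[ℤ] ℤ) (E : K) : Prop :=
  ∃ (v : ι → ℤ) (a : ℤ), E - (T a : ℤ[T;T⁻¹]) • M v ∈ frameSpan M {c | ℓ c < ℓ v}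

variable {ℓ : (ι → ℤ) →ₗ[ℤ] ℤ}

theorem TopMonomial.mem {E : K} (hE : TopMonomial M ℓ E) : E ∈ torusSpan M := by
  obtain ⟨v, a, hv⟩ := hE
  rw [← sub_add_cancel E ((T a : ℤ[T;T⁻¹]) • M v)]
  exact Submodule.add_mem _ (frameSpan_le_torusSpan _ hv)
    (Submodule.smul_mem _ _ (frame_mem M v))

theorem TopMonomial.mul (h : QTorus M ω) {E E' : K} (hE : TopMonomial M ℓ E)
    (hE' : TopMonomial M ℓ E') : TopMonomial M ℓ (E * E') := by
  obtain ⟨v, a, hv⟩ := hE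
  obtain ⟨v', a', hv'⟩ := hE'
  refine ⟨v + v', a + a' + ω v v', ?_⟩
  set y := E - (T a : ℤ[T;T⁻¹]) • M v with hy
  set y' := E' - (T a' : ℤ[T;T⁻¹]) • M v' with hy'
  have e1 : E = (T a : ℤ[T;T⁻¹]) • M v + y := by rw [hy]; abel
  have e2 : E' = (T a' : ℤ[T;T⁻¹]) • M v' + y' := by rw [hy']; abel
  have e3 : ((T a : ℤ[T;T⁻¹]) • M v) * ((T a' : ℤ[T;T⁻¹]) • M v') =
      (T (a + a' + ω v v') : ℤ[T;T⁻¹]) • M (v + v') := by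
    rw [T_smul_mul_T_smul, h.form, T_smul_T_smul]
  have e4 : E * E' - (T (a + a' + ω v v') : ℤ[T;T⁻¹]) • M (v + v') =
      ((T a : ℤ[T;T⁻¹]) • M v) * y' + y * ((T a' : ℤ[T;T⁻¹]) • M v') + y * y' := by
    rw [← e3, e1, e2]; simp only [add_mul, mul_add]; abel
  rw [e4]
  refine Submodule.add_mem _ (Submodule.add_mem _ ?_ ?_) ?_
  · rw [smul_mul_assoc]
    refine Submodule.smul_mem _ _ (h.form.mul_mem_frameSpan ?_ (mem_frameSpan (Set.mem_singleton v))
      hv')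
    rintro _ rfl d hd
    simpa using hd
  · rw [mul_smul_comm]
    refine Submodule.smul_mem _ _ (h.form.mul_mem_frameSpan ?_ hv
      (mem_frameSpan (Set.mem_singleton v')))
    rintro c hc _ rfl
    simpa using hc
  · refine h.form.mul_mem_frameSpan ?_ hv hv'
    intro c hc d hd
    simp only [Set.mem_ofPred_eq, map_add] at hc hd ⊢
    omega

theorem TopMonomial.pow (h : QTorus M ω) {E : K} (hE : TopMonomial M ℓ E) (m : ℕ) :
    TopMonomial M ℓ (E ^ m) := by
  induction m with
  | zero => exact ⟨0, 0, by simp [h.frame_zero]⟩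
  | succ m ih => rw [pow_succ]; exact ih.mul h hE

theorem exists_window (ℓ : (ι → ℤ) →ₗ[ℤ] ℤ) {x : K} (hx : x ∈ torusSpan M) :
    ∃ (lo : ℤ) (N : ℕ), x ∈ frameSpan M {c | lo ≤ ℓ c ∧ ℓ c < lo + N} := by
  suffices ∃ lo hi : ℤ, x ∈ frameSpan M {c | lo ≤ ℓ c ∧ ℓ c < hi} by
    obtain ⟨lo, hi, h⟩ := this
    refine ⟨lo, (hi - lo).toNat, frameSpan_mono ?_ h⟩
    rintro c ⟨h1, h2⟩
    exact ⟨h1, by omega⟩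
  induction hx using Submodule.span_induction with
  | mem x hx =>
    obtain ⟨c, -, rfl⟩ := hx
    exact ⟨ℓ c, ℓ c + 1, mem_frameSpan ⟨le_rfl, by omega⟩⟩
  | zero => exact ⟨0, 0, Submodule.zero_mem _⟩
  | add x y _ _ hx hy =>
    obtain ⟨lo, hi, h1⟩ := hx
    obtain ⟨lo', hi', h2⟩ := hy
    refine ⟨min lo lo', max hi hi', Submodule.add_mem _ (frameSpan_mono ?_ h1)
      (frameSpan_mono ?_ h2)⟩
    all_goals
      rintro c ⟨h1, h2⟩
      exact ⟨by omega, by omega⟩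
  | smul a x _ hx =>
    obtain ⟨lo, hi, h1⟩ := hx
    exact ⟨lo, hi, Submodule.smul_mem _ _ h1⟩

/-- Compare the components of `ℓ`-degree `s + ℓ v`. On the left only `a1` times the top monomial of
`E` reaches this degree; on the right, `X` being homogeneous, the component is `X` times a component
of `f`. The monomial is invertible in the torus. -/
theorem TopMonomial.dvd_top (h : QTorus M ω) {E : K} (hE : TopMonomial M ℓ E) {s t : ℤ} {X : K}
    (hX : X ∈ frameSpan M {c | ℓ c = t}) {a1 a0 f : K} (ha1 : a1 ∈ frameSpan M {c | ℓ c = s})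
    (ha0 : a0 ∈ frameSpan M {c | ℓ c < s}) (hf : f ∈ torusSpan M)
    (haf : (a1 + a0) * E = X * f) : ∃ g ∈ torusSpan M, a1 = X * g := by
  obtain ⟨v, e, hv⟩ := hE
  obtain ⟨f1, hf1, f0, hf0, rfl⟩ := exists_add_of_mem_frameSpan {c | ℓ c = s + ℓ v - t} hf
  rw [Set.univ_inter] at hf1 hf0
  obtain ⟨E', hE'⟩ : ∃ E', E' = E - (T e : ℤ[T;T⁻¹]) • M v := ⟨_, rfl⟩
  rw [← hE'] at hv
  have e1 : E = (T e : ℤ[T;T⁻¹]) • M v + E' := by rw [hE']; abel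
  have e2 : a1 * ((T e : ℤ[T;T⁻¹]) • M v) - X * f1 = X * f0 - (a1 * E' + a0 * E) := by
    have : a1 * ((T e : ℤ[T;T⁻¹]) • M v) + a1 * E' + a0 * E = X * f1 + X * f0 := by
      rw [← mul_add, ← mul_add, ← e1, ← add_mul, haf]
    rw [sub_eq_sub_iff_add_eq_add, ← add_assoc, this]; abel
  have hl : a1 * ((T e : ℤ[T;T⁻¹]) • M v) - X * f1 ∈ frameSpan M {c | ℓ c = s + ℓ v} := by
    refine Submodule.sub_mem _ ?_ ?_
    · rw [mul_smul_comm]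
      refine Submodule.smul_mem _ _ (h.form.mul_mem_frameSpan ?_ ha1
        (mem_frameSpan (Set.mem_singleton v)))
      rintro c hc _ rfl
      simpa using hc
    · refine h.form.mul_mem_frameSpan ?_ hX hf1
      intro c hc d hd
      simp only [Set.mem_ofPred_eq, map_add] at hc hd ⊢
      omega
  have hr : X * f0 - (a1 * E' + a0 * E) ∈ frameSpan M {c | ℓ c = s + ℓ v}ᶜ := by
    have hE2 : E ∈ frameSpan M {c | ℓ c ≤ ℓ v} := by
      rw [e1]
      refine Submodule.add_mem _ (Submodule.smul_mem _ _ (mem_frameSpan ?_))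
        (frameSpan_mono ?_ hv)
      · simp
      · intro c hc
        simp only [Set.mem_ofPred_eq] at hc ⊢
        exact hc.le
    refine Submodule.sub_mem _ ?_ (Submodule.add_mem _ ?_ ?_)
    · refine h.form.mul_mem_frameSpan ?_ hX hf0
      intro c hc d hd
      simp only [Set.mem_ofPred_eq, Set.mem_compl_iff, map_add] at hc hd ⊢
      omega
    · refine h.form.mul_mem_frameSpan ?_ ha1 hv
      intro c hc d hd
      simp only [Set.mem_ofPred_eq, Set.mem_compl_iff, map_add] at hc hd ⊢
      omega
    · refine h.form.mul_mem_frameSpan ?_ ha0 hE2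
      intro c hc d hd
      simp only [Set.mem_ofPred_eq, Set.mem_compl_iff, map_add] at hc hd ⊢
      omega
  rw [← e2] at hr
  have h0 := h.eq_zero_of_mem disjoint_compl_right hl hr
  rw [sub_eq_zero] at h0
  refine ⟨f1 * ((T (-e) : ℤ[T;T⁻¹]) • M (-v)), h.mul_mem (frameSpan_le_torusSpan _ hf1)
    (Submodule.smul_mem _ _ (frame_mem M _)), ?_⟩
  rw [← mul_assoc, ← h0, mul_assoc, T_smul_mul_T_smul, add_neg_cancel, T_zero_smul, h.mul_neg,
    mul_one]

/-- The right ideal generated by an `ℓ`-homogeneous element is prime to elements whose top part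
is a monomial. -/
theorem TopMonomial.dvd_of_dvd_mul (h : QTorus M ω) {E : K} (hE : TopMonomial M ℓ E) {t : ℤ} {X : K}
    (hX : X ∈ frameSpan M {c | ℓ c = t}) {a f : K} (ha : a ∈ torusSpan M) (hf : f ∈ torusSpan M)
    (haf : a * E = X * f) : ∃ g ∈ torusSpan M, a = X * g := by
  obtain ⟨lo, N, haN⟩ := exists_window ℓ ha
  clear ha
  induction N generalizing a f with
  | zero =>
    refine ⟨0, Submodule.zero_mem _, ?_⟩
    have : frameSpan M {c | lo ≤ ℓ c ∧ ℓ c < lo + (0 : ℕ)} = ⊥ := by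
      rw [eq_bot_iff, frameSpan_le]
      rintro c ⟨h1, h2⟩
      simp only [Nat.cast_zero, add_zero] at h2
      omega
    rw [this, Submodule.mem_bot] at haN
    rw [haN, mul_zero]
  | succ N ih =>
    obtain ⟨a1, ha1, a0, ha0, rfl⟩ := exists_add_of_mem_frameSpan {c | ℓ c = lo + N} haN
    replace ha1 : a1 ∈ frameSpan M {c | ℓ c = lo + N} :=
      frameSpan_mono Set.inter_subset_right ha1
    replace ha0 : a0 ∈ frameSpan M {c | lo ≤ ℓ c ∧ ℓ c < lo + N} := by
      refine frameSpan_mono ?_ ha0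
      rintro c ⟨⟨h1, h2⟩, h3⟩
      simp only [Set.mem_compl_iff, Set.mem_ofPred_eq] at h3
      push_cast at h2
      exact ⟨h1, by omega⟩
    -- The top layer of `a` is a right multiple of `X`; subtracting it shortens the window of
    -- `ℓ`-degrees by one.
    obtain ⟨g1, hg1, rfl⟩ := hE.dvd_top h hX ha1 (frameSpan_mono (fun c hc => hc.2) ha0) hf haf
    obtain ⟨g, hg, rfl⟩ := ih (a := a0) (f := f - g1 * E)
      (Submodule.sub_mem _ hf (h.mul_mem hg1 hE.mem))
      (by rw [mul_sub, ← haf, add_mul, ← mul_assoc, add_sub_cancel_left]) ha0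
    exact ⟨g1 + g, Submodule.add_mem _ hg1 hg, by rw [mul_add]⟩

/-- Here `y` has a power of `X` as left denominator and `E` as right denominator, and these are
coprime in the sense of `TopMonomial.dvd_of_dvd_mul`. So the factors `X` can be removed one at a
time. -/
theorem TopMonomial.mem_of_pow_mul_mem (h : QTorus M ω) {E : K} (hE : TopMonomial M ℓ E) {t : ℤ}
    {X : K} (hX : X ∈ frameSpan M {c | ℓ c = t}) (hX0 : X ≠ 0) {y : K} (hyE : y * E ∈ torusSpan M)
    (N : ℕ) (hy : X ^ N * y ∈ torusSpan M) : y ∈ torusSpan M := by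
  induction N with
  | zero => simpa using hy
  | succ N ih =>
    apply ih
    rw [pow_succ', mul_assoc] at hy
    have hf : X ^ N * (y * E) ∈ torusSpan M :=
      h.mul_mem (h.pow_mem (frameSpan_le_torusSpan _ hX) N) hyE
    obtain ⟨g, hg, hag⟩ := hE.dvd_of_dvd_mul h hX hy hf (by simp only [mul_assoc])
    rwa [mul_left_cancel₀ hX0 hag]

theorem exists_lower_bound [Finite ι] {x : K} (hx : x ∈ torusSpan M) :
    ∃ N : ℕ, x ∈ frameSpan M {c | ∀ i, -(N : ℤ) ≤ c i} := by
  induction hx using Submodule.span_induction with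
  | mem x hx =>
    obtain ⟨c, -, rfl⟩ := hx
    cases nonempty_fintype ι
    refine ⟨∑ i, (c i).natAbs, mem_frameSpan fun i => ?_⟩
    have := Finset.single_le_sum (f := fun i => (c i).natAbs) (fun _ _ => Nat.zero_le _)
      (Finset.mem_univ i)
    omega
  | zero => exact ⟨0, Submodule.zero_mem _⟩
  | add x y _ _ hx hy =>
    obtain ⟨N, h1⟩ := hx
    obtain ⟨N', h2⟩ := hy
    refine ⟨max N N', Submodule.add_mem _ (frameSpan_mono ?_ h1) (frameSpan_mono ?_ h2)⟩
    all_goals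
      intro c hc i
      have := hc i
      push_cast
      omega
  | smul a x _ hx =>
    obtain ⟨N, h1⟩ := hx
    exact ⟨N, Submodule.smul_mem _ _ h1⟩

theorem IsMutation.mem_frameSpan [DecidableEq ι] {k : ι} {b : ι → ℤ} {M' : (ι → ℤ) → K}
    (h : QTorus M ω) (hM : IsMutation ω k b M M') {c : ι → ℤ} (hc : 0 ≤ c k) :
    M' c ∈ frameSpan M {a | ∃ p : ℤ, 0 ≤ p ∧ a = mutLin k b c + p • b} := by
  rw [← sub_add_cancel (M' c) (M (mutLin k b c))]
  refine Submodule.add_mem _ (frameSpan_mono ?_ (hM.lead h c hc)) (_root_.mem_frameSpan ⟨0, by simp⟩)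
  rintro _ ⟨p, hp, rfl⟩
  exact ⟨p, by omega, rfl⟩

end
end Laurent

/-! ### The rank two comparison and propagation along paths -/

noncomputable section Laurent

section
variable {ι K : Type*} [DivisionRing K] [Algebra ℤ[T;T⁻¹] K] [DecidableEq ι]
  {M M1 M2 M12 : (ι → ℤ) → K} {ω ω1 ω2 ω12 : LinearMap.BilinForm ℤ (ι → ℤ)}

theorem IsMutation.form_eq {k : ι} {b : ι → ℤ} (hM : IsMutation ω k b M M1) (h1 : QTorus M1 ω1) :
    ω.compl₁₂ (mutLin k b) (mutLin k b) = ω1 :=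
  LinearMap.ext fun c => LinearMap.ext fun d => h1.form_eq_of_qForm hM.form c d

theorem IsMutation.symm' {k : ι} {b : ι → ℤ} {δ : ℤ} (h : QTorus M ω) (hb : CompatCol ω k b δ)
    (hM : IsMutation ω k b M M1) (h1 : QTorus M1 ω1) : IsMutation ω1 k (-b) M1 M := by
  have := hM.form_eq h1
  subst this
  exact hM.symm h hb h1

omit [DecidableEq ι] in
theorem topMonomial_of_sub {ℓ : (ι → ℤ) →ₗ[ℤ] ℤ} {x : K} (v : ι → ℤ) (a : ℤ)
    (hx : x - (T a : ℤ[T;T⁻¹]) • M v ∈ frameSpan M {c | ℓ c < ℓ v}) : TopMonomial M ℓ x :=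
  ⟨v, a, hx⟩

omit [DecidableEq ι] in
theorem topMonomial_frame (ℓ : (ι → ℤ) →ₗ[ℤ] ℤ) (v : ι → ℤ) : TopMonomial M ℓ (M v) :=
  topMonomial_of_sub v 0 (by simp)

omit [DecidableEq ι] in
theorem topMonomial_add {ℓ : (ι → ℤ) →ₗ[ℤ] ℤ} {x : K} (v : ι → ℤ)
    (hx : x ∈ frameSpan M {c | ℓ c < ℓ v}) : TopMonomial M ℓ (M v + x) :=
  topMonomial_of_sub v 0 (by simpa using hx)

/-- Rank two criterion: an element that is Laurent at `M1` and `M2` is Laurent at `M12`, where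
`M12` is the mutation of `M1` in direction `j`, and `M`, `M1` and `M`, `M2` are neighbours in the
directions `k` and `j`. -/
theorem mem_torusSpan_of_topMonomial [Finite ι] {k j : ι} (hkj : k ≠ j)
    (h2 : QTorus M2 ω2) (h1 : QTorus M1 ω1) (h12 : QTorus M12 ω12) {b1 : ι → ℤ}
    (ag1 : ∀ c, c k = 0 → M1 c = M c) (ag2 : ∀ c, c j = 0 → M2 c = M c)
    (m12 : IsMutation ω12 j b1 M12 M1)
    {ℓ : (ι → ℤ) →ₗ[ℤ] ℤ} {t : ℤ} (hX : M1 (Pi.single j 1) ∈ frameSpan M12 {c | ℓ c = t})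
    (hk : TopMonomial M12 ℓ (M (Pi.single k 1))) (hj : TopMonomial M12 ℓ (M2 (Pi.single j 1)))
    {x : K} (hx1 : x ∈ torusSpan M1) (hx2 : x ∈ torusSpan M2) : x ∈ torusSpan M12 := by
  obtain ⟨N1, hN1⟩ := exists_lower_bound hx1
  obtain ⟨N2, hN2⟩ := exists_lower_bound hx2
  have hk' : M2 (Pi.single k 1) = M (Pi.single k 1) := ag2 _ (by simp [hkj.symm])
  rw [← hk'] at hk
  -- Being Laurent at `M1`, `x` needs only a power of `M1 e_j` as left denominator over `M12`. Being
  -- Laurent at `M2`, it needs only powers of `M e_k` and `M2 e_j` as right denominators.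
  refine ((hk.pow h12 N2).mul h12 (hj.pow h12 N2)).mem_of_pow_mul_mem h12 hX (h1.ne_zero _) ?_ N1 ?_
  · have hsub : frameSpan M2 {c | 0 ≤ c k ∧ 0 ≤ c j} ≤ torusSpan M12 := by
      rw [frameSpan_le]
      rintro c ⟨hck, hcj⟩
      obtain ⟨p, hp⟩ := Int.eq_ofNat_of_zero_le hck
      obtain ⟨s, hs⟩ := Int.eq_ofNat_of_zero_le hcj
      have hc : c = (c - c k • Pi.single k 1 - c j • Pi.single j 1)
          + (c k • Pi.single k 1 + c j • Pi.single j 1) := by abel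
      set u := c - c k • Pi.single k 1 - c j • Pi.single j 1 with hu
      have huk : u k = 0 := by simp [hu, hkj]
      have huj : u j = 0 := by simp [hu, hkj.symm]
      have huM : M2 u ∈ torusSpan M12 := by
        -- All four frames agree on exponents vanishing at both `j` and `k`.
        rw [ag2 u huj, ← ag1 u huk, m12.agree u huj]
        exact frame_mem _ _
      rw [hc, h2.form.add, h2.form.add (c k • _), hp, hs, ← h2.frame_pow, ← h2.frame_pow]
      refine Submodule.smul_mem _ _ (h12.mul_mem huM (Submodule.smul_mem _ _ (h12.mul_mem ?_ ?_)))
      · exact h12.pow_mem hk.mem _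
      · exact h12.pow_mem hj.mem _
    apply hsub
    rw [h2.frame_pow, h2.frame_pow, h2.form, mul_smul_comm]
    refine Submodule.smul_mem _ _ (h2.form.mul_mem_frameSpan ?_ hN2
      (mem_frameSpan (Set.mem_singleton _)))
    rintro c hc _ rfl
    have h3 := hc k
    have h4 := hc j
    simp only [Set.mem_ofPred_eq]
    constructor
    · simp [hkj]; omega
    · simp [hkj.symm]; omega
  · have hsub : frameSpan M1 {c | 0 ≤ c j} ≤ torusSpan M12 := by
      rw [frameSpan_le]
      intro c hc
      exact frameSpan_le_torusSpan _ (m12.mem_frameSpan h12 hc)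
    apply hsub
    rw [h1.frame_pow]
    refine h1.form.mul_mem_frameSpan ?_ (mem_frameSpan (Set.mem_singleton _)) hN1
    rintro _ rfl c hc
    have h4 := hc j
    simp only [Set.mem_ofPred_eq]
    simp; omega

end

variable {n r : ℕ} {K : Type*} [DivisionRing K] [Algebra ℤ[T;T⁻¹] K]
  {d : Fin n → ℤ} {M M1 M2 M12 : (Fin n ⊕ Fin r → ℤ) → K}
  {B : Matrix (Fin n ⊕ Fin r) (Fin n) ℤ}
  {ω ω1 ω2 ω12 : LinearMap.BilinForm ℤ (Fin n ⊕ Fin r → ℤ)} {k j : Fin n}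

/-- The exchange of `j` at the seed obtained by mutation in direction `k`, expressed in the initial
seed, when `b_{kj} > 0`. -/
theorem topMonomial_of_pos (hd : ∀ j, d j ≠ 0) (hkj : k ≠ j) (h : IsQSeed d M B ω)
    (hk : IsMutation ω (Sum.inl k) (matCol B k) M M1)
    (hj : IsMutation ω (Sum.inl j) (matCol B j) M M2)
    (h1 : IsQSeed d M1 (matMut B k) ω1)
    (h1j : IsMutation ω1 (Sum.inl j) (matCol (matMut B k) j) M1 M12)
    (h12 : QTorus M12 ω12) (hpos : 0 < B (Sum.inl k) j) (hneg : B (Sum.inl j) k < 0) :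
    ∃ (ℓ : (Fin n ⊕ Fin r → ℤ) →ₗ[ℤ] ℤ) (t : ℤ),
      M1 (Pi.single (Sum.inl j) 1) ∈ frameSpan M12 {c | ℓ c = t} ∧
      TopMonomial M12 ℓ (M (Pi.single (Sum.inl k) 1)) ∧
      TopMonomial M12 ℓ (M2 (Pi.single (Sum.inl j) 1)) := by
  have m12 := h1j.symm' h1.torus (h1.compatCol j (hd j)) h12
  have mk := hk.symm' h.torus (h.compatCol k (hd k)) h1.torus
  have hdk := h.diag k (hd k)
  have hdj := h.diag j (hd j)
  have hdj1 := h1.diag j (hd j)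
  have hne : (Sum.inl k : Fin n ⊕ Fin r) ≠ Sum.inl j := by simpa using hkj
  -- With the `j`-th coordinate as degree, `M1 c` is homogeneous of degree `-c_j` over `M12`
  -- whenever `c_j ≥ 0`, since the exchange column vanishes at `j`.
  set ℓ : (Fin n ⊕ Fin r → ℤ) →ₗ[ℤ] ℤ := LinearMap.proj (Sum.inl j) with hℓ
  have hmem : ∀ c : Fin n ⊕ Fin r → ℤ, 0 ≤ c (Sum.inl j) →
      M1 c ∈ frameSpan M12 {a | ℓ a = -c (Sum.inl j)} := by
    intro c hc
    refine frameSpan_mono ?_ (m12.mem_frameSpan h12 hc)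
    rintro _ ⟨p, -, rfl⟩
    simp [hℓ, mutLin_apply_self, matCol, hdj1]
  refine ⟨ℓ, -1, by simpa using hmem (Pi.single (Sum.inl j) 1) (by simp), ?_, ?_⟩
  · have e1 : exVec (Sum.inl k) (-matCol B k) + -matCol B k = exVec (Sum.inl k) (matCol B k) := by
      rw [exVec_neg (Sum.inl k) (matCol B k) hdk]; abel
    have e2 : exVec (Sum.inl k) (-matCol B k) (Sum.inl j) = 0 := by
      rw [exVec_of_ne _ _ hne.symm]; simp [matCol]; omega
    have e3 : 0 < exVec (Sum.inl k) (matCol B k) (Sum.inl j) := by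
      rw [exVec_of_ne _ _ hne.symm]; simp [matCol]; omega
    rw [mk.exchange, e1, ← h1j.agree _ e2]
    refine topMonomial_add _ (frameSpan_mono ?_ (hmem _ e3.le))
    intro c hc
    simp only [Set.mem_ofPred_eq, hℓ, LinearMap.proj_apply] at hc ⊢
    omega
  -- As `b_kj > 0`, the exponent `w` vanishes at `k`, so `M w = M1 w`, while `M (w + bj)` has
  -- leading term `M1 (w + b1)` over `M1`. These two terms form the exchange binomial of `j` at
  -- `M1`, hence a single monomial of degree `1` over `M12`. The remainder `y` has degree at most
  -- `0` because `b_jk < 0`.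
  · set w := exVec (Sum.inl j) (matCol B j) with hw
    set bj := matCol B j with hbj
    set b1 := matCol (matMut B k) j with hb1
    have hwk : w (Sum.inl k) = 0 := by
      rw [hw, exVec_of_ne _ _ hne]; simp [hbj, matCol]; omega
    have hE : mutLin (Sum.inl k) (-matCol B k) (w + bj) = w + b1 := by
      rw [map_add, mutLin_of_eq_zero _ _ hwk, mutLin_neg_apply (Sum.inl k) (matCol B k) hdk]
      have h3 := congrArg (mutLin (Sum.inl k) (matCol B k)) (mutLin_matCol_matMut hdk hkj.symm)
      rw [mutLin_mutLin, map_add, map_smul, mutLin_of_eq_zero (Sum.inl k) (matCol B k) (c := matCol B k) hdk,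
        max_eq_right hpos.le] at h3
      rw [hb1, h3]
    have hlead := mk.lead h1.torus (w + bj) (by
      rw [Pi.add_apply, hwk, zero_add]; exact hpos.le)
    rw [hE] at hlead
    set y := M (w + bj) - M1 (w + b1) with hy
    have hb1j : b1 (Sum.inl j) = 0 := hdj1
    have hwj : w (Sum.inl j) = -1 := exVec_self _ _
    have hyM : y ∈ frameSpan M12 {c | ℓ c ≤ 0} := by
      have : frameSpan M1 {c | 0 ≤ c (Sum.inl j)} ≤ frameSpan M12 {c | ℓ c ≤ 0} := by
        rw [frameSpan_le]
        intro c hc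
        simp only [Set.mem_ofPred_eq] at hc
        refine frameSpan_mono ?_ (hmem c hc)
        intro a ha
        simp only [Set.mem_ofPred_eq] at ha ⊢
        omega
      refine this (frameSpan_mono ?_ hlead)
      rintro _ ⟨p, hp, rfl⟩
      simp only [Set.mem_ofPred_eq, Pi.add_apply, hwj, hb1j, Pi.smul_apply, Pi.neg_apply, matCol,
        smul_eq_mul]
      nlinarith
    set v := exVec (Sum.inl j) b1 with hv
    have hvj : v (Sum.inl j) = -1 := exVec_self _ _
    have huj : (w - v) (Sum.inl j) = 0 := by simp [hwj, hvj]
    have hex : M12 (Pi.single (Sum.inl j) 1) * M12 (w - v) =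
        (T (ω1 v (w - v)) : ℤ[T;T⁻¹]) • (M1 w + M1 (w + b1)) := by
      rw [h1j.exchange, h1j.agree _ huj, add_mul, h1.torus.form, h1.torus.form, map_add,
        LinearMap.add_apply, h1.compat, huj, mul_zero, add_zero, ← smul_add]
      congr 3
      · abel
      · abel
    have hM2 : M2 (Pi.single (Sum.inl j) 1) = (M1 w + M1 (w + b1)) + y := by
      rw [hj.exchange, hy, hk.agree w hwk]; abel
    rw [h12.form, eq_comm, T_smul_eq_iff, T_smul_T_smul] at hex
    rw [hM2, hex]
    refine topMonomial_of_sub (Pi.single (Sum.inl j) 1 + (w - v))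
      (-ω1 v (w - v) + ω12 (Pi.single (Sum.inl j) 1) (w - v)) ?_
    · rw [add_sub_cancel_left]
      refine frameSpan_mono ?_ hyM
      intro c hc
      simp only [Set.mem_ofPred_eq] at hc ⊢
      have : ℓ (Pi.single (Sum.inl j) 1 + (w - v)) = 1 := by
        simp [hℓ, hwj, hvj]
      omega

/-- The two mutations do not interact. Pairing with `e_k` is constant on the exchange binomial of
`j` and takes values differing by `d k ≠ 0` on that of `k`, whereas `M2 e_j` is the monomial `M12
e_j`. -/
theorem topMonomial_of_zero (hd : ∀ j, d j ≠ 0) (hkj : k ≠ j) (h : IsQSeed d M B ω)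
    (hk : IsMutation ω (Sum.inl k) (matCol B k) M M1)
    (hj : IsMutation ω (Sum.inl j) (matCol B j) M M2)
    (h1 : IsQSeed d M1 (matMut B k) ω1)
    (h1j : IsMutation ω1 (Sum.inl j) (matCol (matMut B k) j) M1 M12)
    (h12 : IsQSeed d M12 (matMut (matMut B k) j) ω12) (hkj0 : B (Sum.inl k) j = 0)
    (hjk0 : B (Sum.inl j) k = 0) :
    ∃ (ℓ : (Fin n ⊕ Fin r → ℤ) →ₗ[ℤ] ℤ) (t : ℤ),
      M1 (Pi.single (Sum.inl j) 1) ∈ frameSpan M12 {c | ℓ c = t} ∧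
      TopMonomial M12 ℓ (M (Pi.single (Sum.inl k) 1)) ∧
      TopMonomial M12 ℓ (M2 (Pi.single (Sum.inl j) 1)) := by
  have m12 := h1j.symm' h1.torus (h1.compatCol j (hd j)) h12.torus
  have mk := hk.symm' h.torus (h.compatCol k (hd k)) h1.torus
  have hdk := h.diag k (hd k)
  have hne : (Sum.inl k : Fin n ⊕ Fin r) ≠ Sum.inl j := by simpa using hkj
  set b1 := matCol (matMut B k) j with hb1
  have hb1j : b1 = matCol B j := by
    ext i
    by_cases hi : i = Sum.inl k
    · subst hi; simp [hb1, matCol, matMut, hkj0]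
    · simp [hb1, matCol, matMut, hi, hkj.symm, hkj0]
  have hb12k : matCol (matMut (matMut B k) j) k = -matCol B k := by
    have h0 : matMut B k (Sum.inl j) k = 0 := by simp [matMut, hjk0]
    have h0' : matMut B k = fun i l => matMut B k i l := rfl
    ext i
    by_cases hi : i = Sum.inl j
    · subst hi
      simp [matCol, matMut, hjk0]
    · have : matMut (matMut B k) j i k = matMut B k i k := by
        conv_lhs => rw [matMut]
        simp [hi, hkj, h0]
      simp only [matCol, this]
      simp [matMut]
  have hb12j : matCol (matMut (matMut B k) j) j = -b1 := matCol_matMut_self _ _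
  set ℓ : (Fin n ⊕ Fin r → ℤ) →ₗ[ℤ] ℤ := LinearMap.flip ω12 (Pi.single (Sum.inl k) 1) with hℓ
  have hℓj : ℓ (-b1) = 0 := by
    have := h12.compat j (Pi.single (Sum.inl k) 1)
    rw [hb12j] at this
    rw [hℓ, LinearMap.flip_apply, this]
    simp [hkj.symm]
  have hℓk : ℓ (-matCol B k) = d k := by
    have := h12.compat k (Pi.single (Sum.inl k) 1)
    rw [hb12k] at this
    rw [hℓ, LinearMap.flip_apply, this]
    simp
  refine ⟨ℓ, ℓ (exVec (Sum.inl j) (-b1)), ?_, ?_, ?_⟩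
  · rw [m12.exchange]
    refine Submodule.add_mem _ (mem_frameSpan rfl) (mem_frameSpan ?_)
    rw [Set.mem_ofPred_eq, map_add, hℓj, add_zero]
  · have e1 : exVec (Sum.inl k) (-matCol B k) (Sum.inl j) = 0 := by
      rw [exVec_of_ne _ _ hne.symm]; simp [matCol, hjk0]
    rw [mk.exchange, ← h1j.agree _ e1, ← h1j.agree (_ + _) (by
      rw [Pi.add_apply, e1]; simp [matCol, hjk0])]
    rcases lt_or_gt_of_ne (hd k) with hdk' | hdk'
    · refine topMonomial_add _ (mem_frameSpan ?_)
      rw [Set.mem_ofPred_eq, map_add, hℓk]; omega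
    · rw [add_comm]
      refine topMonomial_add _ (mem_frameSpan ?_)
      rw [Set.mem_ofPred_eq, map_add, hℓk]; omega
  · have e1 : exVec (Sum.inl j) (matCol B j) (Sum.inl k) = 0 := by
      rw [exVec_of_ne _ _ hne]; simp [matCol, hkj0]
    rw [hj.exchange, ← hk.agree _ e1, ← hk.agree (_ + _) (by
      rw [Pi.add_apply, e1]; simp [matCol, hkj0]), ← hb1j, ← h1j.exchange]
    exact topMonomial_frame _ _

/-- Only the sign of `b_kj` matters, and a negative entry becomes positive when the matrix and `d`
are both negated. -/
theorem mem_torusSpan_of_neighbours (hd : ∀ j, 0 < d j) (hkj : k ≠ j) (h : IsQSeed d M B ω)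
    (hk : IsMutation ω (Sum.inl k) (matCol B k) M M1)
    (hj : IsMutation ω (Sum.inl j) (matCol B j) M M2)
    (h1 : IsQSeed d M1 (matMut B k) ω1) (h2 : QTorus M2 ω2)
    (h1j : IsMutation ω1 (Sum.inl j) (matCol (matMut B k) j) M1 M12)
    (h12 : IsQSeed d M12 (matMut (matMut B k) j) ω12)
    {x : K} (hx1 : x ∈ torusSpan M1) (hx2 : x ∈ torusSpan M2) : x ∈ torusSpan M12 := by
  have hd0 : ∀ j, d j ≠ 0 := fun j => (hd j).ne'
  have hsk := h.skew k j
  have hdk := hd k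
  have hdj := hd j
  have : ∃ (ℓ : (Fin n ⊕ Fin r → ℤ) →ₗ[ℤ] ℤ) (t : ℤ),
      M1 (Pi.single (Sum.inl j) 1) ∈ frameSpan M12 {c | ℓ c = t} ∧
      TopMonomial M12 ℓ (M (Pi.single (Sum.inl k) 1)) ∧
      TopMonomial M12 ℓ (M2 (Pi.single (Sum.inl j) 1)) := by
    rcases lt_trichotomy 0 (B (Sum.inl k) j) with hpos | hzero | hneg
    · refine topMonomial_of_pos hd0 hkj h hk hj h1 h1j h12.torus hpos ?_
      nlinarith [mul_pos hdk hpos]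
    · refine topMonomial_of_zero hd0 hkj h hk hj h1 h1j h12 hzero.symm ?_
      rw [← hzero, mul_zero, eq_comm, neg_eq_zero] at hsk
      exact (mul_eq_zero.1 hsk).resolve_left hdj.ne'
    · have hk' := hk.flip h.torus (h.compatCol k (hd0 k))
      have hj' := hj.flip h.torus (h.compatCol j (hd0 j))
      have h1j' := h1j.flip h1.torus (h1.compatCol j (hd0 j))
      have h1' := h1.neg
      rw [← matMut_neg] at h1'
      have e : -matCol (matMut B k) j = matCol (matMut (-B) k) j := by
        rw [matMut_neg]; rfl
      rw [e] at h1j'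
      refine topMonomial_of_pos (d := -d) (fun j => neg_ne_zero.2 (hd0 j)) hkj h.neg hk' hj' h1'
        h1j' h12.torus (by simpa using hneg) ?_
      simp only [Matrix.neg_apply]
      nlinarith [mul_pos hdk (neg_pos.2 hneg)]
  obtain ⟨ℓ, t, hX, hXk, hXj⟩ := this
  exact mem_torusSpan_of_topMonomial (by simpa using hkj) h2 h1.torus h12.torus hk.agree
    hj.agree (h1j.symm' h1.torus (h1.compatCol j (hd0 j)) h12.torus) hX hXk hXj hx1 hx2

/-- The quantum Laurent phenomenon. -/
theorem QuantumSeed.laurent (hd : ∀ j, 0 < d j) {s : QuantumSeed n r K}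
    (h : IsQSeed d s.frame s.mat ω) (w : List (Fin n)) (l : Fin n) :
    (s.along d w).frame (Pi.single (Sum.inl l) 1) ∈ torusSpan s.frame := by
  -- Upper bound argument: an element that is Laurent at a vertex and at all its neighbours remains
  -- so after one step towards the root. Each neighbour of the next vertex is handled by the rank
  -- two criterion.
  have hupper : ∀ w : List (Fin n), ∀ x : K, x ∈ torusSpan (s.along d w).frame →
      (∀ k, x ∈ torusSpan (s.along d (k :: w)).frame) → x ∈ torusSpan s.frame := by
    intro w
    induction w with
    | nil => intro x hx _; exact hx
    | cons k w ih =>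
      intro x hx hxk
      have hxw : x ∈ torusSpan (s.along d w).frame := by
        rw [← QuantumSeed.along_cons_cons hd h w k]; exact hxk k
      refine ih x hxw fun j => ?_
      by_cases hj : j = k
      · subst hj; exact hx
      · have hkw := h.along hd (k :: w)
        have hkkw := h.along hd (k :: k :: w)
        have hjkw := h.along hd (j :: k :: w)
        have hjkkw := h.along hd (j :: k :: k :: w)
        -- Involutivity presents the neighbour of `w` in direction `j` as two steps away from the
        -- seed at `k :: w`, the configuration of the rank two criterion.
        have hjw : s.along d (j :: w) = s.along d (j :: k :: k :: w) := by
          change (s.along d w).mutate d j = (s.along d (k :: k :: w)).mutate d j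
          rw [QuantumSeed.along_cons_cons hd h w k]
        rw [hjw]
        exact mem_torusSpan_of_neighbours hd (Ne.symm hj) hkw (s.isMutation_along hd hkw k)
          (s.isMutation_along hd hkw j) hkkw hjkw.torus (s.isMutation_along hd hkkw j) hjkkw
          (hxk k) (hxk j)
  refine hupper w _ (frame_mem _ _) fun k => ?_
  by_cases hk : l = k
  · subst hk
    have hw := h.along hd w
    have hkw := h.along hd (l :: w)
    have m := (s.isMutation_along hd hw l).symm' hw.torus (hw.compatCol l (hd l).ne') hkw.torus
    rw [m.exchange]
    exact Submodule.add_mem _ (frame_mem _ _) (frame_mem _ _)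
  · rw [← (s.isMutation_along hd (h.along hd w) k).agree _ (by simp [Ne.symm hk])]
    exact frame_mem _ _

end Laurent

noncomputable section Tropical

/-! ### Exchange matrices, `c`-vectors and `g`-vectors along a word -/

variable {n r r' : ℕ}

/-- The exchange matrix of the seed reached along a word. -/
def matAlong (B : Matrix (Fin n ⊕ Fin r) (Fin n) ℤ) :
    List (Fin n) → Matrix (Fin n ⊕ Fin r) (Fin n) ℤ
  | [] => B
  | k :: w => matMut (matAlong B w) k

theorem ClassicalSeed.along_mat {L : Type*} [Field L] (s : ClassicalSeed n r L)
    (w : List (Fin n)) : (s.along w).mat = matAlong s.mat w := by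
  induction w with
  | nil => rfl
  | cons k w ih => exact congrArg (fun B => matMut B k) ih

theorem QuantumSeed.along_mat {K : Type*} [DivisionRing K] [Algebra ℤ[T;T⁻¹] K]
    (d : Fin n → ℤ) (s : QuantumSeed n r K) (w : List (Fin n)) :
    (s.along d w).mat = matAlong s.mat w := by
  induction w with
  | nil => rfl
  | cons k w ih => exact congrArg (fun B => matMut B k) ih

theorem matAlong_inl {B : Matrix (Fin n ⊕ Fin r) (Fin n) ℤ}
    {B' : Matrix (Fin n ⊕ Fin r') (Fin n) ℤ} (h : B.toRows₁ = B'.toRows₁) (w : List (Fin n))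
    (i j : Fin n) : matAlong B w (Sum.inl i) j = matAlong B' w (Sum.inl i) j := by
  induction w generalizing i j with
  | nil => exact congrFun (congrFun h i) j
  | cons k w ih => simp [matAlong, matMut, ih]

theorem matMut_skew {d : Fin n → ℤ} (hd : ∀ j, 0 < d j) {B : Matrix (Fin n ⊕ Fin r) (Fin n) ℤ}
    (h : ∀ i j, d i * B (Sum.inl i) j = -(d j * B (Sum.inl j) i)) (k i j : Fin n) :
    d i * matMut B k (Sum.inl i) j = -(d j * matMut B k (Sum.inl j) i) := by
  have hmax : ∀ j, d j * max 0 (-B (Sum.inl j) k) = max 0 (B (Sum.inl k) j) * d k := by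
    intro j
    have h1 := h k j
    rw [mul_max_of_nonneg _ _ (hd j).le, max_mul_of_nonneg _ _ (hd k).le]
    congr 1
    · simp
    · linarith
  simp only [matMut, Sum.inl.injEq]
  by_cases hi : i = k
  · simp only [hi, true_or, or_true, if_true]; linear_combination -h k j
  · by_cases hj : j = k
    · simp only [hj, true_or, or_true, if_true]; linear_combination -h i k
    · simp only [hi, hj, or_self, if_false, sign_mul_max]
      linear_combination h i j + B (Sum.inl k) j * hmax i + B (Sum.inl k) i * hmax j +
        max 0 (B (Sum.inl k) j) * h i k + max 0 (B (Sum.inl k) i) * h j k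

theorem matAlong_skew {d : Fin n → ℤ} (hd : ∀ j, 0 < d j) {B : Matrix (Fin n ⊕ Fin r) (Fin n) ℤ}
    (h : ∀ i j, d i * B (Sum.inl i) j = -(d j * B (Sum.inl j) i)) (w : List (Fin n)) (i j : Fin n) :
    d i * matAlong B w (Sum.inl i) j = -(d j * matAlong B w (Sum.inl j) i) := by
  induction w generalizing i j with
  | nil => exact h i j
  | cons k w ih => exact matMut_skew hd ih k i j

theorem matAlong_diag {d : Fin n → ℤ} (hd : ∀ j, 0 < d j) {B : Matrix (Fin n ⊕ Fin r) (Fin n) ℤ}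
    (h : ∀ i j, d i * B (Sum.inl i) j = -(d j * B (Sum.inl j) i)) (w : List (Fin n)) (j : Fin n) :
    matAlong B w (Sum.inl j) j = 0 := by
  have h1 := matAlong_skew hd h w j j
  have h2 : d j * matAlong B w (Sum.inl j) j = 0 := by omega
  exact (mul_eq_zero.1 h2).resolve_left (hd j).ne'

/-- The `c`-vectors along a word. -/
def cVec (B0 : Matrix (Fin n) (Fin n) ℤ) (w : List (Fin n)) (k : Fin n) : Fin n → ℤ :=
  fun i => matAlong (principalMatrix B0) w (Sum.inr i) k

/-- The sign of the `c`-vector (if it is sign-coherent). -/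
def tropSign (B0 : Matrix (Fin n) (Fin n) ℤ) (w : List (Fin n)) (k : Fin n) : ℤ :=
  if ∀ i, 0 ≤ cVec B0 w k i then 1 else -1

theorem tropSign_eq (B0 : Matrix (Fin n) (Fin n) ℤ) (w : List (Fin n)) (k : Fin n) :
    tropSign B0 w k = 1 ∨ tropSign B0 w k = -1 := by
  unfold tropSign; split_ifs <;> simp

/-- Sign-coherence of the `c`-vectors along reduced words. -/
def SignCoherent (B0 : Matrix (Fin n) (Fin n) ℤ) : Prop :=
  ∀ (w : List (Fin n)) (k : Fin n), (k :: w).IsChain (· ≠ ·) →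
    ∀ i, 0 ≤ tropSign B0 w k * cVec B0 w k i

/-- The column of the exchange matrix multiplied by the tropical sign. -/
def tropCol (B : Matrix (Fin n ⊕ Fin r) (Fin n) ℤ) (w : List (Fin n)) (k : Fin n) :
    Fin n ⊕ Fin r → ℤ :=
  tropSign B.toRows₁ w k • matCol (matAlong B w) k

/-- The linear map whose matrix consists of the extended `g`-vectors. -/
def gMap (B : Matrix (Fin n ⊕ Fin r) (Fin n) ℤ) :
    List (Fin n) → (Fin n ⊕ Fin r → ℤ) →ₗ[ℤ] (Fin n ⊕ Fin r → ℤ)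
  | [] => LinearMap.id
  | k :: w => (gMap B w) ∘ₗ mutLin (Sum.inl k) (tropCol B w k)

theorem gMap_inr (B : Matrix (Fin n ⊕ Fin r) (Fin n) ℤ) (w : List (Fin n))
    {c : Fin n ⊕ Fin r → ℤ} (hc : ∀ i, c (Sum.inl i) = 0) : gMap B w c = c := by
  induction w with
  | nil => rfl
  | cons k w ih => rw [gMap, LinearMap.comp_apply, mutLin_of_eq_zero _ _ (hc k), ih]

/-- The principal rows of `mutLin` see only the principal rows of the column, and the tropical sign
is computed from the principal part. Frozen rows never enter, which is why two algebras with the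
same principal part produce the same twists. -/
theorem gMap_inl {B : Matrix (Fin n ⊕ Fin r) (Fin n) ℤ}
    {B' : Matrix (Fin n ⊕ Fin r') (Fin n) ℤ} (h : B.toRows₁ = B'.toRows₁) (w : List (Fin n))
    {c : Fin n ⊕ Fin r → ℤ} {c' : Fin n ⊕ Fin r' → ℤ}
    (hc : ∀ i, c (Sum.inl i) = c' (Sum.inl i)) (i : Fin n) :
    gMap B w c (Sum.inl i) = gMap B' w c' (Sum.inl i) := by
  induction w generalizing c c' i with
  | nil => exact hc i
  | cons k w ih =>
    refine ih (fun i => ?_) i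
    by_cases hi : i = k
    · subst hi; simp [mutLin_apply_self, hc]
    · rw [mutLin_apply_of_ne _ _ _ (by simpa using hi), mutLin_apply_of_ne _ _ _ (by simpa using hi)]
      simp [tropCol, matCol, hc, h, matAlong_inl h]

/-- The fundamental relation between the `g`-vectors, the exchange matrix and the `c`-vectors. -/
theorem gMap_matCol {d : Fin n → ℤ} (hd : ∀ j, 0 < d j) {B : Matrix (Fin n ⊕ Fin r) (Fin n) ℤ}
    (h : ∀ i j, d i * B (Sum.inl i) j = -(d j * B (Sum.inl j) i))
    (hsc : SignCoherent B.toRows₁) {w : List (Fin n)} (hw : w.IsChain (· ≠ ·)) (j : Fin n) :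
    gMap B w (matCol (matAlong B w) j) = B.mulVec (cVec B.toRows₁ w j) := by
  induction w generalizing j with
  | nil =>
    have : cVec B.toRows₁ [] j = Pi.single j 1 := by
      ext i
      simp [cVec, matAlong, principalMatrix, Matrix.one_apply, Pi.single_apply]
    rw [this, Matrix.mulVec_single_one]
    rfl
  | cons k w ih =>
    have hw' : w.IsChain (· ≠ ·) := by cases w <;> simp_all [List.isChain_cons_cons]
    have hk : matAlong B w (Sum.inl k) k = 0 := matAlong_diag hd h w k
    have ihk := ih hw' k
    have hB : matAlong B (k :: w) = matMut (matAlong B w) k := rfl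
    have hP : matAlong (principalMatrix B.toRows₁) (k :: w) =
      matMut (matAlong (principalMatrix B.toRows₁) w) k := rfl
    rw [gMap, LinearMap.comp_apply, tropCol]
    by_cases hj : j = k
    · subst hj
      have hc : cVec B.toRows₁ (j :: w) j = -cVec B.toRows₁ w j := by
        ext i; simp [cVec, hP, matMut]
      have hz : (-matCol (matAlong B w) j) (Sum.inl j) = 0 := by simp [matCol, hk]
      rw [hB, matCol_matMut_self, mutLin_of_eq_zero _ _ hz, map_neg, ihk, hc, Matrix.mulVec_neg]
    · have hsck := hsc w k hw
      have htop : matAlong (principalMatrix B.toRows₁) w (Sum.inl k) j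
          = matAlong B w (Sum.inl k) j := matAlong_inl (by ext; rfl) w k j
      -- Sign-coherence removes one of the two terms of the mutation rule and leaves the coefficient
      -- `[ε b_kj]₊`. The next claim finds the same coefficient for the columns transformed by the
      -- signed linear map.
      have hc : cVec B.toRows₁ (k :: w) j = cVec B.toRows₁ w j +
          max 0 (tropSign B.toRows₁ w k * matAlong B w (Sum.inl k) j) • cVec B.toRows₁ w k := by
        ext i
        have h1 := hsck i
        simp only [cVec, Pi.add_apply, Pi.smul_apply, hP, smul_eq_mul] at h1 ⊢
        rw [matMut, if_neg (by simp [hj]), sign_mul_max, htop]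
        rcases tropSign_eq B.toRows₁ w k with hs | hs <;> rw [hs] at h1 ⊢
        · rw [max_eq_left (by omega : -matAlong (principalMatrix B.toRows₁) w (Sum.inr i) k ≤ 0)]
          simp
        · rw [max_eq_right (by omega : 0 ≤ -matAlong (principalMatrix B.toRows₁) w (Sum.inr i) k)]
          have : max 0 (-1 * matAlong B w (Sum.inl k) j) =
            max 0 (matAlong B w (Sum.inl k) j) - matAlong B w (Sum.inl k) j := by omega
          rw [this]; ring
      have hE : mutLin (Sum.inl k) (tropSign B.toRows₁ w k • matCol (matAlong B w) k)
          (matCol (matAlong B (k :: w)) j) = matCol (matAlong B w) j +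
          max 0 (tropSign B.toRows₁ w k * matAlong B w (Sum.inl k) j) • matCol (matAlong B w) k := by
        rcases tropSign_eq B.toRows₁ w k with hs | hs <;> rw [hs]
        · rw [one_smul, one_mul, hB, mutLin_matCol_matMut hk hj]
        · rw [neg_one_smul, mutLin_neg_apply (Sum.inl k) (matCol (matAlong B w) k) hk, hB,
            mutLin_matCol_matMut hk hj, add_assoc, ← add_smul]
          congr 2
          simp [matCol, matMut]
          omega
      rw [hE, map_add, map_smul, ih hw' j, ihk, hc, Matrix.mulVec_add, Matrix.mulVec_smul]

end Tropical

noncomputable section ClassicalCluster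

/-! ### Classical cluster variables -/

variable {n r : ℕ}

/-- The cluster variables of the seed reached along a word. -/
def varAlong (B : Matrix (Fin n ⊕ Fin r) (Fin n) ℤ) (w : List (Fin n)) :
    Fin n ⊕ Fin r → AmbientField n r :=
  ((ClassicalSeed.mk initVar B).along w).var

theorem varAlong_cons (B : Matrix (Fin n ⊕ Fin r) (Fin n) ℤ) (k : Fin n) (w : List (Fin n)) :
    varAlong B (k :: w) = Function.update (varAlong B w) (Sum.inl k)
      ((varAlong B w (Sum.inl k))⁻¹ * (∏ i, varAlong B w i ^ (matAlong B w i k).toNat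
        + ∏ i, varAlong B w i ^ (-(matAlong B w i k)).toNat)) := by
  have h : ((ClassicalSeed.mk (initVar : Fin n ⊕ Fin r → AmbientField n r) B).along w).mat
    = matAlong B w := ClassicalSeed.along_mat _ w
  rw [← h]
  rfl

theorem varAlong_inr (B : Matrix (Fin n ⊕ Fin r) (Fin n) ℤ) (w : List (Fin n)) (i : Fin r) :
    varAlong B w (Sum.inr i) = initVar (Sum.inr i) := by
  induction w with
  | nil => rfl
  | cons k w ih => rw [varAlong_cons, Function.update_of_ne (by simp), ih]

theorem varAlong_cons_self (B : Matrix (Fin n ⊕ Fin r) (Fin n) ℤ) (k : Fin n) (w : List (Fin n)) :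
    varAlong B (k :: w) (Sum.inl k) =
      (varAlong B w (Sum.inl k))⁻¹ * (∏ i, varAlong B w i ^ (matAlong B w i k).toNat
        + ∏ i, varAlong B w i ^ (-(matAlong B w i k)).toNat) := by
  rw [varAlong_cons, Function.update_self]

theorem varAlong_cons_of_ne (B : Matrix (Fin n ⊕ Fin r) (Fin n) ℤ) {k : Fin n} (w : List (Fin n))
    {i : Fin n ⊕ Fin r} (hi : i ≠ Sum.inl k) : varAlong B (k :: w) i = varAlong B w i := by
  rw [varAlong_cons, Function.update_of_ne hi]

/-! ### Nonvanishing of cluster variables -/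

section positivity

/-- `x` is a quotient of polynomials with positive values at `(1, …, 1)`. -/
def IsPositiveFraction (x : AmbientField n r) : Prop :=
  ∃ a b : MvPolynomial (Fin n ⊕ Fin r) ℤ, x * algebraMap _ (AmbientField n r) b =
    algebraMap _ (AmbientField n r) a ∧
    0 < MvPolynomial.eval (fun _ => (1 : ℤ)) a ∧ 0 < MvPolynomial.eval (fun _ => (1 : ℤ)) b

theorem ambient_algebraMap_ne_zero {b : MvPolynomial (Fin n ⊕ Fin r) ℤ} (hb : b ≠ 0) :
    algebraMap _ (AmbientField n r) b ≠ 0 := by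
  rwa [Ne, map_eq_zero_iff _ (IsFractionRing.injective _ _)]

theorem IsPositiveFraction.ne_zero {x : AmbientField n r} (hx : IsPositiveFraction x) : x ≠ 0 := by
  rintro rfl
  obtain ⟨a, b, h, ha, -⟩ := hx
  rw [zero_mul, eq_comm, map_eq_zero_iff _ (IsFractionRing.injective _ _)] at h
  rw [h, map_zero] at ha
  exact lt_irrefl _ ha

theorem IsPositiveFraction.mul {x y : AmbientField n r} (hx : IsPositiveFraction x)
    (hy : IsPositiveFraction y) : IsPositiveFraction (x * y) := by
  obtain ⟨a, b, h, ha, hb⟩ := hx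
  obtain ⟨a', b', h', ha', hb'⟩ := hy
  refine ⟨a * a', b * b', ?_, by rw [map_mul]; positivity, by rw [map_mul]; positivity⟩
  rw [map_mul, map_mul, ← h, ← h']; ring

theorem IsPositiveFraction.add {x y : AmbientField n r} (hx : IsPositiveFraction x)
    (hy : IsPositiveFraction y) : IsPositiveFraction (x + y) := by
  obtain ⟨a, b, h, ha, hb⟩ := hx
  obtain ⟨a', b', h', ha', hb'⟩ := hy
  refine ⟨a * b' + a' * b, b * b', ?_, by rw [map_add, map_mul, map_mul]; positivity,
    by rw [map_mul]; positivity⟩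
  rw [map_mul, map_add, map_mul, map_mul, ← h, ← h']; ring

theorem IsPositiveFraction.inv {x : AmbientField n r} (hx : IsPositiveFraction x) :
    IsPositiveFraction x⁻¹ := by
  have h0 := hx.ne_zero
  obtain ⟨a, b, h, ha, hb⟩ := hx
  exact ⟨b, a, by rw [← h, inv_mul_cancel_left₀ h0], hb, ha⟩

theorem IsPositiveFraction.one : IsPositiveFraction (1 : AmbientField n r) :=
  ⟨1, 1, by simp, by simp, by simp⟩

theorem IsPositiveFraction.pow {x : AmbientField n r} (hx : IsPositiveFraction x) (m : ℕ) :
    IsPositiveFraction (x ^ m) := by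
  induction m with
  | zero => simpa using IsPositiveFraction.one
  | succ m ih => rw [pow_succ]; exact ih.mul hx

theorem IsPositiveFraction.prod {x : Fin n ⊕ Fin r → AmbientField n r}
    (hx : ∀ i, IsPositiveFraction (x i)) : IsPositiveFraction (∏ i, x i) :=
  Finset.prod_induction _ IsPositiveFraction (fun _ _ => IsPositiveFraction.mul)
    IsPositiveFraction.one fun i _ => hx i

/-- The exchange relations involve no subtraction, so positivity at `(1, …, 1)` is inherited. This
shows that cluster variables are nonzero and may be divided by. -/
theorem isPositiveFraction_varAlong (B : Matrix (Fin n ⊕ Fin r) (Fin n) ℤ) (w : List (Fin n))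
    (i : Fin n ⊕ Fin r) : IsPositiveFraction (varAlong B w i) := by
  induction w generalizing i with
  | nil => exact ⟨MvPolynomial.X i, 1, by simp [varAlong, ClassicalSeed.along, initVar], by simp,
      by simp⟩
  | cons k w ih =>
    by_cases hi : i = Sum.inl k
    · subst hi
      rw [varAlong_cons_self]
      exact (ih _).inv.mul ((IsPositiveFraction.prod fun i => (ih i).pow _).add
        (IsPositiveFraction.prod fun i => (ih i).pow _))
    · rw [varAlong_cons_of_ne B w hi]; exact ih i

theorem varAlong_ne_zero (B : Matrix (Fin n ⊕ Fin r) (Fin n) ℤ) (w : List (Fin n))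
    (i : Fin n ⊕ Fin r) : varAlong B w i ≠ 0 :=
  (isPositiveFraction_varAlong B w i).ne_zero

/-- The exchange relations. -/
theorem varAlong_exchange (B : Matrix (Fin n ⊕ Fin r) (Fin n) ℤ) (k : Fin n) (w : List (Fin n)) :
    varAlong B (k :: w) (Sum.inl k) * varAlong B w (Sum.inl k) =
      ∏ i, varAlong B w i ^ (matAlong B w i k).toNat
        + ∏ i, varAlong B w i ^ (-(matAlong B w i k)).toNat := by
  rw [varAlong_cons_self, mul_comm, mul_inv_cancel_left₀ (varAlong_ne_zero B w _)]

end positivity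

/-! ### The recursion for `F`-polynomials and sign-coherence -/

section fPolynomial

/-- `p` is the image of `x` under the substitution `x_i ↦ 1`, `y_i ↦ u_i`. -/
def SpecializesTo (x : AmbientField n n) (p : MvPolynomial (Fin n) ℤ) : Prop :=
  ∃ a b : MvPolynomial (Fin n ⊕ Fin n) ℤ, x * algebraMap _ (AmbientField n n) b =
    algebraMap _ (AmbientField n n) a ∧ specialize n b ≠ 0 ∧ specialize n a = p * specialize n b

theorem SpecializesTo.mul {x y : AmbientField n n} {p q : MvPolynomial (Fin n) ℤ}
    (hx : SpecializesTo x p) (hy : SpecializesTo y q) : SpecializesTo (x * y) (p * q) := by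
  obtain ⟨a, b, h, hb, ha⟩ := hx
  obtain ⟨a', b', h', hb', ha'⟩ := hy
  refine ⟨a * a', b * b', ?_, by rw [map_mul]; exact mul_ne_zero hb hb', ?_⟩
  · rw [map_mul, map_mul, ← h, ← h']; ring
  · rw [map_mul, map_mul, ha, ha']; ring

theorem SpecializesTo.add {x y : AmbientField n n} {p q : MvPolynomial (Fin n) ℤ}
    (hx : SpecializesTo x p) (hy : SpecializesTo y q) : SpecializesTo (x + y) (p + q) := by
  obtain ⟨a, b, h, hb, ha⟩ := hx
  obtain ⟨a', b', h', hb', ha'⟩ := hy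
  refine ⟨a * b' + a' * b, b * b', ?_, by rw [map_mul]; exact mul_ne_zero hb hb', ?_⟩
  · rw [map_mul, map_add, map_mul, map_mul, ← h, ← h']; ring
  · rw [map_mul, map_add, map_mul, map_mul, ha, ha']; ring

theorem SpecializesTo.one : SpecializesTo (1 : AmbientField n n) 1 :=
  ⟨1, 1, by simp, by simp, by simp⟩

theorem SpecializesTo.pow {x : AmbientField n n} {p : MvPolynomial (Fin n) ℤ}
    (hx : SpecializesTo x p) (m : ℕ) : SpecializesTo (x ^ m) (p ^ m) := by
  induction m with
  | zero => simpa using SpecializesTo.one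
  | succ m ih => rw [pow_succ, pow_succ]; exact ih.mul hx

theorem SpecializesTo.prod {ι : Type*} (s : Finset ι) {x : ι → AmbientField n n}
    {p : ι → MvPolynomial (Fin n) ℤ} (hx : ∀ i, SpecializesTo (x i) (p i)) :
    SpecializesTo (∏ i ∈ s, x i) (∏ i ∈ s, p i) := by
  classical
  induction s using Finset.induction_on with
  | empty => simpa using SpecializesTo.one
  | insert i s hi ih => rw [Finset.prod_insert hi, Finset.prod_insert hi]; exact (hx i).mul ih

theorem SpecializesTo.unique {x : AmbientField n n} {p q : MvPolynomial (Fin n) ℤ}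
    (hp : SpecializesTo x p) (hq : SpecializesTo x q) : p = q := by
  obtain ⟨a, b, h, hb, ha⟩ := hp
  obtain ⟨a', b', h', hb', ha'⟩ := hq
  have h1 : a * b' = a' * b := by
    apply IsFractionRing.injective (MvPolynomial (Fin n ⊕ Fin n) ℤ) (AmbientField n n)
    rw [map_mul, map_mul, ← h, ← h']; ring
  have h2 := congrArg (specialize n) h1
  rw [map_mul, map_mul, ha, ha'] at h2
  have h3 : (p - q) * (specialize n b * specialize n b') = 0 := by linear_combination h2
  rcases mul_eq_zero.1 h3 with h4 | h4
  · exact sub_eq_zero.1 h4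
  · exact absurd h4 (mul_ne_zero hb hb')

theorem specializesTo_initVar_inr (i : Fin n) :
    SpecializesTo (initVar (Sum.inr i)) (MvPolynomial.X i) :=
  ⟨MvPolynomial.X (Sum.inr i), 1, by simp [initVar], by simp, by simp [specialize]⟩

variable {B0 : Matrix (Fin n) (Fin n) ℤ}
  (hF : ∀ (j : Fin n) (t : TreeVertex n), MvPolynomial.constantCoeff (fPolynomial B0 j t) ≠ 0)
include hF

/-- If the specialization were not a polynomial, the default value `0` would be taken, contradicting
the nonzero constant term. So the hypothesis itself supplies the existence. -/
theorem specializesTo_fPolynomial (j : Fin n) (t : TreeVertex n) :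
    SpecializesTo (varAlong (principalMatrix B0) t.1 (Sum.inl j)) (fPolynomial B0 j t) := by
  have h := hF j t
  unfold fPolynomial at h ⊢
  split_ifs at h ⊢ with h1
  · exact h1.choose_spec
  · simp at h

/-- The recursion satisfied by the `F`-polynomials. -/
theorem fPolynomial_exchange {k : Fin n} {w : List (Fin n)} (hkw : (k :: w).IsChain (· ≠ ·))
    (hw : w.IsChain (· ≠ ·)) :
    fPolynomial B0 k ⟨k :: w, hkw⟩ * fPolynomial B0 k ⟨w, hw⟩ =
      (∏ i, fPolynomial B0 i ⟨w, hw⟩ ^ (matAlong (principalMatrix B0) w (Sum.inl i) k).toNat) *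
        ∏ i, MvPolynomial.X i ^ (cVec B0 w k i).toNat
      + (∏ i, fPolynomial B0 i ⟨w, hw⟩ ^
          (-(matAlong (principalMatrix B0) w (Sum.inl i) k)).toNat) *
        ∏ i, MvPolynomial.X i ^ (-cVec B0 w k i).toNat := by
  have h1 := (specializesTo_fPolynomial hF k ⟨k :: w, hkw⟩).mul
    (specializesTo_fPolynomial hF k ⟨w, hw⟩)
  rw [varAlong_exchange, Fintype.prod_sum_type, Fintype.prod_sum_type] at h1
  refine h1.unique (((SpecializesTo.prod _ fun i => ?_).mul (SpecializesTo.prod _ fun i => ?_)).add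
    ((SpecializesTo.prod _ fun i => ?_).mul (SpecializesTo.prod _ fun i => ?_)))
  · exact (specializesTo_fPolynomial hF i ⟨w, hw⟩).pow _
  · rw [varAlong_inr]; exact (specializesTo_initVar_inr i).pow _
  · exact (specializesTo_fPolynomial hF i ⟨w, hw⟩).pow _
  · rw [varAlong_inr]; exact (specializesTo_initVar_inr i).pow _

/-- Nonzero constant terms imply sign-coherence. -/
theorem signCoherent_of_constantCoeff : SignCoherent B0 := by
  intro w k hkw i
  have hw : w.IsChain (· ≠ ·) := by cases w <;> simp_all [List.isChain_cons_cons]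
  unfold tropSign
  split_ifs with h
  · simpa using h i
  · push Not at h
    obtain ⟨l, hl⟩ := h
    by_contra! hi
    -- The `c`-vector is now negative at `l` and positive at `i`, so each of the two terms of the
    -- recursion contains a variable and has constant term zero.
    have h1 := congrArg MvPolynomial.constantCoeff (fPolynomial_exchange hF hkw hw)
    have hz : ∀ (e : Fin n → ℕ) (l : Fin n), e l ≠ 0 →
        MvPolynomial.constantCoeff (∏ i, (MvPolynomial.X i : MvPolynomial (Fin n) ℤ) ^ e i) = 0 := by
      intro e l hl
      rw [map_prod]
      exact Finset.prod_eq_zero (Finset.mem_univ l) (by simp [hl])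
    rw [map_add, map_mul, map_mul, map_mul, hz (fun i => (cVec B0 w k i).toNat) i (by omega),
      hz (fun i => (-cVec B0 w k i).toNat) l (by omega), mul_zero, mul_zero, add_zero] at h1
    exact mul_ne_zero (hF k _) (hF k _) h1

/-- The recursion satisfied by the `F`-polynomials, in terms of the tropical sign. -/
theorem fPolynomial_exchange_tropSign {k : Fin n} {w : List (Fin n)}
    (hkw : (k :: w).IsChain (· ≠ ·)) (hw : w.IsChain (· ≠ ·)) :
    fPolynomial B0 k ⟨k :: w, hkw⟩ * fPolynomial B0 k ⟨w, hw⟩ =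
      (∏ i, fPolynomial B0 i ⟨w, hw⟩ ^ (-(tropSign B0 w k *
          matAlong (principalMatrix B0) w (Sum.inl i) k)).toNat)
      + (∏ i, fPolynomial B0 i ⟨w, hw⟩ ^ (tropSign B0 w k *
          matAlong (principalMatrix B0) w (Sum.inl i) k).toNat) *
        ∏ i, MvPolynomial.X i ^ (tropSign B0 w k * cVec B0 w k i).toNat := by
  rw [fPolynomial_exchange hF hkw hw]
  have hsc := signCoherent_of_constantCoeff hF w k hkw
  rcases tropSign_eq B0 w k with hs | hs <;> rw [hs] at hsc ⊢
  · have h0 : ∀ i, (-cVec B0 w k i).toNat = 0 := fun i => by have := hsc i; omega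
    simp only [one_mul, h0, pow_zero, Finset.prod_const_one, mul_one]
    rw [add_comm]
  · have h0 : ∀ i, (cVec B0 w k i).toNat = 0 := fun i => by have := hsc i; omega
    simp only [neg_one_mul, neg_neg, h0, pow_zero, Finset.prod_const_one, mul_one]

end fPolynomial

end ClassicalCluster

/-! ### Classical separation formula and `g`-vectors -/

noncomputable section GVectors

variable {n r : ℕ}

/-- Laurent monomials in the initial extended cluster. -/
def laurentMonomial (g : Fin n ⊕ Fin r → ℤ) : AmbientField n r := ∏ i, initVar i ^ g i

theorem initVar_ne_zero (i : Fin n ⊕ Fin r) : (initVar i : AmbientField n r) ≠ 0 :=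
  ambient_algebraMap_ne_zero (MvPolynomial.X_ne_zero i)

theorem laurentMonomial_add (g h : Fin n ⊕ Fin r → ℤ) :
    laurentMonomial (g + h) = laurentMonomial g * laurentMonomial h := by
  rw [laurentMonomial, laurentMonomial, laurentMonomial, ← Finset.prod_mul_distrib]
  exact Finset.prod_congr rfl fun i _ => zpow_add₀ (initVar_ne_zero i) _ _

theorem laurentMonomial_zero : laurentMonomial (0 : Fin n ⊕ Fin r → ℤ) = 1 := by
  simp [laurentMonomial]

theorem laurentMonomial_ne_zero (g : Fin n ⊕ Fin r → ℤ) : laurentMonomial g ≠ 0 :=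
  Finset.prod_ne_zero_iff.2 fun i _ => zpow_ne_zero _ (initVar_ne_zero i)

theorem laurentMonomial_nsmul (m : ℕ) (g : Fin n ⊕ Fin r → ℤ) :
    laurentMonomial (m • g) = laurentMonomial g ^ m := by
  induction m with
  | zero => simp [laurentMonomial_zero]
  | succ m ih => rw [succ_nsmul, laurentMonomial_add, ih, pow_succ]

theorem laurentMonomial_sum {ι : Type*} (s : Finset ι) (g : ι → Fin n ⊕ Fin r → ℤ) :
    laurentMonomial (∑ i ∈ s, g i) = ∏ i ∈ s, laurentMonomial (g i) := by
  classical
  induction s using Finset.induction_on with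
  | empty => simp [laurentMonomial_zero]
  | insert i s hi ih => rw [Finset.sum_insert hi, Finset.prod_insert hi, laurentMonomial_add, ih]

theorem laurentMonomial_single (i : Fin n ⊕ Fin r) :
    laurentMonomial (Pi.single i 1) = initVar i := by
  rw [laurentMonomial, Finset.prod_eq_single i]
  · simp
  · intro j _ hj; simp [hj]
  · simp

/-- Multiplying by the positive parts of the exponent differences reduces the claim to monomials of
a polynomial ring. It yields the uniqueness of extended `g`-vectors. -/
theorem laurentMonomial_injective :
    Function.Injective (laurentMonomial : (Fin n ⊕ Fin r → ℤ) → AmbientField n r) := by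
  intro g h hgh
  have key : ∀ m : Fin n ⊕ Fin r →₀ ℕ, laurentMonomial (fun i => (m i : ℤ)) =
      algebraMap (MvPolynomial (Fin n ⊕ Fin r) ℤ) (AmbientField n r) (MvPolynomial.monomial m 1) := by
    intro m
    rw [MvPolynomial.monomial_eq, Finsupp.prod_fintype _ _ (by simp)]
    simp [laurentMonomial, initVar]
  set p : Fin n ⊕ Fin r →₀ ℕ := Finsupp.equivFunOnFinite.symm fun i => (g i - h i).toNat with hp
  set q : Fin n ⊕ Fin r →₀ ℕ := Finsupp.equivFunOnFinite.symm fun i => (h i - g i).toNat with hq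
  have h1 : g + (fun i => (q i : ℤ)) = h + fun i => (p i : ℤ) := by
    ext i; simp [hp, hq]; omega
  have h2 := congrArg laurentMonomial h1
  rw [laurentMonomial_add, laurentMonomial_add, hgh] at h2
  have h3 := mul_left_cancel₀ (laurentMonomial_ne_zero h) h2
  rw [key, key] at h3
  have h4 := MvPolynomial.monomial_left_injective one_ne_zero
    (IsFractionRing.injective _ (AmbientField n r) h3)
  ext i
  have h5 := congrArg (fun m => m i) h4
  simp [hp, hq] at h5
  omega

/-- Products of Laurent monomials with exponents given by the columns of a linear map. -/
theorem prod_laurentMonomial_pow (G : (Fin n ⊕ Fin r → ℤ) →ₗ[ℤ] (Fin n ⊕ Fin r → ℤ))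
    (m : Fin n ⊕ Fin r → ℕ) :
    ∏ i, laurentMonomial (G (Pi.single i 1)) ^ m i = laurentMonomial (G fun i => (m i : ℤ)) := by
  have h : (fun i => (m i : ℤ)) = ∑ i, m i • (Pi.single i 1 : Fin n ⊕ Fin r → ℤ) := by
    ext j; simp [Finset.sum_apply, Pi.single_apply]
  rw [h, map_sum, laurentMonomial_sum]
  exact Finset.prod_congr rfl fun i _ => by rw [map_nsmul, laurentMonomial_nsmul]

/-- The elements `ŷ_l`. -/
def classicalYHat (B : Matrix (Fin n ⊕ Fin r) (Fin n) ℤ) (l : Fin n) : AmbientField n r :=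
  ∏ i, initVar i ^ B i l

theorem prod_classicalYHat_pow (B : Matrix (Fin n ⊕ Fin r) (Fin n) ℤ) (m : Fin n → ℕ) :
    ∏ l, classicalYHat B l ^ m l = laurentMonomial (B.mulVec fun l => (m l : ℤ)) := by
  have h : (B.mulVec fun l => (m l : ℤ)) = ∑ l, m l • (fun i => B i l) := by
    ext j; simp [Matrix.mulVec, dotProduct, Finset.sum_apply, mul_comm]
  rw [h, laurentMonomial_sum]
  exact Finset.prod_congr rfl fun i _ => by rw [laurentMonomial_nsmul]; rfl

theorem fPolynomial_nil {B0 : Matrix (Fin n) (Fin n) ℤ}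
    (hF : ∀ (j : Fin n) (t : TreeVertex n), MvPolynomial.constantCoeff (fPolynomial B0 j t) ≠ 0)
    (j : Fin n) (h : ([] : List (Fin n)).IsChain (· ≠ ·)) : fPolynomial B0 j ⟨[], h⟩ = 1 :=
  (specializesTo_fPolynomial hF j ⟨[], h⟩).unique ⟨MvPolynomial.X (Sum.inl j), 1,
    by simp [varAlong, ClassicalSeed.along, initVar], by simp, by simp [specialize]⟩

/-- The separation formula for the classical cluster variables. -/
theorem varAlong_eq {d : Fin n → ℤ} (hd : ∀ j, 0 < d j) {B : Matrix (Fin n ⊕ Fin r) (Fin n) ℤ}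
    (h : ∀ i j, d i * B (Sum.inl i) j = -(d j * B (Sum.inl j) i))
    (hF : ∀ (j : Fin n) (t : TreeVertex n),
      MvPolynomial.constantCoeff (fPolynomial B.toRows₁ j t) ≠ 0)
    {w : List (Fin n)} (hw : w.IsChain (· ≠ ·)) (j : Fin n) :
    varAlong B w (Sum.inl j) =
      MvPolynomial.aeval (classicalYHat B) (fPolynomial B.toRows₁ j ⟨w, hw⟩) *
        laurentMonomial (gMap B w (Pi.single (Sum.inl j) 1)) := by
  have hsc := signCoherent_of_constantCoeff hF
  induction w generalizing j with
  | nil =>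
    rw [fPolynomial_nil hF, map_one, one_mul]
    exact (laurentMonomial_single _).symm
  | cons k w ih =>
    have hw' : w.IsChain (· ≠ ·) := by cases w <;> simp_all [List.isChain_cons_cons]
    have ih := ih hw'
    by_cases hj : j = k
    swap
    · rw [varAlong_cons_of_ne B w (by simpa using hj), ih, gMap, LinearMap.comp_apply,
        mutLin_of_eq_zero _ _ (by simp [Ne.symm hj])]
      congr 2
      refine (specializesTo_fPolynomial hF j ⟨w, hw'⟩).unique ?_
      have := specializesTo_fPolynomial hF j ⟨k :: w, hw⟩
      rwa [varAlong_cons_of_ne _ w (by simpa using hj)] at this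
    subst hj
    set φ := MvPolynomial.aeval (R := ℤ) (classicalYHat B) with hφ
    set p : Fin n → MvPolynomial (Fin n) ℤ := fun i => fPolynomial B.toRows₁ i ⟨w, hw'⟩ with hp
    have hprod : ∀ m : Fin n ⊕ Fin r → ℕ, ∏ i, varAlong B w i ^ m i =
        φ (∏ i, p i ^ m (Sum.inl i)) * laurentMonomial (gMap B w fun i => (m i : ℤ)) := by
      intro m
      rw [← prod_laurentMonomial_pow, Fintype.prod_sum_type, Fintype.prod_sum_type, map_prod,
        ← mul_assoc, ← Finset.prod_mul_distrib]
      congr 1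
      · refine Finset.prod_congr rfl fun i _ => ?_
        rw [ih, mul_pow, map_pow]
      · refine Finset.prod_congr rfl fun i _ => ?_
        rw [varAlong_inr, gMap_inr _ _ (by simp), laurentMonomial_single]
    set ε := tropSign B.toRows₁ w j with hε
    have hx0 := varAlong_ne_zero B w (Sum.inl j)
    apply mul_right_cancel₀ hx0
    have hswap : ∏ i, varAlong B w i ^ (matAlong B w i j).toNat
        + ∏ i, varAlong B w i ^ (-(matAlong B w i j)).toNat =
        ∏ i, varAlong B w i ^ (-(ε * matAlong B w i j)).toNat +
        ∏ i, varAlong B w i ^ (ε * matAlong B w i j).toNat := by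
      rcases tropSign_eq B.toRows₁ w j with hs | hs <;> rw [← hε] at hs <;> rw [hs]
      · simp only [one_mul]; rw [add_comm]
      · simp only [neg_one_mul, neg_neg]
    rw [varAlong_exchange, hswap, hprod, hprod]
    have hrec := congrArg φ (fPolynomial_exchange_tropSign hF hw hw')
    rw [map_mul, map_add, map_mul, map_prod φ (fun i => MvPolynomial.X i ^ _)] at hrec
    have hX : ∀ i, φ (MvPolynomial.X i) = classicalYHat B i := fun i => MvPolynomial.aeval_X _ i
    simp only [map_pow φ (MvPolynomial.X _), hX] at hrec
    rw [prod_classicalYHat_pow] at hrec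
    have hmat : ∀ i, matAlong (principalMatrix B.toRows₁) w (Sum.inl i) j =
        matAlong B w (Sum.inl i) j := fun i => matAlong_inl (by ext; rfl) w i j
    simp only [hmat] at hrec
    have hc : (fun l => ((ε * cVec B.toRows₁ w j l).toNat : ℤ)) = ε • cVec B.toRows₁ w j := by
      ext l
      rw [Int.toNat_of_nonneg (hsc w j hw l)]; rfl
    -- The monomial in the `ŷ_l` with exponent `ε c` is the Laurent monomial at `gMap` of the signed
    -- column. This is exactly the ratio of the monomials in the two terms of the exchange relation.
    rw [hc, Matrix.mulVec_smul, ← gMap_matCol hd h hsc hw'] at hrec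
    have hdiag : matAlong B w (Sum.inl j) j = 0 := matAlong_diag hd h w j
    have e1 : (fun i => ((ε * matAlong B w i j).toNat : ℤ)) =
        (fun i => ((-(ε * matAlong B w i j)).toNat : ℤ)) + ε • matCol (matAlong B w) j := by
      ext i; simp only [Pi.add_apply, Pi.smul_apply, matCol, smul_eq_mul]; omega
    have e2 : (fun i => ((-(ε * matAlong B w i j)).toNat : ℤ)) =
        exVec (Sum.inl j) (tropCol B w j) + Pi.single (Sum.inl j) 1 := by
      ext i
      by_cases hi : i = Sum.inl j
      · subst hi; simp [exVec_self, hdiag]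
      · simp [exVec_of_ne _ _ hi, hi, tropCol, matCol, max_comm, hε]
    rw [e1, e2, map_add (gMap B w) (_ + _), laurentMonomial_add, map_smul, ih, gMap,
      LinearMap.comp_apply, mutLin_single, map_add, laurentMonomial_add]
    linear_combination -(laurentMonomial ((gMap B w) (exVec (Sum.inl j) (tropCol B w j))) *
      laurentMonomial ((gMap B w) (Pi.single (Sum.inl j) 1))) * hrec

/-- The separation formula makes the column of `gMap` a valid choice. Any other choice agrees with
it after cancelling the value of the `F`-polynomial, which is nonzero because the cluster variable
is. -/
theorem extGVector_eq {d : Fin n → ℤ} (hd : ∀ j, 0 < d j) {B : Matrix (Fin n ⊕ Fin r) (Fin n) ℤ}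
    (h : ∀ i j, d i * B (Sum.inl i) j = -(d j * B (Sum.inl j) i))
    (hF : ∀ (j : Fin n) (t : TreeVertex n),
      MvPolynomial.constantCoeff (fPolynomial B.toRows₁ j t) ≠ 0)
    (t : TreeVertex n) (l : Fin n ⊕ Fin r) :
    extGVector B l t = gMap B t.1 (Pi.single l 1) := by
  cases l with
  | inr i => rw [gMap_inr _ _ (by simp)]; rfl
  | inl j =>
    have h1 : IsExtGVector B j t (gMap B t.1 (Pi.single (Sum.inl j) 1)) :=
      varAlong_eq hd h hF t.2 j
    have h2 : ∃ g, IsExtGVector B j t g := ⟨_, h1⟩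
    have h3 : extGVector B (Sum.inl j) t = h2.choose := dif_pos h2
    have h4 : clusterVar B j t ≠ 0 := varAlong_ne_zero B t.1 (Sum.inl j)
    rw [h3]
    apply laurentMonomial_injective
    have h5 := h2.choose_spec
    generalize h2.choose = g at h5 ⊢
    unfold IsExtGVector at h1 h5
    rw [h1] at h5 h4
    exact (mul_left_cancel₀ (left_ne_zero_of_mul h4) h5).symm

section grading

variable (B0 : Matrix (Fin n) (Fin n) ℤ)

/-- The `ℤⁿ`-grading of the cluster algebra with principal coefficients. -/
abbrev principalGrading : Fin n ⊕ Fin n → Fin n → ℤ :=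
  Sum.elim (fun i => Pi.single i 1) (fun l i => - B0 i l)

/-- `x` is a quotient of homogeneous polynomials, of degree `g`. -/
def HasDegree (x : AmbientField n n) (g : Fin n → ℤ) : Prop :=
  ∃ (a b : MvPolynomial (Fin n ⊕ Fin n) ℤ) (α β : Fin n → ℤ), b ≠ 0 ∧
    x * algebraMap _ (AmbientField n n) b = algebraMap _ (AmbientField n n) a ∧
    a.IsWeightedHomogeneous (principalGrading B0) α ∧
    b.IsWeightedHomogeneous (principalGrading B0) β ∧ g = α - β

variable {B0}

theorem HasDegree.mul {x y : AmbientField n n} {g g' : Fin n → ℤ} (hx : HasDegree B0 x g)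
    (hy : HasDegree B0 y g') : HasDegree B0 (x * y) (g + g') := by
  obtain ⟨a, b, α, β, hb, h, ha, hb', rfl⟩ := hx
  obtain ⟨c, e, γ, δ, he, h', hc, he', rfl⟩ := hy
  refine ⟨a * c, b * e, α + γ, β + δ, mul_ne_zero hb he, ?_, ha.mul hc, hb'.mul he', by abel⟩
  rw [map_mul, map_mul, ← h, ← h']; ring

theorem HasDegree.add {x y : AmbientField n n} {g : Fin n → ℤ} (hx : HasDegree B0 x g)
    (hy : HasDegree B0 y g) : HasDegree B0 (x + y) g := by
  obtain ⟨a, b, α, β, hb, h, ha, hb', rfl⟩ := hx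
  obtain ⟨c, e, γ, δ, he, h', hc, he', hg⟩ := hy
  have h1 : γ + β = α + δ := by
    rw [sub_eq_sub_iff_add_eq_add] at hg; rw [hg]
  refine ⟨a * e + c * b, b * e, α + δ, β + δ, mul_ne_zero hb he, ?_, ?_, hb'.mul he', by abel⟩
  · rw [map_mul, map_add, map_mul, map_mul, ← h, ← h']; ring
  · exact (ha.mul he').add (h1 ▸ hc.mul hb')

theorem HasDegree.inv {x : AmbientField n n} {g : Fin n → ℤ} (hx0 : x ≠ 0)
    (hx : HasDegree B0 x g) : HasDegree B0 x⁻¹ (-g) := by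
  obtain ⟨a, b, α, β, hb, h, ha, hb', rfl⟩ := hx
  refine ⟨b, a, β, α, ?_, by rw [← h, inv_mul_cancel_left₀ hx0], hb', ha, by abel⟩
  rintro rfl
  rw [map_zero] at h
  exact mul_ne_zero hx0 (ambient_algebraMap_ne_zero hb) h

theorem HasDegree.one : HasDegree B0 1 0 :=
  ⟨1, 1, 0, 0, one_ne_zero, by simp, MvPolynomial.isWeightedHomogeneous_one _ _,
    MvPolynomial.isWeightedHomogeneous_one _ _, by simp⟩

theorem HasDegree.pow {x : AmbientField n n} {g : Fin n → ℤ} (hx : HasDegree B0 x g) (m : ℕ) :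
    HasDegree B0 (x ^ m) (m • g) := by
  induction m with
  | zero => simpa using HasDegree.one
  | succ m ih => rw [pow_succ, succ_nsmul]; exact ih.mul hx

theorem HasDegree.prod {ι : Type*} (s : Finset ι) {x : ι → AmbientField n n} {g : ι → Fin n → ℤ}
    (hx : ∀ i, HasDegree B0 (x i) (g i)) : HasDegree B0 (∏ i ∈ s, x i) (∑ i ∈ s, g i) := by
  classical
  induction s using Finset.induction_on with
  | empty => simpa using HasDegree.one
  | insert i s hi ih => rw [Finset.prod_insert hi, Finset.sum_insert hi]; exact (hx i).mul ih

theorem HasDegree.unique {x : AmbientField n n} (hx0 : x ≠ 0) {g g' : Fin n → ℤ}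
    (h : HasDegree B0 x g) (h' : HasDegree B0 x g') : g = g' := by
  obtain ⟨a, b, α, β, hb, h, ha, hb', rfl⟩ := h
  obtain ⟨c, e, γ, δ, he, h', hc, he', rfl⟩ := h'
  have ha0 : a ≠ 0 := by
    rintro rfl
    rw [map_zero] at h
    exact mul_ne_zero hx0 (ambient_algebraMap_ne_zero hb) h
  have h1 : a * e = c * b := by
    apply IsFractionRing.injective (MvPolynomial (Fin n ⊕ Fin n) ℤ) (AmbientField n n)
    rw [map_mul, map_mul, ← h, ← h']; ring
  have h2 := hc.mul hb'
  rw [← h1] at h2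
  have h3 := (ha.mul he').inj_right (mul_ne_zero ha0 he) h2
  rw [sub_eq_sub_iff_add_eq_add, h3]

/-- The degree map along a word. -/
def degreeMap (B0 : Matrix (Fin n) (Fin n) ℤ) (w : List (Fin n)) :
    (Fin n ⊕ Fin n → ℤ) →ₗ[ℤ] (Fin n → ℤ) :=
  LinearMap.funLeft ℤ ℤ Sum.inl ∘ₗ gMap (principalMatrix B0) w
    - B0.mulVecLin ∘ₗ LinearMap.funLeft ℤ ℤ Sum.inr

theorem degreeMap_apply (w : List (Fin n)) (c : Fin n ⊕ Fin n → ℤ) :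
    degreeMap B0 w c = (gMap (principalMatrix B0) w c ∘ Sum.inl) - B0.mulVec (c ∘ Sum.inr) := rfl

/-- The exchange relation is homogeneous because `degreeMap` kills the exchange column: by
`gMap_matCol` its principal contribution is `B0` applied to the `c`-vector, which the degrees of the
coefficient variables cancel. -/
theorem hasDegree_varAlong {d : Fin n → ℤ} (hd : ∀ j, 0 < d j)
    (h : ∀ i j, d i * B0 i j = -(d j * B0 j i)) (hsc : SignCoherent B0)
    {w : List (Fin n)} (hw : w.IsChain (· ≠ ·)) (i : Fin n ⊕ Fin n) :
    HasDegree B0 (varAlong (principalMatrix B0) w i) (degreeMap B0 w (Pi.single i 1)) := by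
  have h' : ∀ i j, d i * principalMatrix B0 (Sum.inl i) j
    = -(d j * principalMatrix B0 (Sum.inl j) i) := h
  have htop : (principalMatrix B0).toRows₁ = B0 := by ext; rfl
  induction w generalizing i with
  | nil =>
    refine ⟨MvPolynomial.X i, 1, principalGrading B0 i, 0, one_ne_zero,
      by simp [varAlong, ClassicalSeed.along, initVar],
      MvPolynomial.isWeightedHomogeneous_X _ _ _, MvPolynomial.isWeightedHomogeneous_one _ _, ?_⟩
    rw [degreeMap_apply, sub_zero]
    cases i with
    | inl i => ext l; simp [gMap, Pi.single_apply, Matrix.mulVec, dotProduct]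
    | inr i => ext l; simp [gMap, Pi.single_apply, Matrix.mulVec, dotProduct]
  | cons k w ih =>
    have hw' : w.IsChain (· ≠ ·) := by cases w <;> simp_all [List.isChain_cons_cons]
    have ih := ih hw'
    by_cases hi : i = Sum.inl k
    swap
    · rw [varAlong_cons_of_ne _ w hi, degreeMap_apply, gMap, LinearMap.comp_apply,
        mutLin_of_eq_zero _ _ (by simp [Ne.symm hi])]
      exact ih i
    subst hi
    have hprod : ∀ m : Fin n ⊕ Fin n → ℕ, HasDegree B0
        (∏ i, varAlong (principalMatrix B0) w i ^ m i) (degreeMap B0 w fun i => (m i : ℤ)) := by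
      intro m
      have e : (fun i => (m i : ℤ)) = ∑ i, m i • (Pi.single i 1 : Fin n ⊕ Fin n → ℤ) := by
        ext j; simp [Finset.sum_apply, Pi.single_apply]
      rw [e, map_sum]
      exact HasDegree.prod _ fun i => by rw [map_nsmul]; exact (ih i).pow _
    set b := matCol (matAlong (principalMatrix B0) w) k with hb
    have hbk : b (Sum.inl k) = 0 := matAlong_diag hd h' w k
    have hDb : degreeMap B0 w b = 0 := by
      have h1 := gMap_matCol hd h' (by rwa [htop]) hw' k
      have h2 : b ∘ Sum.inr = cVec B0 w k := rfl
      rw [degreeMap_apply, h1, htop, h2]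
      ext l
      simp [principalMatrix, Matrix.mulVec, dotProduct]
    set ε := tropSign B0 w k with hε
    have hεk := hsc w k hw
    set m1 : Fin n ⊕ Fin n → ℤ := fun i => ((b i).toNat : ℤ) with hm1
    set m2 : Fin n ⊕ Fin n → ℤ := fun i => ((-(b i)).toNat : ℤ) with hm2
    have h12 : degreeMap B0 w m1 = degreeMap B0 w m2 := by
      have : m1 = m2 + b := by ext i; simp [hm1, hm2]; omega
      rw [this, map_add, hDb, add_zero]
    have hv : degreeMap B0 w m2 =
        degreeMap B0 w (exVec (Sum.inl k) (tropCol (principalMatrix B0) w k))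
          + degreeMap B0 w (Pi.single (Sum.inl k) 1) := by
      rw [← map_add, tropCol, htop, ← hε, ← hb]
      rcases tropSign_eq B0 w k with hs | hs <;> rw [← hε] at hs <;> rw [hs]
      · congr 1; ext i
        by_cases hi : i = Sum.inl k
        · subst hi; simp [exVec_self, hm2, hbk]
        · simp [exVec_of_ne _ _ hi, hi, hm2, max_comm]
      · rw [← h12]
        congr 1; ext i
        by_cases hi : i = Sum.inl k
        · subst hi; simp [exVec_self, hm1, hbk]
        · simp [exVec_of_ne _ _ hi, hi, hm1, max_comm]
    -- The frozen entries of the signed column are nonnegative, so `exVec` vanishes there and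
    -- contributes no degree from the coefficients.
    have hfin : degreeMap B0 (k :: w) (Pi.single (Sum.inl k) 1) =
        degreeMap B0 w (exVec (Sum.inl k) (tropCol (principalMatrix B0) w k)) := by
      rw [degreeMap_apply, degreeMap_apply, gMap, LinearMap.comp_apply, mutLin_single]
      congr 2
      ext l
      have h1 := hεk l
      simp only [Function.comp_apply]
      rw [exVec_of_ne _ _ (by simp)]
      simp only [tropCol, htop, Pi.smul_apply, smul_eq_mul, matCol]
      simp only [cVec] at h1
      rw [← hε] at h1 ⊢
      rw [max_eq_left (by omega)]
      simp
    rw [varAlong_cons_self, hfin, ← add_sub_cancel_right (degreeMap B0 w (exVec _ _))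
      (degreeMap B0 w (Pi.single (Sum.inl k) 1)), ← hv, sub_eq_neg_add]
    refine ((ih _).inv (varAlong_ne_zero _ _ _)).mul (HasDegree.add ?_ (hprod _))
    rw [← h12]
    exact hprod _

end grading

theorem gVector_eq {d : Fin n → ℤ} (hd : ∀ j, 0 < d j) {B0 : Matrix (Fin n) (Fin n) ℤ}
    (h : ∀ i j, d i * B0 i j = -(d j * B0 j i)) (hsc : SignCoherent B0)
    (t : TreeVertex n) (j : Fin n) :
    gVector B0 j t = fun i => gMap (principalMatrix B0) t.1 (Pi.single (Sum.inl j) 1) (Sum.inl i) := by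
  have h1 : IsGVector B0 j t (degreeMap B0 t.1 (Pi.single (Sum.inl j) 1)) :=
    hasDegree_varAlong hd h hsc t.2 (Sum.inl j)
  have h2 : ∃ g, IsGVector B0 j t g := ⟨_, h1⟩
  have h3 : gVector B0 j t = h2.choose := dif_pos h2
  rw [h3, HasDegree.unique (varAlong_ne_zero (principalMatrix B0) t.1 (Sum.inl j))
    h2.choose_spec h1, degreeMap_apply]
  ext i
  simp [Matrix.mulVec, dotProduct]

end GVectors

/-! ### A skew-field with a toric frame of a given form -/

/-- The central extension of `ℤ^ι` by `ℤ` with cocycle `Λ`. -/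
@[ext]
structure HeisenbergGroup {ι : Type*} (Λ : Matrix ι ι ℤ) where
  deg : ι → ℤ
  height : ℤ

namespace HeisenbergGroup

variable {ι : Type*} [Fintype ι] {Λ : Matrix ι ι ℤ}

instance : Mul (HeisenbergGroup Λ) :=
  ⟨fun a b => ⟨a.deg + b.deg, a.height + b.height + a.deg ⬝ᵥ Λ.mulVec b.deg⟩⟩

instance : One (HeisenbergGroup Λ) := ⟨⟨0, 0⟩⟩

instance : Inv (HeisenbergGroup Λ) :=
  ⟨fun a => ⟨-a.deg, -a.height + a.deg ⬝ᵥ Λ.mulVec a.deg⟩⟩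

theorem mul_def (a b : HeisenbergGroup Λ) :
    a * b = ⟨a.deg + b.deg, a.height + b.height + a.deg ⬝ᵥ Λ.mulVec b.deg⟩ := rfl

theorem inv_def (a : HeisenbergGroup Λ) :
    a⁻¹ = ⟨-a.deg, -a.height + a.deg ⬝ᵥ Λ.mulVec a.deg⟩ := rfl

instance : Group (HeisenbergGroup Λ) :=
  Group.ofLeftAxioms
    (fun a b c => by
      ext1
      · simp [mul_def, add_assoc]
      · simp only [mul_def, Matrix.mulVec_add, add_dotProduct, dotProduct_add]
        ring)
    (fun a => by ext1 <;> simp [mul_def, show (1 : HeisenbergGroup Λ) = ⟨0, 0⟩ from rfl])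
    (fun a => by ext1 <;> simp [mul_def, inv_def, show (1 : HeisenbergGroup Λ) = ⟨0, 0⟩ from rfl])

/-- Degrees lie in `ℤ^ι`, which has unique sums. Within the two fibres so obtained, the elements of
maximal height give a unique product. Hence the group ring has no zero divisors. -/
instance : UniqueProds (HeisenbergGroup Λ) where
  uniqueMul_of_nonempty {A B} hA hB := by
    classical
    obtain ⟨p, hp, q, hq, hpq⟩ := UniqueSums.uniqueAdd_of_nonempty (hA.image deg) (hB.image deg)
    obtain ⟨a₁, ha₁, hap⟩ := Finset.mem_image.mp hp
    obtain ⟨b₁, hb₁, hbq⟩ := Finset.mem_image.mp hq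
    obtain ⟨a, ha, hamax⟩ := (A.filter (·.deg = p)).exists_max_image height
      ⟨a₁, Finset.mem_filter.mpr ⟨ha₁, hap⟩⟩
    obtain ⟨b, hb, hbmax⟩ := (B.filter (·.deg = q)).exists_max_image height
      ⟨b₁, Finset.mem_filter.mpr ⟨hb₁, hbq⟩⟩
    rw [Finset.mem_filter] at ha hb
    refine ⟨a, ha.1, b, hb.1, fun a' b' ha' hb' h => ?_⟩
    have h1 := congrArg deg h
    have h2 := congrArg height h
    simp only [mul_def] at h1 h2
    rw [ha.2, hb.2] at h1
    obtain ⟨h3, h4⟩ := hpq (Finset.mem_image_of_mem _ ha') (Finset.mem_image_of_mem _ hb') h1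
    have h5 := hamax a' (Finset.mem_filter.mpr ⟨ha', h3⟩)
    have h6 := hbmax b' (Finset.mem_filter.mpr ⟨hb', h4⟩)
    rw [h3, h4, ha.2, hb.2] at h2
    exact ⟨HeisenbergGroup.ext (h3.trans ha.2.symm) (by omega),
      HeisenbergGroup.ext (h4.trans hb.2.symm) (by omega)⟩

/-- The elements with `|deg i| ≤ N` and `|height| ≤ N²`. -/
noncomputable def box [DecidableEq ι] (Λ : Matrix ι ι ℤ) (N : ℕ) : Finset (HeisenbergGroup Λ) :=
  ((Fintype.piFinset fun _ : ι => Finset.Icc (-(N : ℤ)) N) ×ˢ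
    Finset.Icc (-((N : ℤ) ^ 2)) ((N : ℤ) ^ 2)).map
      ⟨fun p => ⟨p.1, p.2⟩, fun p q h => by
        rw [HeisenbergGroup.mk.injEq] at h; exact Prod.ext h.1 h.2⟩

theorem mem_box [DecidableEq ι] {N : ℕ} {a : HeisenbergGroup Λ} :
    a ∈ box Λ N ↔ (∀ i, |a.deg i| ≤ N) ∧ |a.height| ≤ (N : ℤ) ^ 2 := by
  simp only [box, Finset.mem_map, Finset.mem_product, Fintype.mem_piFinset, Finset.mem_Icc,
    abs_le]
  constructor
  · rintro ⟨p, hp, rfl⟩; exact hp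
  · intro h; exact ⟨(a.deg, a.height), h, rfl⟩

theorem card_box [DecidableEq ι] (Λ : Matrix ι ι ℤ) (N : ℕ) :
    (box Λ N).card = (2 * N + 1) ^ Fintype.card ι * (2 * N ^ 2 + 1) := by
  rw [box, Finset.card_map, Finset.card_product, Fintype.card_piFinset]
  simp only [Int.card_Icc, Finset.prod_const, Finset.card_univ]
  have h : ∀ a : ℕ, ((a : ℤ) + 1 - -(a : ℤ)).toNat = 2 * a + 1 := fun a => by omega
  rw [h, ← h (N ^ 2)]
  push_cast
  rfl

theorem abs_dotProduct_mulVec_le (Λ : Matrix ι ι ℤ) {u v : ι → ℤ} {C N : ℤ}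
    (hu : ∀ i, |u i| ≤ C) (hv : ∀ i, |v i| ≤ N) (hC : 0 ≤ C) :
    |u ⬝ᵥ Λ.mulVec v| ≤ C * N * ∑ i, ∑ j, |Λ i j| := by
  simp only [dotProduct, Matrix.mulVec, Finset.mul_sum]
  refine (Finset.abs_sum_le_sum_abs _ _).trans (Finset.sum_le_sum fun i _ => ?_)
  refine (Finset.abs_sum_le_sum_abs _ _).trans (Finset.sum_le_sum fun j _ => ?_)
  rw [abs_mul, abs_mul]
  calc |u i| * (|Λ i j| * |v j|) = (|u i| * |v j|) * |Λ i j| := by ring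
    _ ≤ _ := mul_le_mul_of_nonneg_right
      (mul_le_mul (hu i) (hv j) (abs_nonneg _) hC) (abs_nonneg _)

/-- Multiplying a box by a given finite set leads into a somewhat larger box. -/
theorem exists_mul_mem_box [DecidableEq ι] (F : Finset (HeisenbergGroup Λ)) :
    ∃ D : ℕ, ∀ f ∈ F, ∀ N : ℕ, ∀ s ∈ box Λ N, f * s ∈ box Λ (N + D) ∧ s * f ∈ box Λ (N + D) := by
  obtain ⟨C, hC1, hC⟩ : ∃ C : ℕ, 1 ≤ C ∧ ∀ f ∈ F, (∀ i, |f.deg i| ≤ C) ∧ |f.height| ≤ C := by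
    refine ⟨1 + ∑ f ∈ F, ((∑ i, (f.deg i).natAbs) + f.height.natAbs), by omega, fun f hf => ?_⟩
    have h1 := Finset.single_le_sum (f := fun f : HeisenbergGroup Λ =>
      (∑ i, (f.deg i).natAbs) + f.height.natAbs) (fun _ _ => Nat.zero_le _) hf
    refine ⟨fun i => ?_, ?_⟩
    · have h2 := Finset.single_le_sum (f := fun i => (f.deg i).natAbs)
        (fun _ _ => Nat.zero_le _) (Finset.mem_univ i)
      rw [Int.abs_eq_natAbs]
      omega
    · rw [Int.abs_eq_natAbs]
      omega
  set L := ∑ i, ∑ j, (Λ i j).natAbs with hL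
  have hL' : ∑ i, ∑ j, |Λ i j| = (L : ℤ) := by simp [hL]
  -- The height grows by at most `C + C N L`. With `D = C (1 + L)` this is at most `2 N D + D²`,
  -- which is why heights are bounded quadratically.
  refine ⟨C * (1 + L), fun f hf N s hs => ?_⟩
  obtain ⟨hf1, hf2⟩ := hC f hf
  rw [mem_box] at hs
  have hCN : (C : ℤ) ≤ (C : ℤ) * (1 + L) := by nlinarith
  have key : ∀ x : ℤ, |x| ≤ C * N * L →
      |f.height + s.height + x| ≤ ((N : ℤ) + C * (1 + L)) ^ 2 := by
    intro x hx
    have h1 := abs_add_le (f.height + s.height) x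
    have h2 := abs_add_le f.height s.height
    have h3 : (C : ℤ) ≤ (C * (1 + L)) ^ 2 := by nlinarith
    have h4 : (0 : ℤ) ≤ C * N * L := by positivity
    have h5 : (0 : ℤ) ≤ C * N := by positivity
    nlinarith [hs.2]
  have hdeg : ∀ i, |f.deg i + s.deg i| ≤ (N : ℤ) + C * (1 + L) := fun i => by
    have := abs_add_le (f.deg i) (s.deg i)
    linarith [hf1 i, hs.1 i]
  refine ⟨mem_box.mpr ⟨fun i => ?_, ?_⟩, mem_box.mpr ⟨fun i => ?_, ?_⟩⟩
  · push_cast; exact hdeg i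
  · push_cast
    refine key _ ?_
    rw [← hL']
    exact abs_dotProduct_mulVec_le Λ hf1 hs.1 (by positivity)
  · push_cast; change |s.deg i + f.deg i| ≤ _; rw [add_comm]; exact hdeg i
  · push_cast
    change |s.height + f.height + _| ≤ _
    rw [add_comm s.height]
    refine key _ ?_
    rw [← hL', mul_comm (C : ℤ) N]
    exact abs_dotProduct_mulVec_le Λ hs.1 hf1 (by positivity)

/-- Box sizes are polynomial in the radius, so they cannot at least double at every step of length
`D`. -/
theorem exists_card_box_lt [DecidableEq ι] (Λ : Matrix ι ι ℤ) (D : ℕ) :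
    ∃ N, (box Λ (N + D)).card < 2 * (box Λ N).card := by
  by_contra! h
  have h1 : ∀ k, 2 ^ k ≤ (box Λ (k * D)).card := by
    intro k
    induction k with
    | zero => simp [card_box]
    | succ k ih =>
      rw [pow_succ, add_mul, one_mul]
      linarith [h (k * D)]
  set e := Fintype.card ι + 2
  have h2 : ∀ k : ℕ, 2 ^ k ≤ (2 * D + 1) ^ e * (k + 1) ^ e := by
    intro k
    refine (h1 k).trans ?_
    rw [card_box, ← mul_pow]
    have h3 : 2 * (k * D) + 1 ≤ (2 * D + 1) * (k + 1) := by nlinarith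
    calc _ ≤ (2 * (k * D) + 1) ^ Fintype.card ι * (2 * (k * D) + 1) ^ 2 := by
          refine Nat.mul_le_mul_left _ ?_
          nlinarith [Nat.zero_le (k * D)]
      _ = (2 * (k * D) + 1) ^ e := by rw [← pow_add]
      _ ≤ _ := Nat.pow_le_pow_left h3 e
  have h3 := (tendsto_pow_const_div_const_pow_of_one_lt e (r := 2) (by norm_num)).eventually
    (gt_mem_nhds (show (0 : ℝ) < 1 / (2 * (2 * D + 1) ^ e) by positivity))
  obtain ⟨m, hm⟩ := h3.exists_forall_of_atTop
  have h4 := hm (m + 1) (by omega)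
  rw [div_lt_div_iff₀ (by positivity) (by positivity), one_mul] at h4
  have h5 : ((2 : ℝ) ^ m) ≤ (2 * D + 1) ^ e * ((m + 1 : ℕ) : ℝ) ^ e := by exact_mod_cast h2 m
  rw [pow_succ (2 : ℝ)] at h4
  linarith

end HeisenbergGroup

/-- Two linear endomorphisms that map the span of a finite set into the span of a less than twice
as large set have a nontrivial coincidence. -/
theorem MonoidAlgebra.exists_apply_eq_apply {G : Type*} [DecidableEq G]
    (φ ψ : MonoidAlgebra ℤ G →ₗ[ℤ] MonoidAlgebra ℤ G) (S S' : Finset G)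
    (hcard : S'.card < 2 * S.card)
    (hφ : ∀ s ∈ S, (φ (single s 1)).coeff.support ⊆ S')
    (hψ : ∀ s ∈ S, (ψ (single s 1)).coeff.support ⊆ S') :
    ∃ x y, (x ≠ 0 ∨ y ≠ 0) ∧ φ x = ψ y := by
  let e : (S → ℤ) →ₗ[ℤ] MonoidAlgebra ℤ G :=
    ∑ s : S, (LinearMap.proj s).smulRight (single (s : G) (1 : ℤ))
  have he : ∀ f, e f = ∑ s : S, f s • single (s : G) (1 : ℤ) := fun f => by simp [e]
  have heinj : ∀ f, e f = 0 → f = 0 := by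
    intro f hf
    funext s
    have := congrArg (fun x : MonoidAlgebra ℤ G => x.coeff s) ((he f).symm.trans hf)
    simpa [MonoidAlgebra.coeff_sum, MonoidAlgebra.coeff_single, Finsupp.single_apply] using this
  have hsupp : ∀ χ : MonoidAlgebra ℤ G →ₗ[ℤ] MonoidAlgebra ℤ G,
      (∀ s ∈ S, (χ (single s 1)).coeff.support ⊆ S') → ∀ f, ∀ g ∉ S', (χ (e f)).coeff g = 0 := by
    intro χ hχ f g hg
    rw [he, map_sum, MonoidAlgebra.coeff_sum, Finsupp.finsetSum_apply]
    refine Finset.sum_eq_zero fun s _ => ?_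
    have h1 : (χ (single (s : G) 1)).coeff g = 0 := by
      by_contra h
      exact hg (hχ s s.2 (Finsupp.mem_support_iff.mpr h))
    rw [map_smul]
    change f s • (χ (single (s : G) 1)).coeff g = 0
    rw [h1, smul_zero]
  let c : MonoidAlgebra ℤ G →ₗ[ℤ] (S' → ℤ) :=
    { toFun := fun x g => x.coeff g
      map_add' := fun x y => rfl
      map_smul' := fun a x => rfl }
  let L : (S ⊕ S → ℤ) →ₗ[ℤ] (S' → ℤ) :=
    c ∘ₗ (φ ∘ₗ e ∘ₗ LinearMap.funLeft ℤ ℤ Sum.inl - ψ ∘ₗ e ∘ₗ LinearMap.funLeft ℤ ℤ Sum.inr)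
  -- The source has rank `2 |S|`, which exceeds the rank `|S'|` of the target.
  have hL : ¬ Function.Injective L := by
    intro h
    have := card_le_of_injective ℤ L h
    simp only [Fintype.card_sum, Fintype.card_coe] at this
    omega
  rw [← LinearMap.ker_eq_bot, Submodule.eq_bot_iff] at hL
  push Not at hL
  obtain ⟨f, hf, hf0⟩ := hL
  refine ⟨e (f ∘ Sum.inl), e (f ∘ Sum.inr), ?_, ?_⟩
  · by_contra! h
    have h1 := heinj _ h.1
    have h2 := heinj _ h.2
    exact hf0 (funext fun x => by
      rcases x with s | s
      · exact congrFun h1 s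
      · exact congrFun h2 s)
  · ext g
    by_cases hg : g ∈ S'
    · have := congrFun (LinearMap.mem_ker.mp hf) ⟨g, hg⟩
      exact sub_eq_zero.mp this
    · rw [hsupp φ hφ _ g hg, hsupp ψ hψ _ g hg]

namespace HeisenbergGroup

variable {ι : Type*} [Fintype ι] {Λ : Matrix ι ι ℤ}

/-- This is the Ore condition on both sides. Multiplication by `a` and by `b` maps the span of a box
into the span of a box less than twice as large, so rank counting forces a common multiple. -/
theorem exists_mul_eq_mul (a b : MonoidAlgebra ℤ (HeisenbergGroup Λ)) :
    (∃ x y, (x ≠ 0 ∨ y ≠ 0) ∧ a * x = b * y) ∧ (∃ x y, (x ≠ 0 ∨ y ≠ 0) ∧ x * a = y * b) := by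
  classical
  obtain ⟨D, hD⟩ := exists_mul_mem_box (a.coeff.support ∪ b.coeff.support)
  obtain ⟨N, hN⟩ := exists_card_box_lt Λ D
  have hl : ∀ c : MonoidAlgebra ℤ (HeisenbergGroup Λ),
      c.coeff.support ⊆ a.coeff.support ∪ b.coeff.support → ∀ s ∈ box Λ N,
        (LinearMap.mulLeft ℤ c (MonoidAlgebra.single s 1)).coeff.support ⊆ box Λ (N + D) := by
    intro c hc s hs g hg
    obtain ⟨f, hf, h, hh, rfl⟩ := Finset.mem_mul.mp (MonoidAlgebra.support_coeff_mul_subset _ _ hg)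
    rw [MonoidAlgebra.coeff_single] at hh
    obtain rfl := Finset.mem_singleton.mp (Finsupp.support_single_subset hh)
    exact (hD f (hc hf) N h hs).1
  have hr : ∀ c : MonoidAlgebra ℤ (HeisenbergGroup Λ),
      c.coeff.support ⊆ a.coeff.support ∪ b.coeff.support → ∀ s ∈ box Λ N,
        (LinearMap.mulRight ℤ c (MonoidAlgebra.single s 1)).coeff.support ⊆ box Λ (N + D) := by
    intro c hc s hs g hg
    obtain ⟨h, hh, f, hf, rfl⟩ := Finset.mem_mul.mp (MonoidAlgebra.support_coeff_mul_subset _ _ hg)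
    rw [MonoidAlgebra.coeff_single] at hh
    obtain rfl := Finset.mem_singleton.mp (Finsupp.support_single_subset hh)
    exact (hD f (hc hf) N h hs).2
  exact ⟨MonoidAlgebra.exists_apply_eq_apply (LinearMap.mulLeft ℤ a) (LinearMap.mulLeft ℤ b) _ _ hN
      (hl a Finset.subset_union_left) (hl b Finset.subset_union_right),
    MonoidAlgebra.exists_apply_eq_apply (LinearMap.mulRight ℤ a) (LinearMap.mulRight ℤ b) _ _ hN
      (hr a Finset.subset_union_left) (hr b Finset.subset_union_right)⟩

end HeisenbergGroup

namespace HeisenbergGroup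

variable {ι : Type*} [Fintype ι] (Λ : Matrix ι ι ℤ)

/-- The ring homomorphism that sends `T z` to the central element of height `z`. -/
noncomputable def laurentHom : ℤ[T;T⁻¹] →ₐ[ℤ] MonoidAlgebra ℤ (HeisenbergGroup Λ) :=
  AddMonoidAlgebra.lift ℤ _ ℤ
    { toFun := fun z => MonoidAlgebra.single ⟨0, z.toAdd⟩ 1
      map_one' := rfl
      map_mul' := fun x y => by simp [MonoidAlgebra.single_mul_single, mul_def] }

theorem laurentHom_T (z : ℤ) :
    laurentHom Λ (T z) = MonoidAlgebra.single (⟨0, z⟩ : HeisenbergGroup Λ) 1 := by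
  rw [laurentHom, LaurentPolynomial.T, AddMonoidAlgebra.lift_single, one_smul]
  rfl

theorem laurentHom_mul_single (r : ℤ[T;T⁻¹]) (c : ι → ℤ) (z : ℤ) :
    laurentHom Λ r * MonoidAlgebra.single ⟨c, z⟩ 1 =
      r.coeff.sum fun y n => MonoidAlgebra.single (⟨c, y + z⟩ : HeisenbergGroup Λ) n := by
  induction r using AddMonoidAlgebra.induction_linear with
  | zero => simp
  | add f g hf hg =>
    rw [map_add, add_mul, hf, hg, AddMonoidAlgebra.coeff_add,
      Finsupp.sum_add_index' (by simp) (by simp [MonoidAlgebra.single_add])]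
  | single y n =>
    have h : (AddMonoidAlgebra.single y n : ℤ[T;T⁻¹]) = n • T y := by
      rw [LaurentPolynomial.T, AddMonoidAlgebra.smul_single, smul_eq_mul, mul_one]
    rw [h, map_smul, laurentHom_T, smul_mul_assoc, MonoidAlgebra.single_mul_single, ← h,
      AddMonoidAlgebra.coeff_single, Finsupp.sum_single_index (by simp)]
    simp [mul_def, MonoidAlgebra.smul_single]

/-- Elements of degree zero pair trivially with every degree under the cocycle, hence are central.
-/
theorem laurentHom_commutes (r : ℤ[T;T⁻¹]) (x : MonoidAlgebra ℤ (HeisenbergGroup Λ)) :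
    laurentHom Λ r * x = x * laurentHom Λ r := by
  induction r using AddMonoidAlgebra.induction_linear with
  | zero => simp
  | add f g hf hg => rw [map_add, add_mul, hf, hg, mul_add]
  | single y n =>
    have h : (AddMonoidAlgebra.single y n : ℤ[T;T⁻¹]) = n • T y := by
      rw [LaurentPolynomial.T, AddMonoidAlgebra.smul_single, smul_eq_mul, mul_one]
    rw [h, map_smul, laurentHom_T, smul_mul_assoc, mul_smul_comm]
    congr 1
    induction x using MonoidAlgebra.induction_linear with
    | zero => simp
    | add f g hf hg => rw [mul_add, hf, hg, add_mul]
    | single g m =>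
      rw [MonoidAlgebra.single_mul_single, MonoidAlgebra.single_mul_single]
      simp [mul_def, add_comm]

end HeisenbergGroup

open HeisenbergGroup in
/-- Every skew-symmetric form is the form of a toric frame in some skew-field. -/
theorem exists_isToricFrame {ι : Type} [Fintype ι] (Λ : Matrix ι ι ℤ) (hΛ : Λ.transpose = -Λ) :
    ∃ (K : Type) (_ : DivisionRing K) (_ : Algebra ℤ[T;T⁻¹] K) (M : (ι → ℤ) → K),
      IsToricFrame M Λ := by
  classical
  let A := MonoidAlgebra ℤ (HeisenbergGroup Λ)
  let : Algebra ℤ[T;T⁻¹] A := (laurentHom Λ).toRingHom.toAlgebra' (laurentHom_commutes Λ)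
  have hmap : ∀ r, algebraMap ℤ[T;T⁻¹] A r = laurentHom Λ r := fun r => rfl
  have hore : Nonempty (OreLocalization.OreSet (nonZeroDivisors A)) := by
    rw [OreLocalization.nonempty_oreSet_iff_of_noZeroDivisors]
    intro r s
    obtain ⟨x, y, hxy, h⟩ := (exists_mul_eq_mul r (s : A)).2
    have hs := nonZeroDivisors.ne_zero s.2
    refine ⟨y, ⟨x, mem_nonZeroDivisors_of_ne_zero ?_⟩, h⟩
    rintro rfl
    rw [zero_mul, eq_comm, mul_eq_zero] at h
    exact hxy.elim (fun h => h rfl) fun hy => h.elim hy hs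
  obtain ⟨hore⟩ := hore
  let K := OreLocalization (nonZeroDivisors A) A
  let N : A →ₐ[ℤ[T;T⁻¹]] K :=
    { OreLocalization.numeratorRingHom with commutes' := fun r => rfl }
  have hN : Function.Injective N :=
    OreLocalization.numeratorHom_inj (fun _ h => h.1)
  have hfrac : ∀ x : K, ∃ (r s : A), s ≠ 0 ∧ N s * x = N r := by
    intro x
    induction x using OreLocalization.ind with | _ r s
    refine ⟨r, s, nonZeroDivisors.ne_zero s.2, ?_⟩
    change ((s : A) /ₒ 1) * (r /ₒ s) = (r /ₒ 1)
    rw [OreLocalization.mul_cancel]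
  let m : (ι → ℤ) → A := fun c => MonoidAlgebra.single ⟨c, 0⟩ 1
  have hsmul : ∀ (r : ℤ[T;T⁻¹]) (c : ι → ℤ), r • m c =
      r.coeff.sum fun y n => MonoidAlgebra.single (⟨c, y⟩ : HeisenbergGroup Λ) n := by
    intro r c
    rw [Algebra.smul_def, hmap, laurentHom_mul_single]
    simp
  have hT : ∀ (z : ℤ) c, (T z : ℤ[T;T⁻¹]) • m c = MonoidAlgebra.single ⟨c, z⟩ 1 := by
    intro z c
    rw [Algebra.smul_def, hmap, laurentHom_T, MonoidAlgebra.single_mul_single]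
    simp [mul_def]
  have hmem : ∀ a : A, N a ∈ Submodule.span ℤ[T;T⁻¹] (Set.range fun c => N (m c)) := by
    intro a
    induction a using MonoidAlgebra.induction_linear with
    | zero => rw [map_zero]; exact Submodule.zero_mem _
    | add f g hf hg => rw [map_add]; exact Submodule.add_mem _ hf hg
    | single g k =>
      have h : (MonoidAlgebra.single g k : A) = k • (T g.height : ℤ[T;T⁻¹]) • m g.deg := by
        rw [hT, MonoidAlgebra.smul_single, smul_eq_mul, mul_one]
      rw [h, map_zsmul, map_smul]
      exact zsmul_mem (Submodule.smul_mem _ _ (Submodule.subset_span (Set.mem_range_self _))) _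
  refine ⟨K, inferInstance, inferInstance, fun c => N (m c), hΛ, ?_, ?_, ?_⟩
  · intro c d
    rw [← map_mul, ← map_smul, hT, MonoidAlgebra.single_mul_single]
    simp [mul_def]
  · refine LinearIndependent.map_injOn (f := N.toLinearMap) ?_ hN.injOn
    rw [linearIndependent_iff]
    intro l hl
    ext c z
    have h := congrArg (fun x : A => x.coeff ⟨c, z⟩) hl
    have hcoeff : ∀ (r : ℤ[T;T⁻¹]) (c' : ι → ℤ),
        (r • m c').coeff ⟨c, z⟩ = if c' = c then r.coeff z else 0 := by
      intro r c'
      rw [hsmul, Finsupp.sum, MonoidAlgebra.coeff_sum, Finsupp.finsetSum_apply]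
      simp only [MonoidAlgebra.coeff_single, Finsupp.single_apply, HeisenbergGroup.mk.injEq]
      split_ifs with hc
      · simp +contextual [hc]
      · simp [hc]
    rw [Finsupp.linearCombination_apply, Finsupp.sum] at h
    have h2 := (DFunLike.congr_fun (MonoidAlgebra.coeff_sum _ _)
      (⟨c, z⟩ : HeisenbergGroup Λ)).symm.trans h
    rw [Finsupp.finsetSum_apply, Finset.sum_congr rfl fun c' _ => hcoeff (l c') c'] at h2
    by_cases h0 : l c = 0
    · rw [h0]
      rfl
    · simpa [h0] using h2
  · intro x
    obtain ⟨r, s, hs, h⟩ := hfrac x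
    -- Elements of the localization are left fractions, but a toric frame asks for right fractions;
    -- a common right multiple of numerator and denominator converts one into the other.
    obtain ⟨u, v, huv, h'⟩ := (exists_mul_eq_mul r s).1
    have hu : u ≠ 0 := by
      rintro rfl
      rw [mul_zero, eq_comm, mul_eq_zero] at h'
      exact huv.elim (fun h => h rfl) fun hy => h'.elim hs hy
    have hNu : N u ≠ 0 := by rwa [ne_eq, map_eq_zero_iff N hN]
    have hNs : N s ≠ 0 := by rwa [ne_eq, map_eq_zero_iff N hN]
    refine ⟨N v, hmem v, N u, hmem u, hNu, ?_⟩
    rw [eq_mul_inv_iff_mul_eq₀ hNu]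
    apply mul_left_cancel₀ hNs
    rw [← mul_assoc, h, ← map_mul, h', map_mul]

noncomputable section Evaluation

/-! ### Quantum polynomials and their values -/

/-- If the leading coefficient of `E` is `1` and `E * x` is supported in a submonoid that supports
`E`, then so is `x`. -/
theorem QTorus.mem_frameSpan_of_mul_mem {ι K : Type*} [DivisionRing K] [Algebra ℤ[T;T⁻¹] K]
    {M : (ι → ℤ) → K} {ω : LinearMap.BilinForm ℤ (ι → ℤ)} (h : QTorus M ω)
    (ℓ : (ι → ℤ) →ₗ[ℤ] ℤ) {N : Set (ι → ℤ)} (hN : ∀ c ∈ N, ∀ d ∈ N, c + d ∈ N) {E x : K}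
    (hE : E - 1 ∈ frameSpan M (N ∩ {c | 1 ≤ ℓ c})) (hx : x ∈ torusSpan M)
    (hEx : E * x ∈ frameSpan M N) : x ∈ frameSpan M N := by
  obtain ⟨y, hy, z, hz, rfl⟩ := exists_add_of_mem_frameSpan N hx
  rw [Set.univ_inter] at hy hz
  have hEz : z + (E - 1) * z ∈ frameSpan M N := by
    have h1 : z + (E - 1) * z = E * (y + z) - y - (E - 1) * y := by
      simp only [sub_mul, mul_add, one_mul]; abel
    rw [h1]
    exact Submodule.sub_mem _ (Submodule.sub_mem _ hEx hy)
      (h.form.mul_mem_frameSpan hN (frameSpan_mono Set.inter_subset_left hE) hy)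
  obtain ⟨lo, m, hm⟩ := exists_window ℓ (frameSpan_le_torusSpan _ hz)
  -- The part `z` of `x` outside `N` equals `-(E - 1) * z` up to elements supported in `N`, and
  -- multiplication by `E - 1` raises `ℓ` by at least one. So `z` is pushed beyond its bounded
  -- window and vanishes.
  have key : ∀ p : ℕ, z ∈ frameSpan M {c | lo + p ≤ ℓ c} := by
    intro p
    induction p with
    | zero =>
      refine frameSpan_mono ?_ hm
      rintro c ⟨h1, h2⟩
      simpa using h1
    | succ p ih =>
      obtain ⟨y₁, hy₁, z₁, hz₁, hyz⟩ := exists_add_of_mem_frameSpan {c | lo + p + 1 ≤ ℓ c} hz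
      have h2 : (E - 1) * z ∈ frameSpan M (N ∪ {c | lo + p + 1 ≤ ℓ c}) := by
        refine h.form.mul_mem_frameSpan ?_ hE ih
        rintro c ⟨-, hc⟩ d hd
        simp only [Set.mem_ofPred_eq] at hc hd
        right
        simp only [Set.mem_ofPred_eq, map_add]
        omega
      have h3 : z₁ ∈ frameSpan M (N ∪ {c | lo + p + 1 ≤ ℓ c}) := by
        have h4 : z₁ = (z + (E - 1) * z) - (E - 1) * z - y₁ := by
          rw [add_sub_cancel_right, hyz, add_sub_cancel_left]
        rw [h4]
        exact Submodule.sub_mem _ (Submodule.sub_mem _ (frameSpan_mono Set.subset_union_left hEz)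
          h2) (frameSpan_mono (Set.inter_subset_right.trans Set.subset_union_right) hy₁)
      have h5 : z₁ = 0 := by
        refine h.eq_zero_of_mem ?_ hz₁ h3
        rw [Set.disjoint_left]
        rintro c ⟨hc1, hc2⟩ (hc3 | hc3)
        · exact hc1 hc3
        · exact hc2 hc3
      rw [hyz, h5, add_zero]
      refine frameSpan_mono ?_ hy₁
      rintro c ⟨-, hc⟩
      simp only [Set.mem_ofPred_eq, Nat.cast_succ] at hc ⊢
      omega
  have hz0 : z = 0 := by
    refine h.eq_zero_of_mem ?_ (key m) hm
    rw [Set.disjoint_left]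
    rintro c hc1 ⟨-, hc2⟩
    simp only [Set.mem_ofPred_eq] at hc1 hc2
    omega
  rw [hz0, add_zero]
  exact hy

variable {n r : ℕ} {K : Type*} [DivisionRing K] [Algebra ℤ[T;T⁻¹] K]

/-- An exponent as an integer vector. -/
def natVec (a : Fin n →₀ ℕ) : Fin n → ℤ := fun i => a i

@[simp] theorem natVec_apply (a : Fin n →₀ ℕ) (i : Fin n) : natVec a i = a i := rfl

@[simp] theorem natVec_zero : natVec (0 : Fin n →₀ ℕ) = 0 := by ext; simp

@[simp] theorem natVec_add (a b : Fin n →₀ ℕ) : natVec (a + b) = natVec a + natVec b := by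
  ext; simp

theorem natVec_injective : Function.Injective (natVec : (Fin n →₀ ℕ) → Fin n → ℤ) := by
  intro a b h
  ext i
  have := congrFun h i
  simpa using this

/-- The value of a quantum polynomial at the elements `M(b^j)`, where the normalized monomial of
exponent `a` is sent to `M(B a)`. -/
def qEval (M : (Fin n ⊕ Fin r → ℤ) → K) (B : Matrix (Fin n ⊕ Fin r) (Fin n) ℤ) :
    QuantumPolynomial n →ₗ[ℤ[T;T⁻¹]] K :=
  Finsupp.linearCombination ℤ[T;T⁻¹] fun a => M (B.mulVec (natVec a))

/-- The product of quantum polynomials. -/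
def qMul (B0 : Matrix (Fin n) (Fin n) ℤ) (d : Fin n → ℤ) (F G : QuantumPolynomial n) :
    QuantumPolynomial n :=
  Finsupp.linearCombination ℤ[T;T⁻¹] (fun a =>
    Finsupp.linearCombination ℤ[T;T⁻¹] (fun b =>
      Finsupp.single (a + b) (T (∑ l, d l * natVec a l * B0.mulVec (natVec b) l) : ℤ[T;T⁻¹])) G) F

/-- Conjugation by a frame element of degree `g`. -/
def qTwist (d g : Fin n → ℤ) : QuantumPolynomial n →ₗ[ℤ[T;T⁻¹]] QuantumPolynomial n :=
  Finsupp.linearCombination ℤ[T;T⁻¹] fun a =>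
    Finsupp.single a (T (-(2 * ∑ l, d l * natVec a l * g l)) : ℤ[T;T⁻¹])

theorem qMul_apply_zero (B0 : Matrix (Fin n) (Fin n) ℤ) (d : Fin n → ℤ)
    (F G : QuantumPolynomial n) : qMul B0 d F G 0 = F 0 * G 0 := by
  classical
  have h : ∀ (a : Fin n →₀ ℕ) (r : ℤ[T;T⁻¹]), (Finsupp.linearCombination ℤ[T;T⁻¹] (fun b =>
      Finsupp.single (a + b) (T (∑ l, d l * natVec a l * B0.mulVec (natVec b) l) : ℤ[T;T⁻¹])) G) 0
      * r = if a = 0 then G 0 * r else 0 := by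
    intro a r
    induction G using Finsupp.induction_linear with
    | zero => simp
    | add f g hf hg => rw [map_add, Finsupp.add_apply, add_mul, hf, hg]; split_ifs <;> simp [add_mul]
    | single b s =>
      by_cases ha : a = 0
      · by_cases hb : b = 0 <;> simp [ha, hb]
      · simp [ha]
  induction F using Finsupp.induction_linear with
  | zero => simp [qMul]
  | add f g hf hg =>
    unfold qMul at hf hg ⊢
    rw [map_add, Finsupp.add_apply, hf, hg, Finsupp.add_apply, add_mul]
  | single a s =>
    rw [qMul, Finsupp.linearCombination_single, Finsupp.smul_apply, smul_eq_mul, mul_comm, h]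
    by_cases ha : a = 0 <;> simp [ha, mul_comm]

theorem qTwist_apply_zero (d g : Fin n → ℤ) (F : QuantumPolynomial n) : qTwist d g F 0 = F 0 := by
  induction F using Finsupp.induction_linear with
  | zero => simp
  | add f g hf hg => rw [map_add, Finsupp.add_apply, hf, hg, Finsupp.add_apply]
  | single a s =>
    rw [qTwist, Finsupp.linearCombination_single]
    by_cases ha : a = 0 <;> simp [ha]

variable {d : Fin n → ℤ} {M : (Fin n ⊕ Fin r → ℤ) → K}
  {B : Matrix (Fin n ⊕ Fin r) (Fin n) ℤ} {ω : LinearMap.BilinForm ℤ (Fin n ⊕ Fin r → ℤ)}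

theorem IsQSeed.apply_mulVec (h : IsQSeed d M B ω) (x : Fin n → ℤ) (c : Fin n ⊕ Fin r → ℤ) :
    ω (B.mulVec x) c = ∑ l, d l * x l * c (Sum.inl l) := by
  have h1 : B.mulVec x = ∑ l, x l • matCol B l := by
    ext i
    simp [Matrix.mulVec, dotProduct, mul_comm]
  rw [h1, map_sum, LinearMap.sum_apply]
  refine Finset.sum_congr rfl fun l _ => ?_
  rw [map_smul, LinearMap.smul_apply, h.compat, smul_eq_mul]
  ring

/-- Pairing `B x` with `e_l` recovers `d l * x l`. -/
theorem IsQSeed.mulVec_injective (hd : ∀ j, 0 < d j) (h : IsQSeed d M B ω) :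
    Function.Injective B.mulVec := by
  intro x y hxy
  ext l
  have h1 : ω (B.mulVec x) (Pi.single (Sum.inl l) 1) = ω (B.mulVec y) (Pi.single (Sum.inl l) 1) := by
    rw [hxy]
  rw [h.apply_mulVec, h.apply_mulVec] at h1
  simpa [Pi.single_apply, (hd l).ne'] using h1

theorem IsQSeed.qEval_injective (hd : ∀ j, 0 < d j) (h : IsQSeed d M B ω) :
    Function.Injective (qEval M B) :=
  (h.torus.linInd.comp _ ((h.mulVec_injective hd).comp natVec_injective))

/-- By compatibility, `ω (B a) (B b)` involves only `d`, `a` and the principal rows of `B b`. The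
product of quantum polynomials is therefore independent of the frozen rows and of the rest of the
form. -/
theorem IsQSeed.qEval_qMul (h : IsQSeed d M B ω) (F G : QuantumPolynomial n) :
    qEval M B (qMul B.toRows₁ d F G) = qEval M B F * qEval M B G := by
  induction F using Finsupp.induction_linear with
  | zero => simp [qMul]
  | add f g hf hg =>
    unfold qMul at hf hg ⊢
    rw [map_add, map_add, map_add, hf, hg, add_mul]
  | single a s =>
    rw [qMul, Finsupp.linearCombination_single]
    induction G using Finsupp.induction_linear with
    | zero => simp
    | add f g hf hg => rw [map_add, smul_add, map_add, hf, hg, map_add, mul_add]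
    | single b s' =>
      simp only [qEval, Finsupp.linearCombination_single, Finsupp.smul_single, smul_eq_mul]
      rw [natVec_add, Matrix.mulVec_add, smul_mul_assoc, mul_smul_comm, h.torus.form,
        h.apply_mulVec, smul_smul, smul_smul, mul_assoc]
      rfl

/-- Again by compatibility, only the principal part of `c` enters the commutation of `M c` with the
`Ŷ_l`. -/
theorem IsQSeed.frame_mul_qEval (h : IsQSeed d M B ω) (c : Fin n ⊕ Fin r → ℤ)
    (F : QuantumPolynomial n) :
    M c * qEval M B F = qEval M B (qTwist d (fun i => c (Sum.inl i)) F) * M c := by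
  induction F using Finsupp.induction_linear with
  | zero => simp
  | add f g hf hg => rw [map_add, mul_add, hf, hg, map_add, map_add, add_mul]
  | single a s =>
    simp only [qEval, qTwist, Finsupp.linearCombination_single, Finsupp.smul_single, smul_eq_mul]
    rw [smul_mul_assoc, mul_smul_comm, h.torus.comm, h.torus.skew, h.apply_mulVec, smul_smul,
      mul_neg]

/-- A quantum polynomial with constant term `1` has leading term `1`. -/
theorem IsQSeed.qEval_sub_one_mem (hd : ∀ j, 0 < d j) (h : IsQSeed d M B ω)
    {F : QuantumPolynomial n} (hF : F 0 = 1) :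
    qEval M B F - 1 ∈ frameSpan M (Set.range (fun a => B.mulVec (natVec a)) ∩
      {c | 1 ≤ ω.flip (Sum.elim 1 0) c}) := by
  classical
  have h1 : qEval M B F = F.sum fun a s => s • M (B.mulVec (natVec a)) := rfl
  have h2 : (0 : Fin n →₀ ℕ) ∈ F.support := by rw [Finsupp.mem_support_iff, hF]; exact one_ne_zero
  rw [h1, Finsupp.sum, ← Finset.add_sum_erase _ _ h2, hF, one_smul, natVec_zero,
    Matrix.mulVec_zero, h.torus.frame_zero, add_sub_cancel_left]
  refine Submodule.sum_mem _ fun a ha => Submodule.smul_mem _ _ (mem_frameSpan ⟨⟨a, rfl⟩, ?_⟩)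
  have ha0 : a ≠ 0 := Finset.ne_of_mem_erase ha
  obtain ⟨i, hi⟩ : ∃ i, a i ≠ 0 := by
    by_contra! h
    exact ha0 (Finsupp.ext h)
  have h3 : ω.flip (Sum.elim 1 0) (B.mulVec (natVec a)) = ∑ l, d l * a l := by
    change ω (B.mulVec (natVec a)) (Sum.elim 1 0) = _
    rw [h.apply_mulVec]
    simp
  simp only [Set.mem_ofPred_eq, h3]
  have h4 := Finset.single_le_sum (f := fun l => d l * (a l : ℤ))
    (fun l _ => mul_nonneg (hd l).le (by positivity)) (Finset.mem_univ i)
  have h5 : 1 * 1 ≤ d i * (a i : ℤ) :=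
    mul_le_mul (hd i) (by omega) (by norm_num) (hd i).le
  linarith

theorem mem_frameSpan_range_iff {x : K} :
    x ∈ frameSpan M (Set.range fun a => B.mulVec (natVec a)) ↔ ∃ F, qEval M B F = x := by
  rw [frameSpan, ← Set.range_comp, Finsupp.mem_span_range_iff_exists_finsupp]
  rfl

/-- Left division by a quantum polynomial with constant term `1`. -/
theorem IsQSeed.exists_qEval_eq (hd : ∀ j, 0 < d j) (h : IsQSeed d M B ω)
    {F P : QuantumPolynomial n} (hF : F 0 = 1) {x : K} (hx : x ∈ torusSpan M)
    (hP : qEval M B F * x = qEval M B P) : ∃ G, qEval M B G = x := by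
  rw [← mem_frameSpan_range_iff]
  refine h.torus.mem_frameSpan_of_mul_mem _ ?_ (h.qEval_sub_one_mem hd hF) hx
    (mem_frameSpan_range_iff.mpr ⟨P, hP.symm⟩)
  rintro _ ⟨a, rfl⟩ _ ⟨b, rfl⟩
  exact ⟨a + b, by simp [Matrix.mulVec_add]⟩

theorem IsQSeed.qEval_ne_zero (hd : ∀ j, 0 < d j) (h : IsQSeed d M B ω)
    {F : QuantumPolynomial n} (hF : F 0 = 1) : qEval M B F ≠ 0 := by
  intro h0
  rw [map_eq_zero_iff _ (h.qEval_injective hd)] at h0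
  rw [h0] at hF
  exact zero_ne_one hF

/-! ### Normalized monomials -/

theorem QTorus.prod_ofFn {ι : Type*} {M : (ι → ℤ) → K} {ω : LinearMap.BilinForm ℤ (ι → ℤ)}
    (h : QTorus M ω) {m : ℕ} (v : Fin m → ι → ℤ) :
    (List.ofFn fun i => M (v i)).prod =
      (T (∑ i, ∑ j ∈ Finset.Ioi i, ω (v i) (v j)) : ℤ[T;T⁻¹]) • M (∑ i, v i) := by
  induction m with
  | zero => simp [h.frame_zero]
  | succ m ih =>
    rw [List.ofFn_succ, List.prod_cons, ih, mul_smul_comm, h.form, T_smul_T_smul,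
      Fin.sum_univ_succ, Fin.sum_univ_succ, Fin.sum_Ioi_zero, map_sum, add_comm]
    simp only [Fin.sum_Ioi_succ]

/-- Multiplying out the ordered product gives the exponents `d_i b_ij a_i a_j`, and skew-symmetry of
`d_i b_ij` cancels them against the normalizing ones. -/
theorem IsQSeed.eval_eq (h : IsQSeed d M B ω) (F : QuantumPolynomial n) :
    F.eval B.toRows₁ d (yHat M B) = qEval M B F := by
  have h1 : qEval M B F = F.sum fun a s => s • M (B.mulVec (natVec a)) := rfl
  rw [QuantumPolynomial.eval, h1]
  refine Finsupp.sum_congr fun a _ => ?_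
  congr 1
  have h2 : ∀ i, yHat M B i ^ a i = M ((a i : ℤ) • matCol B i) := fun i => h.torus.frame_pow _ _
  simp only [h2]
  rw [h.torus.prod_ofFn, T_smul_T_smul]
  have h3 : ∑ i, (a i : ℤ) • matCol B i = B.mulVec (natVec a) := by
    ext i
    simp [Matrix.mulVec, dotProduct, mul_comm]
  rw [h3, ← Finset.sum_add_distrib, Finset.sum_eq_zero, T_zero_smul]
  intro i _
  rw [← Finset.sum_add_distrib]
  refine Finset.sum_eq_zero fun j _ => ?_
  rw [map_smul, map_smul, LinearMap.smul_apply, h.compat]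
  have h4 := h.skew i j
  simp only [Matrix.toRows₁_apply, smul_eq_mul]
  linear_combination (a i : ℤ) * (a j : ℤ) * h4

end Evaluation

noncomputable section Separation

/-! ### Separation of additions for quantum cluster variables -/

variable {n r : ℕ} {K : Type*} [DivisionRing K] [Algebra ℤ[T;T⁻¹] K]
  {d : Fin n → ℤ} {s : QuantumSeed n r K} {ω : LinearMap.BilinForm ℤ (Fin n ⊕ Fin r → ℤ)}
  {B0 : Matrix (Fin n) (Fin n) ℤ} {w : List (Fin n)} {k : Fin n}

/-- Since a mutation may use the column or its negative, it may use the one selected by the tropical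
sign. The form then evolves by the same linear maps that build `gMap`. -/
theorem QuantumSeed.isMutation_tropCol (hd : ∀ j, 0 < d j) (h : IsQSeed d s.frame s.mat ω)
    (w : List (Fin n)) (k : Fin n) :
    IsMutation (formAlong d s ω w) (Sum.inl k) (tropCol s.mat w k)
        (s.along d w).frame (s.along d (k :: w)).frame ∧
      formAlong d s ω (k :: w) = (formAlong d s ω w).compl₁₂
        (mutLin (Sum.inl k) (tropCol s.mat w k)) (mutLin (Sum.inl k) (tropCol s.mat w k)) := by
  have hw := h.along hd w
  have h1 := s.isMutation_along hd hw k
  have hb := hw.compatCol k (hd k).ne'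
  rw [tropCol, ← s.along_mat d w]
  rcases tropSign_eq s.mat.toRows₁ w k with hs | hs <;> rw [hs]
  · rw [one_smul]
    exact ⟨h1, rfl⟩
  · rw [neg_one_smul]
    exact ⟨h1.flip hw.torus hb, (compl_mutLin_neg hw.torus hb).symm⟩

/-- The form at a vertex, expressed by the `g`-vectors. -/
theorem IsQSeed.formAlong_apply (hd : ∀ j, 0 < d j) (h : IsQSeed d s.frame s.mat ω)
    (w : List (Fin n)) (c c' : Fin n ⊕ Fin r → ℤ) :
    formAlong d s ω w c c' = ω (gMap s.mat w c) (gMap s.mat w c') := by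
  induction w generalizing c c' with
  | nil => rfl
  | cons k w ih =>
    rw [(s.isMutation_tropCol hd h w k).2, LinearMap.compl₁₂_apply, ih]
    rfl

theorem IsQSeed.along_frame_frozen (hd : ∀ j, 0 < d j) (h : IsQSeed d s.frame s.mat ω)
    (w : List (Fin n)) {c : Fin n ⊕ Fin r → ℤ} (hc : ∀ i, c (Sum.inl i) = 0) :
    (s.along d w).frame c = s.frame c := by
  induction w with
  | nil => rfl
  | cons k w ih => rw [(s.isMutation_along hd (h.along hd w) k).agree c (hc k), ih]

/-- The frame element of exponent `c` at the vertex reached along `w` is the value of `F` times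
the initial frame element of its `g`-vector. -/
def Represents (d : Fin n → ℤ) (s : QuantumSeed n r K) (w : List (Fin n))
    (c : Fin n ⊕ Fin r → ℤ) (F : QuantumPolynomial n) : Prop :=
  (s.along d w).frame c = qEval s.frame s.mat F * s.frame (gMap s.mat w c)

/-- The principal part of a combination of `g`-vectors. -/
def gTop (B0 : Matrix (Fin n) (Fin n) ℤ) (w : List (Fin n)) (x : Fin n → ℤ) : Fin n → ℤ :=
  fun i => gMap (principalMatrix B0) w (Sum.elim x 0) (Sum.inl i)

theorem gMap_inl_eq_gTop {B : Matrix (Fin n ⊕ Fin r) (Fin n) ℤ} (hB : B.toRows₁ = B0)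
    (w : List (Fin n)) {c : Fin n ⊕ Fin r → ℤ} {x : Fin n → ℤ} (hc : ∀ i, c (Sum.inl i) = x i) :
    (fun i => gMap B w c (Sum.inl i)) = gTop B0 w x := by
  funext i
  exact gMap_inl (by rw [hB]; ext; rfl) w (by simpa using hc) i

/-- Moving the initial frame element of the first factor past the second polynomial produces the
twist. The power of `q` from merging the two initial monomials cancels that from splitting `c + c'`,
because the form at `w` is the initial form on `g`-vectors. -/
theorem Represents.add (hd : ∀ j, 0 < d j) (h : IsQSeed d s.frame s.mat ω)
    (hB : s.mat.toRows₁ = B0) {c c' : Fin n ⊕ Fin r → ℤ} {x : Fin n → ℤ}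
    (hc : ∀ i, c (Sum.inl i) = x i) {F F' : QuantumPolynomial n}
    (hF : Represents d s w c F) (hF' : Represents d s w c' F') :
    Represents d s w (c + c') (qMul B0 d F (qTwist d (gTop B0 w x) F')) := by
  unfold Represents at hF hF' ⊢
  rw [(h.along hd w).torus.form.add, hF, hF', ← hB, h.qEval_qMul, hB, ← gMap_inl_eq_gTop hB w hc,
    mul_assoc, ← mul_assoc (s.frame _), h.frame_mul_qEval, mul_assoc _ (s.frame _), h.torus.form,
    h.formAlong_apply hd, mul_smul_comm, mul_smul_comm, T_smul_T_smul, neg_add_cancel, T_zero_smul,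
    map_add, mul_assoc]

/-- The exponents of the cluster variables in the two terms of the exchange relation. -/
def exchangeExp (B0 : Matrix (Fin n) (Fin n) ℤ) (w : List (Fin n)) (k : Fin n) (ε : ℤ) :
    Fin n →₀ ℕ :=
  Finsupp.equivFunOnFinite.symm fun i =>
    (ε * tropSign B0 w k * matAlong (principalMatrix B0) w (Sum.inl i) k).toNat

/-- The `c`-vector multiplied by its sign. -/
def absCVec (B0 : Matrix (Fin n) (Fin n) ℤ) (w : List (Fin n)) (k : Fin n) : Fin n →₀ ℕ :=
  Finsupp.equivFunOnFinite.symm fun i => (tropSign B0 w k * cVec B0 w k i).toNat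

theorem natVec_absCVec (hsc : SignCoherent B0) (hkw : (k :: w).IsChain (· ≠ ·)) :
    natVec (absCVec B0 w k) = tropSign B0 w k • cVec B0 w k := by
  ext i
  exact Int.toNat_of_nonneg (hsc w k hkw i)

theorem gMap_tropCol (hd : ∀ j, 0 < d j) (h : IsQSeed d s.frame s.mat ω)
    (hB : s.mat.toRows₁ = B0) (hsc : SignCoherent B0) (hkw : (k :: w).IsChain (· ≠ ·)) :
    gMap s.mat w (tropCol s.mat w k) = s.mat.mulVec (natVec (absCVec B0 w k)) := by
  have hw : w.IsChain (· ≠ ·) := by cases w <;> simp_all [List.isChain_cons_cons]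
  rw [tropCol, map_smul, gMap_matCol hd h.skew (hB ▸ hsc) hw, natVec_absCVec hsc hkw, hB,
    Matrix.mulVec_smul]

theorem formAlong_tropCol (hd : ∀ j, 0 < d j) (h : IsQSeed d s.frame s.mat ω)
    (w : List (Fin n)) (k : Fin n) (c : Fin n ⊕ Fin r → ℤ) :
    formAlong d s ω w (tropCol s.mat w k) c =
      tropSign s.mat.toRows₁ w k * (d k * c (Sum.inl k)) := by
  rw [tropCol, map_smul, LinearMap.smul_apply, ← s.along_mat d w, (h.along hd w).compat,
    smul_eq_mul]

/-- Otherwise `gMap` would send the signed column to zero, although its pairing with `e_k` at `w` is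
`± d k`. -/
theorem absCVec_ne_zero (hd : ∀ j, 0 < d j) (h : IsQSeed d s.frame s.mat ω)
    (hB : s.mat.toRows₁ = B0) (hsc : SignCoherent B0) (hkw : (k :: w).IsChain (· ≠ ·)) :
    absCVec B0 w k ≠ 0 := by
  intro h0
  have h1 := formAlong_tropCol hd h w k (Pi.single (Sum.inl k) 1)
  rw [h.formAlong_apply hd, gMap_tropCol hd h hB hsc hkw, h0, natVec_zero, Matrix.mulVec_zero,
    map_zero, LinearMap.zero_apply, Pi.single_eq_same, mul_one] at h1
  have h2 := hd k
  rcases tropSign_eq s.mat.toRows₁ w k with hs | hs <;> rw [hs] at h1 <;> omega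

/-- The exchange polynomial. -/
def exchangePoly (B0 : Matrix (Fin n) (Fin n) ℤ) (d : Fin n → ℤ) (w : List (Fin n)) (k : Fin n)
    (P P' : QuantumPolynomial n) : QuantumPolynomial n :=
  P + (T (-(tropSign B0 w k * d k)) : ℤ[T;T⁻¹]) •
    qMul B0 d P' (Finsupp.single (absCVec B0 w k) 1)

theorem exchangePoly_apply_zero {P P' : QuantumPolynomial n} (h : absCVec B0 w k ≠ 0) :
    exchangePoly B0 d w k P P' 0 = P 0 := by
  rw [exchangePoly, Finsupp.add_apply, Finsupp.smul_apply, qMul_apply_zero,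
    Finsupp.single_eq_of_ne (Ne.symm h), mul_zero, smul_zero, add_zero]

/-- The exchange relation, separated. -/
theorem IsQSeed.qEval_mul_eq (hd : ∀ j, 0 < d j) (h : IsQSeed d s.frame s.mat ω)
    (hB : s.mat.toRows₁ = B0) (hsc : SignCoherent B0) (hkw : (k :: w).IsChain (· ≠ ·))
    {F P P' : QuantumPolynomial n} (hF : Represents d s w (Pi.single (Sum.inl k) 1) F)
    (hP : ∀ c, (∀ i, c (Sum.inl i) = natVec (exchangeExp B0 w k (-1)) i) → Represents d s w c P)
    (hP' : ∀ c, (∀ i, c (Sum.inl i) = natVec (exchangeExp B0 w k 1) i) → Represents d s w c P') :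
    qEval s.frame s.mat F * (s.frame (gMap s.mat w (Pi.single (Sum.inl k) 1)) *
        ((s.along d (k :: w)).frame (Pi.single (Sum.inl k) 1) *
          (s.frame (gMap s.mat (k :: w) (Pi.single (Sum.inl k) 1)))⁻¹) *
        (s.frame (gMap s.mat w (Pi.single (Sum.inl k) 1)))⁻¹) =
      qEval s.frame s.mat (exchangePoly B0 d w k P P') := by
  set b := tropCol s.mat w k with hb
  set v := exVec (Sum.inl k) b with hv
  set e : Fin n ⊕ Fin r → ℤ := Pi.single (Sum.inl k) 1 with he
  have hbi : ∀ i, b (Sum.inl i) =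
      tropSign B0 w k * matAlong (principalMatrix B0) w (Sum.inl i) k := by
    intro i
    rw [hb, tropCol, hB, Pi.smul_apply, smul_eq_mul]
    congr 1
    exact matAlong_inl (by rw [hB]; ext; rfl) w i k
  have hbk : b (Sum.inl k) = 0 := by
    rw [hb, tropCol, Pi.smul_apply, matCol, matAlong_diag hd h.skew, smul_zero]
  have hw := h.along hd w
  have hu0 : (e + v) (Sum.inl k) = 0 := by simp [he, hv, exVec_self]
  have hR : (s.along d w).frame (e + v) =
      qEval s.frame s.mat P * s.frame (gMap s.mat w (e + v)) := by
    refine hP _ fun i => ?_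
    have h1 := hbi i
    change _ = (((-1 * tropSign B0 w k *
      matAlong (principalMatrix B0) w (Sum.inl i) k).toNat : ℕ) : ℤ)
    rw [mul_assoc, ← h1]
    by_cases hi : i = k
    · subst hi; rw [hu0, hbk]; rfl
    · have hi' : (Sum.inl i : Fin n ⊕ Fin r) ≠ Sum.inl k := by simpa using hi
      rw [Pi.add_apply, hv, exVec_of_ne _ _ hi', he, Pi.single_eq_of_ne hi']
      omega
  have hR' : (s.along d w).frame (e + (v + b)) =
      qEval s.frame s.mat P' * s.frame (gMap s.mat w (e + (v + b))) := by
    refine hP' _ fun i => ?_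
    have h1 := hbi i
    change _ = (((1 * tropSign B0 w k *
      matAlong (principalMatrix B0) w (Sum.inl i) k).toNat : ℕ) : ℤ)
    rw [mul_assoc, ← h1, ← add_assoc, Pi.add_apply]
    by_cases hi : i = k
    · subst hi; rw [hu0, hbk]; rfl
    · have hi' : (Sum.inl i : Fin n ⊕ Fin r) ≠ Sum.inl k := by simpa using hi
      rw [Pi.add_apply, hv, exVec_of_ne _ _ hi', he, Pi.single_eq_of_ne hi']
      omega
  have hgb := gMap_tropCol hd h hB hsc hkw
  have hbu : ω (gMap s.mat w b) (gMap s.mat w (e + v)) = 0 := by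
    rw [← h.formAlong_apply hd, formAlong_tropCol hd h, hu0, mul_zero, mul_zero]
  have heb : formAlong d s ω w e b = -(tropSign B0 w k * d k) := by
    rw [hw.torus.skew, formAlong_tropCol hd h, hB, he, Pi.single_eq_same, mul_one]
  -- Multiplying the exchange relation by the old variable leaves two frame elements with principal
  -- exponents `[-ε b]₊` and `[ε b]₊`, represented by `P` and `P'`. Their `g`-vectors differ by `B`
  -- applied to the absolute `c`-vector, which becomes the monomial factor in `exchangePoly`.
  have hmain : (s.along d w).frame e * (s.along d (k :: w)).frame e =
      qEval s.frame s.mat (exchangePoly B0 d w k P P') *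
        (s.frame (gMap s.mat w e) * s.frame (gMap s.mat w v)) := by
    have hex : (s.along d (k :: w)).frame e =
        (s.along d w).frame v + (s.along d w).frame (v + b) :=
      (s.isMutation_tropCol hd h w k).1.exchange
    rw [hex, mul_add, hw.torus.form, hw.torus.form, hR, hR',
      h.torus.form, ← h.formAlong_apply hd, map_add (formAlong d s ω w e), heb, ← map_add,
      ← add_assoc e v b, add_comm (e + v) b, map_add _ b, h.torus.form.add, hbu, neg_zero,
      T_zero_smul, LaurentPolynomial.T_add, mul_smul, ← smul_add, mul_smul_comm, exchangePoly,
      map_add (qEval _ _), map_smul (qEval _ _), add_mul, ← hB, h.qEval_qMul, hB, smul_mul_assoc, mul_assoc (qEval _ _ P')]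
    congr 5
    rw [hgb, qEval, Finsupp.linearCombination_single, one_smul]
  have hg : gMap s.mat (k :: w) e = gMap s.mat w v := by
    rw [gMap, LinearMap.comp_apply, he, mutLin_single]
  have hne := h.torus.ne_zero
  rw [hg, mul_assoc (s.frame _), mul_assoc ((s.along d (k :: w)).frame e), ← mul_inv_rev,
    ← mul_assoc, ← mul_assoc, eq_comm, eq_mul_inv_iff_mul_eq₀ (mul_ne_zero (hne _) (hne _)),
    ← hmain, hF]

/-- Undoing the conjugation by a frame element only twists `G`, by the negative of the principal
part of its exponent. -/
theorem IsQSeed.represents_of_conj_eq (h : IsQSeed d s.frame s.mat ω)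
    {c c' : Fin n ⊕ Fin r → ℤ} {G : QuantumPolynomial n} {w' : List (Fin n)}
    (hG : s.frame (gMap s.mat w c) * ((s.along d w').frame c' *
      (s.frame (gMap s.mat w' c'))⁻¹) * (s.frame (gMap s.mat w c))⁻¹ = qEval s.frame s.mat G) :
    Represents d s w' c' (qTwist d (fun i => -gMap s.mat w c (Sum.inl i)) G) := by
  have hne := h.torus.ne_zero
  rw [mul_inv_eq_iff_eq_mul₀ (hne _), ← eq_inv_mul_iff_mul_eq₀ (hne _), ← h.torus.frame_neg (gMap s.mat w c),
    ← mul_assoc, h.frame_mul_qEval, mul_assoc, h.torus.frame_neg (gMap s.mat w c), inv_mul_cancel₀ (hne _), mul_one,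
    mul_inv_eq_iff_eq_mul₀ (hne _)] at hG
  exact hG

end Separation

noncomputable section Comparison

/-! ### The quantum `F`-polynomials do not depend on the cluster algebra -/

section pair

variable {n r₁ r₂ : ℕ} {K₁ K₂ : Type*} [DivisionRing K₁] [Algebra ℤ[T;T⁻¹] K₁]
  [DivisionRing K₂] [Algebra ℤ[T;T⁻¹] K₂] {d : Fin n → ℤ}
  {s₁ : QuantumSeed n r₁ K₁} {ω₁ : LinearMap.BilinForm ℤ (Fin n ⊕ Fin r₁ → ℤ)}
  {s₂ : QuantumSeed n r₂ K₂} {ω₂ : LinearMap.BilinForm ℤ (Fin n ⊕ Fin r₂ → ℤ)}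
  {B0 : Matrix (Fin n) (Fin n) ℤ}
  (hd : ∀ j, 0 < d j) (h₁ : IsQSeed d s₁.frame s₁.mat ω₁) (h₂ : IsQSeed d s₂.frame s₂.mat ω₂)
  (hB₁ : s₁.mat.toRows₁ = B0) (hB₂ : s₂.mat.toRows₁ = B0)

theorem IsQSeed.represents_frozen {n r : ℕ} {K : Type*} [DivisionRing K] [Algebra ℤ[T;T⁻¹] K]
    {d : Fin n → ℤ} {s : QuantumSeed n r K} {ω : LinearMap.BilinForm ℤ (Fin n ⊕ Fin r → ℤ)}
    (hd : ∀ j, 0 < d j) (h : IsQSeed d s.frame s.mat ω) (w : List (Fin n))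
    {c : Fin n ⊕ Fin r → ℤ} (hc : ∀ i, c (Sum.inl i) = 0) :
    Represents d s w c (Finsupp.single 0 1) := by
  rw [Represents, h.along_frame_frozen hd w hc, gMap_inr _ _ hc, qEval,
    Finsupp.linearCombination_single, natVec_zero, Matrix.mulVec_zero, h.torus.frame_zero, one_smul,
    one_mul]

theorem Represents.cons_of_eq_zero {n r : ℕ} {K : Type*} [DivisionRing K] [Algebra ℤ[T;T⁻¹] K]
    {d : Fin n → ℤ} {s : QuantumSeed n r K} {ω : LinearMap.BilinForm ℤ (Fin n ⊕ Fin r → ℤ)}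
    (hd : ∀ j, 0 < d j) (h : IsQSeed d s.frame s.mat ω) {w : List (Fin n)} {k : Fin n}
    {c : Fin n ⊕ Fin r → ℤ} (hc : c (Sum.inl k) = 0) {F : QuantumPolynomial n}
    (hF : Represents d s w c F) : Represents d s (k :: w) c F := by
  rw [Represents, (s.isMutation_along hd (h.along hd w) k).agree c hc, gMap, LinearMap.comp_apply,
    mutLin_of_eq_zero _ _ hc]
  exact hF

include hd h₁ h₂ hB₁ hB₂

/-- Common quantum polynomials for the frame elements with nonnegative principal exponents. -/
theorem exists_represents_natVec {w : List (Fin n)} {F : Fin n → QuantumPolynomial n}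
    (hF0 : ∀ j, F j 0 = 1) (hF₁ : ∀ j, Represents d s₁ w (Pi.single (Sum.inl j) 1) (F j))
    (hF₂ : ∀ j, Represents d s₂ w (Pi.single (Sum.inl j) 1) (F j)) (a : Fin n →₀ ℕ) :
    ∃ P : QuantumPolynomial n, P 0 = 1 ∧
      (∀ c, (∀ i, c (Sum.inl i) = natVec a i) → Represents d s₁ w c P) ∧
      (∀ c, (∀ i, c (Sum.inl i) = natVec a i) → Represents d s₂ w c P) := by
  have hzero : ∃ P : QuantumPolynomial n, P 0 = 1 ∧
      (∀ c, (∀ i, c (Sum.inl i) = natVec 0 i) → Represents d s₁ w c P) ∧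
      (∀ c, (∀ i, c (Sum.inl i) = natVec 0 i) → Represents d s₂ w c P) :=
    ⟨Finsupp.single 0 1, by simp, fun c hc => h₁.represents_frozen hd w (by simpa using hc),
      fun c hc => h₂.represents_frozen hd w (by simpa using hc)⟩
  have hadd : ∀ a b : Fin n →₀ ℕ,
      (∃ P : QuantumPolynomial n, P 0 = 1 ∧
        (∀ c, (∀ i, c (Sum.inl i) = natVec a i) → Represents d s₁ w c P) ∧
        (∀ c, (∀ i, c (Sum.inl i) = natVec a i) → Represents d s₂ w c P)) →
      (∃ P : QuantumPolynomial n, P 0 = 1 ∧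
        (∀ c, (∀ i, c (Sum.inl i) = natVec b i) → Represents d s₁ w c P) ∧
        (∀ c, (∀ i, c (Sum.inl i) = natVec b i) → Represents d s₂ w c P)) →
      ∃ P : QuantumPolynomial n, P 0 = 1 ∧
        (∀ c, (∀ i, c (Sum.inl i) = natVec (a + b) i) → Represents d s₁ w c P) ∧
        (∀ c, (∀ i, c (Sum.inl i) = natVec (a + b) i) → Represents d s₂ w c P) := by
    rintro a b ⟨P, hP0, hP₁, hP₂⟩ ⟨Q, hQ0, hQ₁, hQ₂⟩
    refine ⟨qMul B0 d P (qTwist d (gTop B0 w (natVec a)) Q), ?_, fun c hc => ?_, fun c hc => ?_⟩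
    · rw [qMul_apply_zero, qTwist_apply_zero, hP0, hQ0, one_mul]
    -- All of the frozen part of `c` is put into the second summand, so the polynomial depends on
    -- the principal part alone.
    · have h := (hP₁ (Sum.elim (natVec a) 0) (by simp)).add hd h₁ hB₁ (x := natVec a) (by simp)
        (hQ₁ (c - Sum.elim (natVec a) 0) (by simp [hc]))
      rwa [add_sub_cancel] at h
    · have h := (hP₂ (Sum.elim (natVec a) 0) (by simp)).add hd h₂ hB₂ (x := natVec a) (by simp)
        (hQ₂ (c - Sum.elim (natVec a) 0) (by simp [hc]))
      rwa [add_sub_cancel] at h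
  induction a using Finsupp.induction_linear with
  | zero => exact hzero
  | add a b ha hb => exact hadd a b ha hb
  | single j m =>
    induction m with
    | zero => rw [Finsupp.single_zero]; exact hzero
    | succ m ih =>
      rw [Finsupp.single_add]
      refine hadd _ _ ih ⟨qMul B0 d (F j) (qTwist d (gTop B0 w (Pi.single j 1))
        (Finsupp.single 0 1)), ?_, fun c hc => ?_, fun c hc => ?_⟩
      · rw [qMul_apply_zero, qTwist_apply_zero, hF0, Finsupp.single_eq_same, one_mul]
      · have h := (hF₁ j).add hd h₁ hB₁ (x := Pi.single j 1) (fun i => by simp [Pi.single_apply])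
          (h₁.represents_frozen hd w (c := c - Pi.single (Sum.inl j) 1) fun i => by
            simp [hc, Pi.single_apply, Finsupp.single_apply, eq_comm])
        rwa [add_sub_cancel] at h
      · have h := (hF₂ j).add hd h₂ hB₂ (x := Pi.single j 1) (fun i => by simp [Pi.single_apply])
          (h₂.represents_frozen hd w (c := c - Pi.single (Sum.inl j) 1) fun i => by
            simp [hc, Pi.single_apply, Finsupp.single_apply, eq_comm])
        rwa [add_sub_cancel] at h

/-- Two quantum cluster algebras with the same principal part have common quantum
`F`-polynomials. -/
theorem exists_represents (hsc : SignCoherent B0) {w : List (Fin n)} (hw : w.IsChain (· ≠ ·)) :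
    ∃ F : Fin n → QuantumPolynomial n, (∀ j, F j 0 = 1) ∧
      (∀ j, Represents d s₁ w (Pi.single (Sum.inl j) 1) (F j)) ∧
      (∀ j, Represents d s₂ w (Pi.single (Sum.inl j) 1) (F j)) := by
  classical
  induction w with
  | nil =>
    refine ⟨fun _ => Finsupp.single 0 1, by simp, fun j => ?_, fun j => ?_⟩
    · rw [Represents, qEval, Finsupp.linearCombination_single, natVec_zero, Matrix.mulVec_zero,
        h₁.torus.frame_zero, one_smul, one_mul]
      rfl
    · rw [Represents, qEval, Finsupp.linearCombination_single, natVec_zero, Matrix.mulVec_zero,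
        h₂.torus.frame_zero, one_smul, one_mul]
      rfl
  | cons k w ih =>
    have hw' : w.IsChain (· ≠ ·) := by cases w <;> simp_all [List.isChain_cons_cons]
    obtain ⟨F, hF0, hF₁, hF₂⟩ := ih hw'
    obtain ⟨P, hP0, hP₁, hP₂⟩ := exists_represents_natVec hd h₁ h₂ hB₁ hB₂ hF0 hF₁ hF₂
      (exchangeExp B0 w k (-1))
    obtain ⟨P', -, hP'₁, hP'₂⟩ := exists_represents_natVec hd h₁ h₂ hB₁ hB₂ hF0 hF₁ hF₂
      (exchangeExp B0 w k 1)
    have hex₁ := h₁.qEval_mul_eq hd hB₁ hsc hw (hF₁ k) hP₁ hP'₁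
    have hex₂ := h₂.qEval_mul_eq hd hB₂ hsc hw (hF₂ k) hP₂ hP'₂
    -- The Laurent phenomenon and the division are needed in the first algebra only.
    obtain ⟨G, hG⟩ := h₁.exists_qEval_eq hd (hF0 k) (by
      have hmem := s₁.laurent hd h₁ (k :: w) k
      rw [← h₁.torus.frame_neg, ← h₁.torus.frame_neg]
      exact h₁.torus.mul_mem (h₁.torus.mul_mem (frame_mem _ _)
        (h₁.torus.mul_mem hmem (frame_mem _ _))) (frame_mem _ _)) hex₁
    rw [← hG, ← h₁.qEval_qMul, hB₁, (h₁.qEval_injective hd).eq_iff] at hex₁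
    have hG0 : G 0 = 1 := by
      have := DFunLike.congr_fun hex₁ 0
      rwa [qMul_apply_zero, hF0, one_mul,
        exchangePoly_apply_zero (absCVec_ne_zero hd h₁ hB₁ hsc hw), hP0] at this
    -- The identity for `F k` and `G` now holds between quantum polynomials, hence after evaluation
    -- in the second algebra, where `F k` can be cancelled.
    have hG₂ := mul_left_cancel₀ (h₂.qEval_ne_zero hd (hF0 k))
      (hex₂.trans ((congrArg _ hex₁.symm).trans (hB₂ ▸ h₂.qEval_qMul (F k) G)))
    have hR₁ := h₁.represents_of_conj_eq hG.symm
    have hR₂ := h₂.represents_of_conj_eq hG₂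
    have htop : (fun i => -gMap s₂.mat w (Pi.single (Sum.inl k) 1) (Sum.inl i)) =
        fun i => -gMap s₁.mat w (Pi.single (Sum.inl k) 1) (Sum.inl i) := by
      funext i
      rw [gMap_inl (hB₂.trans hB₁.symm) w (c' := Pi.single (Sum.inl k) 1)
        (fun i => by simp [Pi.single_apply])]
    rw [htop] at hR₂
    refine ⟨Function.update F k
      (qTwist d (fun i => -gMap s₁.mat w (Pi.single (Sum.inl k) 1) (Sum.inl i)) G), ?_, ?_, ?_⟩
    · intro j
      by_cases hj : j = k
      · subst hj
        rw [Function.update_self, qTwist_apply_zero, hG0]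
      · rw [Function.update_of_ne hj, hF0]
    · intro j
      by_cases hj : j = k
      · subst hj
        rwa [Function.update_self]
      · rw [Function.update_of_ne hj]
        exact (hF₁ j).cons_of_eq_zero hd h₁ (by simp [Ne.symm hj])
    · intro j
      by_cases hj : j = k
      · subst hj
        rwa [Function.update_self]
      · rw [Function.update_of_ne hj]
        exact (hF₂ j).cons_of_eq_zero hd h₂ (by simp [Ne.symm hj])

end pair

section frames

variable {n r : ℕ} {K : Type*} [DivisionRing K] [Algebra ℤ[T;T⁻¹] K] {d : Fin n → ℤ}
  {M : (Fin n ⊕ Fin r → ℤ) → K} {B : Matrix (Fin n ⊕ Fin r) (Fin n) ℤ}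
  {Λ : Matrix (Fin n ⊕ Fin r) (Fin n ⊕ Fin r) ℤ} {B0 : Matrix (Fin n) (Fin n) ℤ}

theorem IsToricFrame.isQSeed (h : IsToricFrame M Λ) (hΛ : IsCompatible Λ B d) :
    IsQSeed d M B (Matrix.toBilin' Λ) where
  torus :=
    { form := fun c c' => by rw [h.form, Matrix.toBilin'_apply']
      skew := fun c c' => by
        rw [Matrix.toBilin'_apply', Matrix.toBilin'_apply', Matrix.dotProduct_mulVec,
          ← Matrix.mulVec_transpose, h.skew, Matrix.neg_mulVec, neg_dotProduct, dotProduct_comm]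
      linInd := h.linearIndependent }
  compat j c := by
    have h1 : ∀ i, (B.transpose * Λ) j i = Matrix.fromCols (Matrix.diagonal d) 0 j i :=
      fun i => congrFun (congrFun hΛ j) i
    have h2 : ∀ i, (Matrix.vecMul (matCol B j) Λ) i = (B.transpose * Λ) j i := fun i => rfl
    rw [Matrix.toBilin'_apply', Matrix.dotProduct_mulVec, dotProduct]
    simp only [h2, h1]
    simp [Fintype.sum_sum_type, Matrix.diagonal_apply]

theorem isCompatible_principalForm (B0 : Matrix (Fin n) (Fin n) ℤ) (d : Fin n → ℤ)
    (Λ : Matrix (Fin n) (Fin n) ℤ) :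
    IsCompatible (principalForm B0 d Λ) (principalMatrix B0) d := by
  rw [IsCompatible, principalForm, principalMatrix, Matrix.transpose_fromRows,
    Matrix.fromCols_mul_fromBlocks, Matrix.transpose_one, Matrix.one_mul, Matrix.one_mul]
  congr 1
  · abel
  · rw [Matrix.mul_sub, Matrix.mul_neg, Matrix.mul_assoc]
    abel

theorem principalForm_skew
    (hDB : (Matrix.diagonal d * B0).transpose = -(Matrix.diagonal d * B0)) :
    (principalForm B0 d 0).transpose = -principalForm B0 d 0 := by
  have h1 : B0.transpose * Matrix.diagonal d = -(Matrix.diagonal d * B0) := by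
    rw [← hDB, Matrix.transpose_mul, Matrix.diagonal_transpose]
  simp [principalForm, Matrix.fromBlocks_transpose, Matrix.fromBlocks_neg, h1, hDB]

/-- For principal coefficients the frozen part of the signed column is the signed `c`-vector. It is
nonnegative, so `mutLin` adds nothing to the frozen coordinates. -/
theorem gMap_principalMatrix_inr (hsc : SignCoherent B0) {w : List (Fin n)}
    (hw : w.IsChain (· ≠ ·)) {c : Fin n ⊕ Fin n → ℤ} (hc : ∀ i, c (Sum.inr i) = 0) (i : Fin n) :
    gMap (principalMatrix B0) w c (Sum.inr i) = 0 := by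
  induction w generalizing c with
  | nil => exact hc i
  | cons k w ih =>
    have hw' : w.IsChain (· ≠ ·) := by cases w <;> simp_all [List.isChain_cons_cons]
    refine ih hw' fun i => ?_
    have h1 : (principalMatrix B0).toRows₁ = B0 := by ext; rfl
    have h2 := hsc w k hw i
    rw [mutLin_apply_of_ne _ _ _ (by simp), hc, zero_add, tropCol, h1, max_eq_left, mul_zero]
    simpa [cVec] using h2

theorem gMap_principalMatrix_single (hd : ∀ j, 0 < d j)
    (h : ∀ i j, d i * B0 i j = -(d j * B0 j i)) (hsc : SignCoherent B0) (t : TreeVertex n)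
    (j : Fin n) :
    gMap (principalMatrix B0) t.1 (Pi.single (Sum.inl j) 1) = Sum.elim (gVector B0 j t) 0 := by
  ext (i | i)
  · rw [gVector_eq hd h hsc]; rfl
  · exact gMap_principalMatrix_inr hsc t.2 (by simp) i

end frames

/-- In any quantum cluster algebra the cluster variables are separated by the quantum
`F`-polynomials. -/
theorem represents_quantumFPolynomial {n r : ℕ} {K : Type*} [DivisionRing K] [Algebra ℤ[T;T⁻¹] K]
    {d : Fin n → ℤ} {s : QuantumSeed n r K} {ω : LinearMap.BilinForm ℤ (Fin n ⊕ Fin r → ℤ)}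
    {B0 : Matrix (Fin n) (Fin n) ℤ} (hd : ∀ j, 0 < d j)
    (hDB : (Matrix.diagonal d * B0).transpose = -(Matrix.diagonal d * B0))
    (h : IsQSeed d s.frame s.mat ω) (hB : s.mat.toRows₁ = B0) (hsc : SignCoherent B0)
    (t : TreeVertex n) (j : Fin n) :
    Represents d s t.1 (Pi.single (Sum.inl j) 1) (quantumFPolynomial B0 d j t) := by
  have hskew : ∀ i j, d i * B0 i j = -(d j * B0 j i) := fun i j => by
    simpa using congrFun (congrFun hDB j) i
  have hP : (principalMatrix B0).toRows₁ = B0 := by ext; rfl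
  -- The principal algebra with `Λ = 0` serves as reference: evaluation there is injective, so it
  -- pins down the polynomial.
  obtain ⟨K', _, _, M', hM'⟩ := exists_isToricFrame _ (principalForm_skew hDB)
  let s' : QuantumSeed n n K' := ⟨M', principalMatrix B0⟩
  have h' : IsQSeed d s'.frame s'.mat _ := hM'.isQSeed (isCompatible_principalForm B0 d 0)
  have hsep : ∀ {K'' : Type} [DivisionRing K''] [Algebra ℤ[T;T⁻¹] K'']
      {M'' : (Fin n ⊕ Fin n → ℤ) → K''} {Λ : Matrix (Fin n) (Fin n) ℤ}
      (hM'' : IsToricFrame M'' (principalForm B0 d Λ)) (F : QuantumPolynomial n),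
      Represents d ⟨M'', principalMatrix B0⟩ t.1 (Pi.single (Sum.inl j) 1) F ↔
        quantumClusterVar d M'' (principalMatrix B0) j t =
          F.eval B0 d (yHat M'' (principalMatrix B0)) * M'' (Sum.elim (gVector B0 j t) 0) := by
    intro K'' _ _ M'' Λ hM'' F
    have h'' := hM''.isQSeed (isCompatible_principalForm B0 d Λ)
    have h1 := h''.eval_eq F
    rw [hP] at h1
    rw [h1, ← gMap_principalMatrix_single hd hskew hsc]
    rfl
  have hinj : ∀ {F G : QuantumPolynomial n},
      Represents d s' t.1 (Pi.single (Sum.inl j) 1) F →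
      Represents d s' t.1 (Pi.single (Sum.inl j) 1) G → F = G := by
    intro F G hF hG
    exact h'.qEval_injective hd (mul_right_cancel₀ (h'.torus.ne_zero _) (hF.symm.trans hG))
  obtain ⟨F, -, hF, hF'⟩ := exists_represents hd h h' hB hP hsc t.2
  have hex : ∃ F, IsQuantumFPolynomial B0 d j t F := by
    refine ⟨F j, fun Λ _ K'' _ _ M'' hM'' => (hsep hM'' _).mp ?_⟩
    have h'' := hM''.isQSeed (isCompatible_principalForm B0 d Λ)
    -- For any other `Λ`, a polynomial common to that algebra and the reference algebra must be `F
    -- j`.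
    obtain ⟨G, -, hG, hG'⟩ := exists_represents (s₂ := ⟨M'', principalMatrix B0⟩)
      hd h' h'' hP hP hsc t.2
    rw [hinj (hF' j) (hG j)]
    exact hG' j
  have hdef : quantumFPolynomial B0 d j t = hex.choose := dif_pos hex
  have hspec := (hsep hM' _).mpr (hex.choose_spec 0 (by simp) K' M' hM')
  rw [hdef, hinj hspec (hF' j)]
  exact hF j

end Comparison
-- The theorem
theorem mainTheorem4 {n : ℕ} (B0 : Matrix (Fin n) (Fin n) ℤ) (d : Fin n → ℤ)
    (hd : ∀ j, 0 < d j)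
    (hDB : (Matrix.diagonal d * B0).transpose = -(Matrix.diagonal d * B0))
    (hF : ∀ (j : Fin n) (t : TreeVertex n),
      MvPolynomial.constantCoeff (fPolynomial B0 j t) ≠ 0)
    {r : ℕ} (B : Matrix (Fin n ⊕ Fin r) (Fin n) ℤ) (hB : B.toRows₁ = B0)
    (Λ0 : Matrix (Fin n ⊕ Fin r) (Fin n ⊕ Fin r) ℤ) (hΛ : IsCompatible Λ0 B d)
    {K : Type*} [DivisionRing K] [Algebra (LaurentPolynomial ℤ) K]
    (M0 : (Fin n ⊕ Fin r → ℤ) → K) (hM : IsToricFrame M0 Λ0) (t : TreeVertex n) :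
    (∀ j : Fin n,
      quantumClusterVar d M0 B j t =
        (quantumFPolynomial B0 d j t).eval B0 d (yHat M0 B) * M0 (extGVector B (Sum.inl j) t)) ∧
    HasForm (frameAt d M0 B t)
      (Matrix.of fun i j => extGVector B i t ⬝ᵥ Λ0.mulVec (extGVector B j t)) := by
  subst hB
  have hsc : SignCoherent B.toRows₁ :=
    signCoherent_of_constantCoeff (B0 := B.toRows₁) hF
  have h : IsQSeed d (QuantumSeed.mk M0 B).frame (QuantumSeed.mk M0 B).mat _ := hM.isQSeed hΛ
  refine ⟨fun j => ?_, fun c c' => ?_⟩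
  · rw [h.eval_eq, extGVector_eq hd h.skew hF]
    exact represents_quantumFPolynomial hd hDB h rfl hsc t j
  · have hform := (h.along hd t.1).torus.form c c'
    rw [h.formAlong_apply hd, Matrix.toBilin'_apply'] at hform
    rw [frameAt, hform]
    congr 2
    simp only [← Matrix.toBilin'_apply']
    -- The form on `g`-vectors is bilinear in `c` and `c'`, so expansion in unit vectors gives the
    -- matrix entries.
    conv_lhs => rw [← Finset.univ_sum_single c, ← Finset.univ_sum_single c']
    have hg : ∀ (i : Fin n ⊕ Fin r) (x : ℤ),
        gMap B t.1 (Pi.single i x) = x • extGVector B i t := fun i x => by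
      rw [extGVector_eq hd h.skew hF, ← map_smul, ← Pi.single_smul, smul_eq_mul, mul_one]
    simp only [map_sum, LinearMap.sum_apply, hg, map_smul, LinearMap.smul_apply, smul_eq_mul]
    rw [Matrix.toBilin'_apply, Finset.sum_comm]
    refine Finset.sum_congr rfl fun i _ => ?_
    rw [Finset.mul_sum]
    refine Finset.sum_congr rfl fun l _ => ?_
    rw [Matrix.of_apply]
    ring
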